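/- **Setting.** Let $\Omega\subset\mathbb R^2$ be bounded and open, let $D\subset\Omega$ (the observation region) be measurable, and let $\varepsilon,\gamma,\mu>0$. Let $H^1_0(\Omega)^2$ be the closure of $C_c^\infty(\Omega)^2$ in the $H^1$ norm, $V=\{\psi\in H^1_0(\Omega)^2:\operatorname{div}\psi=0\}$, and let $H$ be the space of $\psi\in L^2(\Omega)^2$ with $\operatorname{div}\psi=0$ in $\Omega$ and $\psi\cdot n=0$ on $\partial\Omega$ in the weak sense, i.e. $\int_\Omega\psi\cdot\nabla q\,dx=0$ for all $q\in H^1(\Omega)$. Let $c_P,c_L>0$ be constants such that for all $v\in H^1_0(\Omega)^2$ $$\|v\|_{L^2}\le c_P\|\nabla v\|_{L^2},\qquad \|v\|_{L^4}\le\sqrt{c_L}\,\|v\|_{L^2}^{1/2}\|\nabla v\|_{L^2}^{1/2}.$$ **Data.** Let $\alpha,\beta:\mathbb R\to[0,\infty)$ be Lipschitz continuous with $\alpha(1)=\beta(1)=0$ and $\alpha(-1),\beta(-1)>0$. Let $u_d\in L^2(D)^2$, $u_0\in H$, $f_s\in L^2(\Omega)^2$, and let $f$ belong to $L^2(0,T;L^2(\Omega)^2)$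 for every $T>0$. Assume $$2c_P^2c_L\|f_s\|_{L^2}<\mu^2,$$ and that there is $K>0$ such that for all $T>0$ $$\int_0^T e^{\lambda t}\|f(t)-f_s\|_{L^2}^2\,dt\le K,\qquad \lambda=\frac{\mu^4-2c_L^2c_P^4\|f_s\|_{L^2}^2}{c_P^2\mu^3}.$$ **States.** Let $\Phi_{ad}=\{\varphi\in H^1(\Omega):|\varphi|\le1\text{ a.e.}\}$, and put $a_\varphi(u,v)=\mu\int_\Omega\nabla u:\nabla v\,dx+\int_\Omega\alpha(\varphi)\,u\cdot v\,dx$ and $b(u,v,w)=\int_\Omega[(u\cdot\nabla)v]\cdot w\,dx$. For $\varphi\in\Phi_{ad}$: * a stationary state for $\varphi$ is $v\in V$ with $a_\varphi(v,\psi)+b(v,v,\psi)=(f_s,\psi)_{L^2}$ for all $\psi\in V$; * for $T>0$, a time-dependent state for $\varphi$ is $u\in L^2(0,T;V)$ with $\partial_tu\in L^2(0,T;V^*)$ such that $\langle\partial_tu(t),\psi\rangle+a_\varphi(u(t),\psi)+b(u(t),u(t),\psi)=(f(t),\psi)_{L^2}$ for a.e. $t\in(0,T)$ and all $\psi\in V$,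 and $u(0)=u_0$ (for the representative of $u$ that is continuous from $[0,T]$ to $L^2(\Omega)^2$). **Objectives.** With $\Psi(s)=(1-s^2)/2$ on $[-1,1]$ and $c_0=\frac12\int_{-1}^1\sqrt{2\Psi(s)}\,ds$, let $$\mathbb E_\varepsilon(\varphi)=\frac1{2c_0}\int_\Omega\Big(\frac\varepsilon2|\nabla\varphi|^2+\frac1\varepsilon\Psi(\varphi)\Big)dx,$$ $$J_T(u,\varphi)=\frac1T\int_0^T\Big[\int_\Omega\tfrac{\varphi+1}2|u-u_d|^2\chi_D\,dx+\int_\Omega\beta(\varphi)|u|^2\,dx\Big]dt+\gamma\,\mathbb E_\varepsilon(\varphi),$$ $$J_s(v,\varphi)=\int_\Omega\tfrac{\varphi+1}2|v-u_d|^2\chi_D\,dx+\int_\Omega\beta(\varphi)|v|^2\,dx+\gamma\,\mathbb E_\varepsilon(\varphi).$$ A design $\varphi^T\in\Phi_{ad}$ with time-dependent state $u^T$ is a global minimizer of the time-dependent problem if $J_T(u^T,\varphi^T)\le J_T(u,\varphi)$ for all $\varphi\in\Phi_{ad}$ and all time-dependent states $u$ for $\varphi$; a global minimizer $\varphi^s$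 of the stationary problem, with stationary state $v^s$, is defined in the same way through $J_s$. Write $J_T(\varphi^T)=J_T(u^T,\varphi^T)$ and $J_s(\varphi^s)=J_s(v^s,\varphi^s)$. **Theorem.** There is a constant $c>0$, independent of $T$, such that for every $T>0$ and all global minimizers $\varphi^T$ of the time-dependent problem and $\varphi^s$ of the stationary problem $$|J_T(\varphi^T)-J_s(\varphi^s)|\le c\Big(\frac1{\sqrt T}+\frac1T\Big).$$ -/

import Mathlib

open MeasureTheory Set
open scoped ContDiff InnerProductSpace

noncomputable section

namespace PhaseFieldNS

/-- The plane with its Euclidean norm. -/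
abbrev Plane : Type := EuclideanSpace ℝ (Fin 2)

/-- `2 × 2` matrices with the Frobenius norm; the entry `(i, j)` of a velocity gradient is
`∂ⱼ uᵢ`. -/
abbrev Mat2 : Type := EuclideanSpace ℝ (Fin 2 × Fin 2)

/-- The Lebesgue space `L²(D; F)`. -/
abbrev L2 (D : Set Plane) (F : Type) [NormedAddCommGroup F] : Type :=
  Lp F 2 ((volume : Measure Plane).restrict D)

/-- Smooth functions with compact support in `D`. -/
structure IsTestFunction {F : Type} [NormedAddCommGroup F] [NormedSpace ℝ F]
    (D : Set Plane) (η : Plane → F) : Prop where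
  smooth : ContDiff ℝ ∞ η
  compact : HasCompactSupport η
  support : tsupport η ⊆ D

/-- The partial derivative `∂ⱼ η` of a smooth function. -/
def partialD {F : Type} [NormedAddCommGroup F] [NormedSpace ℝ F]
    (j : Fin 2) (η : Plane → F) (x : Plane) : F :=
  fderiv ℝ η x (EuclideanSpace.single j 1)

/-- The gradient matrix of a smooth vector field. -/
def velocityGrad (ψ : Plane → Plane) (x : Plane) : Mat2 :=
  WithLp.toLp 2 fun ij : Fin 2 × Fin 2 => partialD ij.2 ψ x ij.1

/-- The Sobolev space `H¹(Ω)` of scalar functions; an element is recorded as the pair of the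
function and its weak gradient. -/
def H1 (Ω : Set Plane) : Set (L2 Ω ℝ × L2 Ω Plane) :=
  {q | ∀ η : Plane → ℝ, IsTestFunction Ω η → ∀ j : Fin 2,
    ∫ x in Ω, q.1 x * partialD j η x = - ∫ x in Ω, q.2 x j * η x}

/-- Pairs of an `L²` vector field and an `L²` matrix field, with the norm
`(‖u‖² + ‖G‖²)^(1/2)`, which is the `H¹` norm when `G` is the gradient of `u`. -/
abbrev FieldPair (Ω : Set Plane) : Type := WithLp 2 (L2 Ω Plane × L2 Ω Mat2)

/-- The space `H¹₀(Ω; ℝ²)`: the closure in the `H¹` norm of the smooth vector fields with compact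
support in `Ω`. An element is recorded as the pair of the field and its gradient. (The pairs
`(ψ, ∇ψ)` already form a linear subspace, so the span adds nothing.) -/
def H10 (Ω : Set Plane) : Submodule ℝ (FieldPair Ω) :=
  (Submodule.span ℝ {p : FieldPair Ω | ∃ ψ : Plane → Plane, IsTestFunction Ω ψ ∧
    p.fst =ᵐ[volume.restrict Ω] ψ ∧
    p.snd =ᵐ[volume.restrict Ω] velocityGrad ψ}).topologicalClosure

/-- The pairs whose matrix field has vanishing trace almost everywhere. -/
def traceFree (Ω : Set Plane) : Submodule ℝ (FieldPair Ω) where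
  carrier := {p | ∀ᵐ x ∂((volume : Measure Plane).restrict Ω), ∑ i : Fin 2, p.snd x (i, i) = 0}
  zero_mem' := by
    show ∀ᵐ x ∂((volume : Measure Plane).restrict Ω),
      ∑ i : Fin 2, ((0 : L2 Ω Mat2) : Plane → Mat2) x (i, i) = 0
    filter_upwards [Lp.coeFn_zero Mat2 2 ((volume : Measure Plane).restrict Ω)] with x hx
    simp only [hx, Pi.zero_apply, PiLp.zero_apply, Finset.sum_const_zero]
  add_mem' := by
    intro p q hp hq
    show ∀ᵐ x ∂((volume : Measure Plane).restrict Ω),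
      ∑ i : Fin 2, ((p.snd + q.snd : L2 Ω Mat2) : Plane → Mat2) x (i, i) = 0
    filter_upwards [hp, hq, Lp.coeFn_add p.snd q.snd] with x h1 h2 hx
    simp only [hx, Pi.add_apply, PiLp.add_apply, Finset.sum_add_distrib, h1, h2, add_zero]
  smul_mem' := by
    intro c p hp
    show ∀ᵐ x ∂((volume : Measure Plane).restrict Ω),
      ∑ i : Fin 2, ((c • p.snd : L2 Ω Mat2) : Plane → Mat2) x (i, i) = 0
    filter_upwards [hp, Lp.coeFn_smul c p.snd] with x h1 hx
    simp only [hx, Pi.smul_apply, PiLp.smul_apply, ← Finset.smul_sum, h1, smul_zero]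

/-- The space `V` of the divergence-free fields in `H¹₀(Ω; ℝ²)`. -/
def V (Ω : Set Plane) : Submodule ℝ (FieldPair Ω) := H10 Ω ⊓ traceFree Ω

/-- The space `H` of the `L²` fields with vanishing divergence in `Ω` and vanishing normal
component on the boundary, both in the weak sense: Green's formula `∫ ψ · ∇q = 0` for all
`q ∈ H¹(Ω)`. -/
def H (Ω : Set Plane) : Set (L2 Ω Plane) :=
  {ψ | ∀ q ∈ H1 Ω, ∫ x in Ω, ⟪ψ x, q.2 x⟫_ℝ = 0}

/-- `c` is a constant in the Poincaré inequality `‖v‖ ≤ c ‖∇v‖` on `H¹₀(Ω; ℝ²)`. -/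
def IsPoincareConstant (Ω : Set Plane) (c : ℝ) : Prop :=
  0 < c ∧ ∀ v ∈ H10 Ω, ‖v.fst‖ ≤ c * ‖v.snd‖

/-- `c` is a constant in the Ladyzhenskaya inequality
`‖v‖_{L⁴} ≤ √c ‖v‖^{1/2} ‖∇v‖^{1/2}` on `H¹₀(Ω; ℝ²)`. -/
def IsLadyzhenskayaConstant (Ω : Set Plane) (c : ℝ) : Prop :=
  0 < c ∧ ∀ v ∈ H10 Ω, eLpNorm v.fst 4 (volume.restrict Ω) ≤
    ENNReal.ofReal (√c * (√‖v.fst‖ * √‖v.snd‖))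

/-- The admissible designs `φ ∈ H¹(Ω)`, `|φ| ≤ 1` almost everywhere. -/
def Admissible (Ω : Set Plane) : Set (L2 Ω ℝ × L2 Ω Plane) :=
  {φ | φ ∈ H1 Ω ∧ ∀ᵐ x ∂((volume : Measure Plane).restrict Ω), |φ.1 x| ≤ 1}

/-- The assumptions on the functions that describe the porous medium. -/
structure IsPorousCoefficient (α : ℝ → ℝ) : Prop where
  nonneg : ∀ s, 0 ≤ α s
  lipschitz : ∃ L, LipschitzWith L α
  fluid : α 1 = 0
  obstacle : 0 < α (-1)

/-- The bilinear form `a_φ(u, v) = μ ∫ ∇u : ∇v + ∫ α(φ) u · v`. -/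
def aForm {Ω : Set Plane} (μ : ℝ) (α : ℝ → ℝ) (φ : L2 Ω ℝ) (u v : FieldPair Ω) : ℝ :=
  μ * (∫ x in Ω, ⟪u.snd x, v.snd x⟫_ℝ) + ∫ x in Ω, α (φ x) * ⟪u.fst x, v.fst x⟫_ℝ

/-- The trilinear form `b(u, v, w) = ∫ [(u · ∇) v] · w`. -/
def bForm {Ω : Set Plane} (u v w : FieldPair Ω) : ℝ :=
  ∫ x in Ω, ∑ i : Fin 2, (∑ j : Fin 2, u.fst x j * v.snd x (i, j)) * w.fst x i

/-- `v ∈ V` is the state of the stationary problem for the design `φ`, that is, a weak solution of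
the stationary Navier-Stokes equations with force `f_s`. -/
def IsStationaryState {Ω : Set Plane} (μ : ℝ) (α : ℝ → ℝ) (f_s : L2 Ω Plane) (φ : L2 Ω ℝ)
    (v : V Ω) : Prop :=
  ∀ ψ : V Ω, aForm μ α φ v ψ + bForm (v : FieldPair Ω) v ψ = ∫ x in Ω, ⟪f_s x, ψ.1.fst x⟫_ℝ

/-- `du : (0, T) → V*` is the weak time derivative of `u : (0, T) → V`, where `u(t)` acts on `V`
through the `L²` inner product. -/
def IsWeakTimeDeriv {Ω : Set Plane} (T : ℝ) (u : ℝ → V Ω) (du : ℝ → StrongDual ℝ (V Ω)) : Prop :=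
  ∀ θ : ℝ → ℝ, ContDiff ℝ ∞ θ → HasCompactSupport θ → tsupport θ ⊆ Ioo 0 T → ∀ ψ : V Ω,
    ∫ t in Ioo 0 T, deriv θ t * ⟪(u t).1.fst, ψ.1.fst⟫_ℝ = - ∫ t in Ioo 0 T, θ t * du t ψ

/-- `u` is the state of the time-dependent problem on `(0, T)` for the design `φ`: it lies in
`L²(0, T; V)`, has a time derivative in `L²(0, T; V*)`, solves the Navier-Stokes equations weakly
for almost every time, and its representative in `C([0, T]; H)` takes the value `u₀` at `0`. -/
structure IsTimeState {Ω : Set Plane} (μ : ℝ) (α : ℝ → ℝ) (f : ℝ → L2 Ω Plane)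
    (u₀ : L2 Ω Plane) (T : ℝ) (φ : L2 Ω ℝ) (u : ℝ → V Ω) : Prop where
  memLp : MemLp u 2 (volume.restrict (Ioo 0 T))
  equation : ∃ du : ℝ → StrongDual ℝ (V Ω),
    MemLp du 2 (volume.restrict (Ioo 0 T)) ∧ IsWeakTimeDeriv T u du ∧
    ∀ᵐ t ∂((volume : Measure ℝ).restrict (Ioo 0 T)), ∀ ψ : V Ω,
      du t ψ + aForm μ α φ (u t) ψ + bForm (u t : FieldPair Ω) (u t) ψ =
        ∫ x in Ω, ⟪f t x, ψ.1.fst x⟫_ℝ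
  initial : ∃ w : ℝ → L2 Ω Plane, ContinuousOn w (Icc 0 T) ∧
    (∀ᵐ t ∂((volume : Measure ℝ).restrict (Ioo 0 T)), w t = (u t).1.fst) ∧ w 0 = u₀

/-- The double-obstacle potential on `[-1, 1]`, where admissible designs take their values. -/
def potential (s : ℝ) : ℝ := (1 - s ^ 2) / 2

/-- The normalization `c₀ = ½ ∫ √(2Ψ)` over `[-1, 1]`. -/
def potentialConst : ℝ := 1 / 2 * ∫ s in (-1 : ℝ)..1, √(2 * potential s)

/-- The Ginzburg-Landau energy of a design. -/
def energy {Ω : Set Plane} (ε : ℝ) (φ : L2 Ω ℝ × L2 Ω Plane) : ℝ :=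
  1 / (2 * potentialConst) *
    ∫ x in Ω, (ε / 2 * ‖φ.2 x‖ ^ 2 + 1 / ε * potential (φ.1 x))

/-- The tracking and penalty terms at a fixed time:
`∫ (φ + 1)/2 |v - u_d|² χ_D + ∫ β(φ) |v|²`. -/
def runningCost {Ω D : Set Plane} (β : ℝ → ℝ) (u_d : L2 D Plane) (φ : L2 Ω ℝ)
    (v : L2 Ω Plane) : ℝ :=
  (∫ x in Ω, D.indicator (fun y => (φ y + 1) / 2 * ‖v y - u_d y‖ ^ 2) x) +
    ∫ x in Ω, β (φ x) * ‖v x‖ ^ 2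

/-- The objective `J_T(u, φ)` of the time-dependent problem. -/
def JT {Ω D : Set Plane} (ε γ : ℝ) (β : ℝ → ℝ) (u_d : L2 D Plane) (T : ℝ)
    (u : ℝ → V Ω) (φ : L2 Ω ℝ × L2 Ω Plane) : ℝ :=
  1 / T * (∫ t in Ioo 0 T, runningCost β u_d φ.1 (u t).1.fst) + γ * energy ε φ

/-- The objective `J_s(v, φ)` of the stationary problem. -/
def Js {Ω D : Set Plane} (ε γ : ℝ) (β : ℝ → ℝ) (u_d : L2 D Plane)
    (v : V Ω) (φ : L2 Ω ℝ × L2 Ω Plane) : ℝ :=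
  runningCost β u_d φ.1 v.1.fst + γ * energy ε φ

/-- The design `φ`, with its state `u`, is a global minimizer of the time-dependent problem. -/
structure IsTimeMinimizer {Ω D : Set Plane} (ε γ μ : ℝ) (α β : ℝ → ℝ) (u_d : L2 D Plane)
    (f : ℝ → L2 Ω Plane) (u₀ : L2 Ω Plane) (T : ℝ)
    (φ : L2 Ω ℝ × L2 Ω Plane) (u : ℝ → V Ω) : Prop where
  admissible : φ ∈ Admissible Ω
  state : IsTimeState μ α f u₀ T φ.1 u
  minimal : ∀ φ' ∈ Admissible Ω, ∀ u', IsTimeState μ α f u₀ T φ'.1 u' →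
    JT ε γ β u_d T u φ ≤ JT ε γ β u_d T u' φ'

/-- The design `φ`, with its state `v`, is a global minimizer of the stationary problem. -/
structure IsStationaryMinimizer {Ω D : Set Plane} (ε γ μ : ℝ) (α β : ℝ → ℝ) (u_d : L2 D Plane)
    (f_s : L2 Ω Plane) (φ : L2 Ω ℝ × L2 Ω Plane) (v : V Ω) : Prop where
  admissible : φ ∈ Admissible Ω
  state : IsStationaryState μ α f_s φ.1 v
  minimal : ∀ φ' ∈ Admissible Ω, ∀ v', IsStationaryState μ α f_s φ'.1 v' →
    Js ε γ β u_d v φ ≤ Js ε γ β u_d v' φ'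

/-- The exponential weight `(μ⁴ - 2 c_L² c_P⁴ F²) / (c_P² μ³)`, with `F` the norm of the stationary
force. -/
def decayRate (μ c_P c_L F : ℝ) : ℝ :=
  (μ ^ 4 - 2 * c_L ^ 2 * c_P ^ 4 * F ^ 2) / (c_P ^ 2 * μ ^ 3)

end PhaseFieldNS

end

open PhaseFieldNS

/-! For a fixed design `φ` the Ginzburg-Landau terms of the two objectives cancel, and what is left
is the time average of a difference of running costs. If `u` and `v` are the time-dependent and the
stationary state of `φ`, testing the difference of the equations with `u - v` leaves one advection
term, `b(u - v, v, u - v)`. Since `‖∇v‖ ≤ c_P ‖f_s‖ / μ`, the smallness of `f_s` lets half of the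
viscosity absorb it. Integration over `(0, T)` bounds `∫ ‖u - v‖²` by a constant that depends
neither on `T` nor on `φ` (`turnpike`). The running cost is quadratic in the velocity, with
coefficients bounded uniformly in the design, so its increments are controlled by `‖u - v‖² + ‖u -
v‖`. Averaging gives the rates `1/T` and `1/√T` (`exists_objective_sub_le`).

The minimizers need not share a design, so each is tested with the design of the other: `J_T(φT) ≤
J_T(φs) ≤ J_s(φs) + error` and `J_s(φs) ≤ J_s(φT) ≤ J_T(φT) + error`. This requires a stationary
state for `φT` and a time-dependent state for `φs`. The former comes from a Picard iteration on
Oseen problems (`exists_small_solution`).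

The latter is obtained by deforming the state that the minimizer `φT` already carries
(`exists_timeState`). The correction has zero initial value, so only a parabolic theory with zero
initial data is needed. In that theory the equation is integrated in time: with the Volterra
operator `S` and the Gram operator `ι†ι` of the embedding of `V` in `L²`, it reads `ι†ι z = S (g - A
z)`. Accretivity of `S` gives solvability (`exists_parabolic`) and a regularization that proves the
energy identity (`exists_continuous_representative`). The nonlinear problem follows by the method of
continuity in the coefficient `α(φ)` (`exists_solution_of_apriori`), with estimates of the
linearized equation supplied by Gronwall's inequality (`apriori_estimate`). -/

set_option linter.unusedSectionVars false

noncomputable section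

namespace PhaseFieldNS

/-! ### Square-integrable functions of time and the Volterra operator -/

/-- Lebesgue measure on the time interval `(a, b)`. -/
abbrev timeMeasure (a b : ℝ) : Measure ℝ := volume.restrict (Ioo a b)

/-- The space `L²(a, b; E)`. -/
abbrev LT (a b : ℝ) (E : Type*) [NormedAddCommGroup E] : Type _ := Lp E 2 (timeMeasure a b)

section Volterra

variable {E : Type*} [NormedAddCommGroup E] [InnerProductSpace ℝ E] [CompleteSpace E]
  {F : Type*} [NormedAddCommGroup F] [InnerProductSpace ℝ F] [CompleteSpace F]
  {a b : ℝ}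

theorem intervalIntegrable_of_integrable_Ioo {E : Type*} [NormedAddCommGroup E] {f : ℝ → E}
    (hf : Integrable f (timeMeasure a b)) {s t : ℝ}
    (hs : s ∈ Icc a b) (ht : t ∈ Icc a b) : IntervalIntegrable f volume s t := by
  have h : IntegrableOn f (Icc a b) volume := by
    rw [integrableOn_Icc_iff_integrableOn_Ioo]; exact hf
  refine (h.mono_set ?_).intervalIntegrable
  exact uIcc_subset_Icc hs ht

theorem integral_Ioo_eq_intervalIntegral {E : Type*} [NormedAddCommGroup E] [NormedSpace ℝ E]
    (f : ℝ → E) {s t : ℝ} (h : s ≤ t) : ∫ r in Ioo s t, f r = ∫ r in s..t, f r := by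
  rw [intervalIntegral.integral_of_le h, integral_Ioc_eq_integral_Ioo]

theorem LT.integrable {E : Type*} [NormedAddCommGroup E] (ρ : LT a b E) :
    Integrable ρ (timeMeasure a b) :=
  (Lp.memLp ρ).integrable one_le_two

theorem LT.intervalIntegrable {E : Type*} [NormedAddCommGroup E] (ρ : LT a b E) {s t : ℝ}
    (hs : s ∈ Icc a b) (ht : t ∈ Icc a b) : IntervalIntegrable ρ volume s t :=
  intervalIntegrable_of_integrable_Ioo ρ.integrable hs ht

theorem ae_Ioo_of_ae_timeMeasure {p : ℝ → Prop} (h : ∀ᵐ t ∂(timeMeasure a b), p t) {s t : ℝ}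
    (hs : a ≤ s) (ht : t ≤ b) : ∀ᵐ r ∂(timeMeasure s t), p r :=
  ae_restrict_of_ae_restrict_of_subset (Ioo_subset_Ioo hs ht) h

theorem intervalIntegral_congr_timeMeasure {E : Type*} [NormedAddCommGroup E] [NormedSpace ℝ E]
    {f g : ℝ → E} (h : f =ᵐ[timeMeasure a b] g) {s t : ℝ}
    (hs : a ≤ s) (hst : s ≤ t) (ht : t ≤ b) : ∫ r in s..t, f r = ∫ r in s..t, g r := by
  rw [← integral_Ioo_eq_intervalIntegral _ hst, ← integral_Ioo_eq_intervalIntegral _ hst]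
  exact integral_congr_ae (ae_Ioo_of_ae_timeMeasure h hs ht)

/-- The primitive vanishing at `a`. -/
def prim (a : ℝ) (ρ : ℝ → E) (t : ℝ) : E := ∫ s in a..t, ρ s

theorem continuousOn_prim {ρ : ℝ → E} (hρ : Integrable ρ (timeMeasure a b)) :
    ContinuousOn (prim a ρ) (Icc a b) := by
  rcases le_or_gt a b with hab | hab
  · have := intervalIntegral.continuousOn_primitive_interval (f := ρ) (μ := volume)
      (a := a) (b := b) (by rw [uIcc_of_le hab, integrableOn_Icc_iff_integrableOn_Ioo]; exact hρ)
    rwa [uIcc_of_le hab] at this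
  · rw [Icc_eq_empty (not_le.2 hab)]; exact continuousOn_empty _

theorem prim_congr {f g : ℝ → E} (h : f =ᵐ[timeMeasure a b] g) {t : ℝ} (ht : t ∈ Icc a b) :
    prim a f t = prim a g t :=
  intervalIntegral_congr_timeMeasure h le_rfl ht.1 ht.2

theorem norm_prim_le {ρ : ℝ → E} (hρ : Integrable ρ (timeMeasure a b)) {t : ℝ}
    (ht : t ∈ Icc a b) : ‖prim a ρ t‖ ≤ ∫ s in Ioo a b, ‖ρ s‖ := by
  refine (intervalIntegral.norm_integral_le_integral_norm ht.1).trans ?_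
  rw [← integral_Ioo_eq_intervalIntegral _ ht.1]
  exact setIntegral_mono_set hρ.norm (Filter.Eventually.of_forall fun _ => norm_nonneg _)
    (Ioo_subset_Ioo_right ht.2).eventuallyLE

theorem LT.integral_norm_le (ρ : LT a b E) :
    ∫ s in Ioo a b, ‖ρ s‖ ≤ (timeMeasure a b).real univ ^ (2⁻¹ : ℝ) * ‖ρ‖ := by
  have h := eLpNorm_le_eLpNorm_mul_rpow_measure_univ (p := 1) (q := 2) (μ := timeMeasure a b)
    (f := ρ) one_le_two (Lp.aestronglyMeasurable ρ)
  have h1 : ∫ s in Ioo a b, ‖ρ s‖ = (eLpNorm ρ 1 (timeMeasure a b)).toReal := by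
    rw [eLpNorm_one_eq_lintegral_enorm, integral_norm_eq_lintegral_enorm
      (Lp.aestronglyMeasurable ρ)]
  rw [h1, Lp.norm_def, mul_comm, measureReal_def, ENNReal.toReal_rpow, ← ENNReal.toReal_mul]
  refine ENNReal.toReal_mono ?_ (h.trans (le_of_eq ?_))
  · exact ENNReal.mul_ne_top (Lp.eLpNorm_ne_top ρ)
      (ENNReal.rpow_ne_top_of_nonneg (by norm_num) (measure_ne_top _ _))
  · norm_num

theorem memLp_prim (ρ : LT a b E) : MemLp (prim a ρ) 2 (timeMeasure a b) := by
  refine MemLp.of_bound ?_ (∫ s in Ioo a b, ‖ρ s‖) ?_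
  · exact ((continuousOn_prim ρ.integrable).mono Ioo_subset_Icc_self).aestronglyMeasurable
      measurableSet_Ioo
  · filter_upwards [ae_restrict_mem measurableSet_Ioo] with t ht
    exact norm_prim_le ρ.integrable (Ioo_subset_Icc_self ht)

theorem prim_add (ρ σ : LT a b E) {t : ℝ} (ht : t ∈ Icc a b) :
    prim a (ρ + σ : LT a b E) t = prim a ρ t + prim a σ t := by
  rw [prim_congr (Lp.coeFn_add ρ σ) ht]
  exact intervalIntegral.integral_add
    (ρ.intervalIntegrable (left_mem_Icc.2 (ht.1.trans ht.2)) ht)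
    (σ.intervalIntegrable (left_mem_Icc.2 (ht.1.trans ht.2)) ht)

theorem prim_smul (c : ℝ) (ρ : LT a b E) {t : ℝ} (ht : t ∈ Icc a b) :
    prim a (c • ρ : LT a b E) t = c • prim a ρ t := by
  rw [prim_congr (Lp.coeFn_smul c ρ) ht]
  exact intervalIntegral.integral_smul c ρ

/-- The Volterra operator `ρ ↦ ∫ₐᵗ ρ` on `L²(a, b; E)`. -/
def volterra (a b : ℝ) (E : Type*) [NormedAddCommGroup E] [InnerProductSpace ℝ E]
    [CompleteSpace E] : LT a b E →L[ℝ] LT a b E :=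
  LinearMap.mkContinuous
    { toFun := fun ρ => (memLp_prim ρ).toLp
      map_add' := by
        intro ρ σ
        rw [← MemLp.toLp_add, MemLp.toLp_eq_toLp_iff]
        filter_upwards [ae_restrict_mem measurableSet_Ioo] with t ht
        exact prim_add ρ σ (Ioo_subset_Icc_self ht)
      map_smul' := by
        intro c ρ
        rw [RingHom.id_apply, ← MemLp.toLp_const_smul, MemLp.toLp_eq_toLp_iff]
        filter_upwards [ae_restrict_mem measurableSet_Ioo] with t ht
        exact prim_smul c ρ (Ioo_subset_Icc_self ht) }
    ((measureUnivNNReal (timeMeasure a b) : ℝ) ^ (2 : ENNReal).toReal⁻¹ *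
      (timeMeasure a b).real univ ^ (2⁻¹ : ℝ)) (by
      intro ρ
      rw [mul_assoc]
      refine (Lp.norm_le_of_ae_bound (C := (timeMeasure a b).real univ ^ (2⁻¹ : ℝ) * ‖ρ‖)
        (by positivity) ?_)
      filter_upwards [MemLp.coeFn_toLp (memLp_prim ρ), ae_restrict_mem measurableSet_Ioo]
        with t h1 ht
      simp only [LinearMap.coe_mk, AddHom.coe_mk]
      rw [h1]
      exact (norm_prim_le ρ.integrable (Ioo_subset_Icc_self ht)).trans ρ.integral_norm_le)

theorem coeFn_volterra (ρ : LT a b E) :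
    volterra a b E ρ =ᵐ[timeMeasure a b] prim a ρ :=
  MemLp.coeFn_toLp (memLp_prim ρ)

/-- Bounded operators pass through the integral. Fibrewise operators therefore commute with any
regularization built from the Volterra operator. -/
theorem volterra_compLpL (L : E →L[ℝ] F) (ρ : LT a b E) :
    L.compLpL 2 _ (volterra a b E ρ) = volterra a b F (L.compLpL 2 _ ρ) := by
  refine Lp.ext ?_
  filter_upwards [L.coeFn_compLpL (p := 2) (volterra a b E ρ), coeFn_volterra ρ,
    coeFn_volterra (L.compLpL 2 _ ρ), ae_restrict_mem measurableSet_Ioo] with t h1 h2 h3 ht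
  rw [h1, h2, h3, prim_congr (L.coeFn_compLpL (p := 2) ρ) (Ioo_subset_Icc_self ht)]
  have ht' := Ioo_subset_Icc_self ht
  exact (L.intervalIntegral_comp_comm
    (ρ.intervalIntegrable (left_mem_Icc.2 (ht'.1.trans ht'.2)) ht')).symm

theorem absolutelyContinuousOnInterval_of_dist_le {X Y : Type*} [PseudoMetricSpace X]
    [PseudoMetricSpace Y] {f : ℝ → X} {g : ℝ → Y}
    (hg : AbsolutelyContinuousOnInterval g a b)
    (h : ∀ x ∈ uIcc a b, ∀ y ∈ uIcc a b, dist (f x) (f y) ≤ dist (g x) (g y)) :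
    AbsolutelyContinuousOnInterval f a b := by
  rw [absolutelyContinuousOnInterval_iff] at hg ⊢
  intro ε hε
  obtain ⟨δ, hδ, H⟩ := hg ε hε
  refine ⟨δ, hδ, fun I hI hlen => lt_of_le_of_lt (Finset.sum_le_sum fun i hi => ?_) (H I hI hlen)⟩
  exact h _ (hI.1 i hi).1 _ (hI.1 i hi).2

/-- The energy identity for the primitive of an integrable function. -/
theorem norm_prim_sq {ρ : ℝ → E} (hρ : Integrable ρ (timeMeasure a b)) {t : ℝ}
    (ht : t ∈ Icc a b) : ‖prim a ρ t‖ ^ 2 = 2 * ∫ s in a..t, ⟪ρ s, prim a ρ s⟫_ℝ := by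
  have hab := ht.1.trans ht.2
  have hI : IntervalIntegrable ρ volume a t :=
    intervalIntegrable_of_integrable_Ioo hρ (left_mem_Icc.2 hab) ht
  have hcont : ContinuousOn (prim a ρ) (uIcc a t) := by
    rw [uIcc_of_le ht.1]; exact (continuousOn_prim hρ).mono (Icc_subset_Icc_right ht.2)
  have hJ : IntervalIntegrable (fun s => ⟪ρ s, prim a ρ s⟫_ℝ) volume a t := by
    obtain ⟨C, hC⟩ := (isCompact_uIcc (a := a) (b := t)).exists_bound_of_continuousOn hcont
    rw [intervalIntegrable_iff] at hI ⊢
    refine Integrable.mono' (hI.norm.mul_const C) ?_ ?_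
    · exact hI.aestronglyMeasurable.inner
        ((hcont.mono uIoc_subset_uIcc).aestronglyMeasurable measurableSet_uIoc)
    · filter_upwards [ae_restrict_mem measurableSet_uIoc] with s hs
      refine (norm_inner_le_norm _ _).trans ?_
      gcongr
      exact hC s (uIoc_subset_uIcc hs)
  -- The increments of this function are dominated by those of the real primitive of `‖ρ‖`.
  have hN : AbsolutelyContinuousOnInterval (fun s => ‖prim a ρ s‖) a t := by
    refine absolutelyContinuousOnInterval_of_dist_le
      (hI.norm.absolutelyContinuousOnInterval_intervalIntegral (c := a) left_mem_uIcc) ?_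
    intro x hx y hy
    have h1 : IntervalIntegrable ρ volume a x := hI.mono_set (uIcc_subset_uIcc left_mem_uIcc hx)
    have h2 : IntervalIntegrable ρ volume a y := hI.mono_set (uIcc_subset_uIcc left_mem_uIcc hy)
    refine (dist_norm_norm_le _ _).trans ?_
    rw [Real.dist_eq, intervalIntegral.integral_interval_sub_left h1.norm h2.norm, prim, prim,
      intervalIntegral.integral_interval_sub_left h1 h2]
    exact intervalIntegral.norm_integral_le_abs_integral_norm
  -- The difference of the two sides is absolutely continuous with derivative zero almost
  -- everywhere, hence constant, and it vanishes at `a`.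
  have hAC : AbsolutelyContinuousOnInterval
      (fun s => ‖prim a ρ s‖ * ‖prim a ρ s‖ - 2 * ∫ r in a..s, ⟪ρ r, prim a ρ r⟫_ℝ) a t :=
    (hN.fun_mul hN).fun_sub
      ((hJ.absolutelyContinuousOnInterval_intervalIntegral (c := a) left_mem_uIcc).const_mul 2)
  have hder : ∀ᵐ x, x ∈ uIcc a t → HasDerivAt
      (fun s => ‖prim a ρ s‖ * ‖prim a ρ s‖ - 2 * ∫ r in a..s, ⟪ρ r, prim a ρ r⟫_ℝ) 0 x := by
    filter_upwards [hI.ae_hasDerivAt_integral, hJ.ae_hasDerivAt_integral] with x h1 h2 hx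
    have h1' := h1 hx a left_mem_uIcc
    have h2' := (h2 hx a left_mem_uIcc).const_mul 2
    have h3 := (h1'.inner ℝ h1').sub h2'
    refine (h3.congr_deriv ?_).congr_of_eventuallyEq ?_
    · rw [real_inner_comm]; simp only [prim]; rw [real_inner_comm]; ring
    · refine Filter.Eventually.of_forall fun s => ?_
      simp only [prim, Pi.sub_apply, real_inner_self_eq_norm_mul_norm]
  obtain ⟨C, hC⟩ := hAC.const_of_ae_hasDerivAt_zero hder
  have e1 := hC a left_mem_uIcc
  have e2 := hC t right_mem_uIcc
  simp only [prim, intervalIntegral.integral_same, norm_zero] at e1 e2 ⊢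
  nlinarith [e1, e2]

theorem inner_eq_intervalIntegral (hab : a ≤ b) (ρ σ : LT a b E) :
    ⟪ρ, σ⟫_ℝ = ∫ s in a..b, ⟪ρ s, σ s⟫_ℝ := by
  rw [L2.inner_def, integral_Ioo_eq_intervalIntegral _ hab]

/-- For `a ≤ b` the pairing is half of `‖prim a ρ b‖ ^ 2`, by `norm_prim_sq`. -/
theorem volterra_accretive (ρ : LT a b E) : 0 ≤ ⟪volterra a b E ρ, ρ⟫_ℝ := by
  rcases le_or_gt a b with hab | hab
  · have h := norm_prim_sq ρ.integrable (right_mem_Icc.2 hab)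
    have : ⟪volterra a b E ρ, ρ⟫_ℝ = ∫ s in a..b, ⟪ρ s, prim a ρ s⟫_ℝ := by
      rw [inner_eq_intervalIntegral hab]
      refine intervalIntegral_congr_timeMeasure (a := a) (b := b) ?_ le_rfl hab le_rfl
      filter_upwards [coeFn_volterra ρ] with s hs
      rw [hs, real_inner_comm]
    rw [this]
    nlinarith [sq_nonneg ‖prim a ρ b‖]
  · rw [L2.inner_def, setIntegral_eq_zero_of_forall_eq_zero]
    intro t ht
    exact absurd (ht.1.trans ht.2) (not_lt.2 hab.le)

/-- By continuity the primitive vanishes everywhere on the open interval, and Lebesgue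
differentiation recovers `ρ` from it. -/
theorem ae_eq_zero_of_prim_eq_zero {ρ : ℝ → E} (hρ : Integrable ρ (timeMeasure a b))
    (h : prim a ρ =ᵐ[timeMeasure a b] 0) : ρ =ᵐ[timeMeasure a b] 0 := by
  rcases le_or_gt b a with hab | hab
  · filter_upwards [ae_restrict_mem measurableSet_Ioo] with t ht
    exact absurd (ht.1.trans ht.2) (not_lt.2 hab)
  have hI : IntervalIntegrable ρ volume a b :=
    intervalIntegrable_of_integrable_Ioo hρ (left_mem_Icc.2 hab.le) (right_mem_Icc.2 hab.le)
  have hz : EqOn (prim a ρ) 0 (Ioo a b) :=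
    Measure.eqOn_open_of_ae_eq h isOpen_Ioo
      ((continuousOn_prim hρ).mono Ioo_subset_Icc_self) continuousOn_const
  have hd := hI.ae_hasDerivAt_integral
  rw [Filter.EventuallyEq, ae_restrict_iff' measurableSet_Ioo]
  filter_upwards [hd] with x hx hxI
  have h1 := hx (Ioo_subset_Icc_self.trans Icc_subset_uIcc hxI) a left_mem_uIcc
  have h2 : HasDerivAt (fun x => ∫ s in a..x, ρ s) 0 x := by
    refine (hasDerivAt_const x (0 : E)).congr_of_eventuallyEq ?_
    filter_upwards [isOpen_Ioo.mem_nhds hxI] with y hy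
    exact hz hy
  exact h1.unique h2

theorem volterra_injective : Function.Injective (volterra a b E) := by
  rw [injective_iff_map_eq_zero]
  intro ρ hρ
  rw [Lp.eq_zero_iff_ae_eq_zero]
  refine ae_eq_zero_of_prim_eq_zero ρ.integrable ?_
  rw [Lp.eq_zero_iff_ae_eq_zero] at hρ
  exact (coeFn_volterra ρ).symm.trans hρ

end Volterra

/-! ### Accretive operators on a Hilbert space -/

section Accretive

open Filter Topology

variable {X : Type*} [NormedAddCommGroup X] [InnerProductSpace ℝ X] [CompleteSpace X]

/-- Adding `η` makes an accretive form coercive, and the Lax-Milgram theorem inverts it. -/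
theorem exists_resolvent {S : X →L[ℝ] X} (hS : ∀ x, 0 ≤ ⟪S x, x⟫_ℝ) {η : ℝ} (hη : 0 < η) :
    ∃ R : X →L[ℝ] X, (∀ x, S (R x) + η • R x = x) ∧ ∀ x, R (S x + η • x) = x := by
  let B : X →L[ℝ] X →L[ℝ] ℝ := (innerSL ℝ).comp (S + η • ContinuousLinearMap.id ℝ X)
  have hB : ∀ v w, B v w = ⟪S v + η • v, w⟫_ℝ := fun v w => rfl
  have hco : IsCoercive B := by
    refine ⟨η, hη, fun u => ?_⟩
    rw [hB, inner_add_left, real_inner_smul_left, real_inner_self_eq_norm_mul_norm]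
    nlinarith [hS u]
  have he : ∀ v, hco.continuousLinearEquivOfBilin v = S v + η • v := by
    intro v
    refine ext_inner_right ℝ fun w => ?_
    rw [hco.continuousLinearEquivOfBilin_apply, hB]
  refine ⟨hco.continuousLinearEquivOfBilin.symm, fun x => ?_, fun x => ?_⟩
  · rw [← he]; simp
  · rw [← he]; simp

/-- Let `x` be orthogonal to the range. Accretivity at `x - s • S x` gives `‖S x‖² ≤ s ⟪S (S x), S
x⟫` for all `s > 0`, and `s → 0` forces `S x = 0`. -/
theorem orthogonal_range_eq_bot {S : X →L[ℝ] X} (hS : ∀ x, 0 ≤ ⟪S x, x⟫_ℝ)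
    (hinj : Function.Injective S) : (LinearMap.range (S : X →ₗ[ℝ] X))ᗮ = ⊥ := by
  rw [Submodule.eq_bot_iff]
  intro x hx
  have hx' : ∀ y, ⟪S y, x⟫_ℝ = 0 := fun y => hx _ ⟨y, rfl⟩
  have key : ∀ s : ℝ, 0 < s → ‖S x‖ ^ 2 ≤ s * ⟪S (S x), S x⟫_ℝ := by
    intro s hs
    have h := hS (x - s • S x)
    rw [map_sub, map_smul, inner_sub_left, inner_sub_right, inner_sub_right,
      real_inner_smul_left, real_inner_smul_left, real_inner_smul_right, real_inner_smul_right,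
      hx', hx', real_inner_self_eq_norm_sq] at h
    have : 0 ≤ s * (s * ⟪S (S x), S x⟫_ℝ - ‖S x‖ ^ 2) := by linarith
    have := nonneg_of_mul_nonneg_right this hs
    linarith
  have h0 : ‖S x‖ ^ 2 ≤ 0 := by
    have ht : Tendsto (fun s : ℝ => s * ⟪S (S x), S x⟫_ℝ) (𝓝[>] 0) (𝓝 0) := by
      have : Tendsto (fun s : ℝ => s * ⟪S (S x), S x⟫_ℝ) (𝓝 0) (𝓝 (0 * ⟪S (S x), S x⟫_ℝ)) :=
        tendsto_id.mul_const _
      rw [zero_mul] at this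
      exact this.mono_left nhdsWithin_le_nhds
    refine ge_of_tendsto ht ?_
    filter_upwards [self_mem_nhdsWithin] with s hs using key s hs
  have h1 : S x = 0 := by
    have : ‖S x‖ = 0 := by nlinarith [norm_nonneg (S x)]
    exact norm_eq_zero.1 this
  exact hinj (by rw [h1, map_zero])

/-- Approximation of the identity by operators that factor through an accretive injective
operator. -/
theorem exists_approximation {S : X →L[ℝ] X} (hS : ∀ x, 0 ≤ ⟪S x, x⟫_ℝ)
    (hinj : Function.Injective S) :
    ∃ R : ℕ → X →L[ℝ] X, (∀ x, Tendsto (fun n => S (R n x)) atTop (𝓝 x)) ∧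
      ∀ L : X →L[ℝ] X, (∀ x, L (S x) = S (L x)) → ∀ n x, L (R n x) = R n (L x) := by
  -- `R n` is the resolvent `(S + 1/(n+1))⁻¹`. Strong convergence of `S (S + η)⁻¹` to the identity
  -- follows from a uniform bound and convergence on the range of `S`, which is dense.
  have hpos : ∀ n : ℕ, (0 : ℝ) < 1 / (n + 1) := fun n => by positivity
  choose R hR1 hR2 using fun n : ℕ => exists_resolvent hS (hpos n)
  refine ⟨R, ?_, ?_⟩
  · have hb : ∀ n x, ‖S (R n x)‖ ≤ ‖x‖ := by
      intro n x
      -- Expand the square of `x = S R x + η R x`; the cross term is nonnegative by accretivity.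
      have h : ‖x‖ ^ 2 = ‖S (R n x)‖ ^ 2 + 2 * ((1 / ((n : ℝ) + 1)) * ⟪S (R n x), R n x⟫_ℝ)
          + ‖(1 / ((n : ℝ) + 1)) • R n x‖ ^ 2 := by
        conv_lhs => rw [← hR1 n x]
        rw [norm_add_sq_real, real_inner_smul_right]
      have h2 := mul_nonneg (hpos n).le (hS (R n x))
      refine le_of_sq_le_sq ?_ (norm_nonneg _)
      nlinarith [sq_nonneg ‖(1 / ((n : ℝ) + 1)) • R n x‖]
    have hb' : ∀ n x, ‖S (R n x) - x‖ ≤ 2 * ‖x‖ := fun n x =>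
      (norm_sub_le _ _).trans (by linarith [hb n x])
    have hdense : Dense (LinearMap.range (S : X →ₗ[ℝ] X) : Set X) := by
      rw [Submodule.dense_iff_topologicalClosure_eq_top, Submodule.topologicalClosure_eq_top_iff]
      exact orthogonal_range_eq_bot hS hinj
    intro x
    rw [Metric.tendsto_atTop]
    intro ε hε
    obtain ⟨w, hw, ⟨y, rfl⟩⟩ := Metric.dense_iff.1 hdense x (ε / 4) (by positivity)
    rw [Metric.mem_ball, dist_eq_norm] at hw
    obtain ⟨N, hN⟩ := exists_nat_gt (4 * ‖y‖ / ε)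
    refine ⟨N, fun n hn => ?_⟩
    -- On the range of `S` the error is `-η S R y`, of norm at most `η ‖y‖`.
    have h1 : ‖S (R n (S y)) - S y‖ ≤ 1 / ((n : ℝ) + 1) * ‖y‖ * 1 := by
      have e1 : S (R n (S y)) - S y = -((1 / ((n : ℝ) + 1)) • R n (S y)) := by
        nth_rw 2 [← hR1 n (S y)]; abel
      have e2 : R n (S y) = S (R n y) := by
        have e := hR2 n (R n (S y))
        have e3 : R n (S (S (R n y) + (1 / ((n : ℝ) + 1)) • R n y)) = S (R n y) := by
          rw [map_add, map_smul]; exact hR2 n (S (R n y))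
        rwa [hR1] at e3
      rw [e1, norm_neg, norm_smul, Real.norm_of_nonneg (hpos n).le, mul_one, e2]
      exact mul_le_mul_of_nonneg_left (hb n y) (hpos n).le
    have h2 : 1 / ((n : ℝ) + 1) * ‖y‖ ≤ ε / 4 := by
      rw [div_mul_eq_mul_div, one_mul, div_le_iff₀ (by positivity)]
      rw [div_lt_iff₀ hε] at hN
      have : (N : ℝ) ≤ n := by exact_mod_cast hn
      nlinarith
    have e : S (R n x) - x = (S (R n (S y)) - S y) + (S (R n (x - S y)) - (x - S y)) := by
      simp only [map_sub]; abel
    rw [dist_eq_norm, e]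
    have hw' : ‖x - S y‖ < ε / 4 := by rw [norm_sub_rev]; exact hw
    calc _ ≤ ‖S (R n (S y)) - S y‖ + ‖S (R n (x - S y)) - (x - S y)‖ := norm_add_le _ _
      _ ≤ ε / 4 + 2 * ‖x - S y‖ := by
          have := hb' n (x - S y)
          linarith
      _ < ε := by linarith
  · intro L hL n x
    have e1 := hR2 n (L (R n x))
    rw [← hL, ← map_smul, ← map_add, hR1] at e1
    exact e1.symm

/-- If `‖S† x‖ ≤ k ‖P† x‖` for all `x`, then the range of `S` is contained in that of `P`. -/
theorem exists_eq_of_adjoint_le {S P : X →L[ℝ] X} {k : ℝ}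
    (h : ∀ x, ‖ContinuousLinearMap.adjoint S x‖ ≤ k * ‖ContinuousLinearMap.adjoint P x‖) (g : X) :
    ∃ z, P z = S g := by
  set S' := ContinuousLinearMap.adjoint S with hS'
  set P' := ContinuousLinearMap.adjoint P with hP'
  let f : X →ₗ[ℝ] LinearMap.range (P' : X →ₗ[ℝ] X) := (P' : X →ₗ[ℝ] X).rangeRestrict
  obtain ⟨s, hs⟩ := f.exists_rightInverse_of_surjective (LinearMap.range_rangeRestrict _)
  have hfs : ∀ y, P' (s y) = y := fun y => congrArg Subtype.val (LinearMap.congr_fun hs y)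
  -- The functional `P† x ↦ ⟪g, S† x⟫` is well defined and bounded on the range of `P†` by the
  -- hypothesis. The Riesz vector of a Hahn-Banach extension is the required preimage.
  let ℓ : StrongDual ℝ (LinearMap.range (P' : X →ₗ[ℝ] X)) :=
    LinearMap.mkContinuous ((innerSL ℝ g : X →ₗ[ℝ] ℝ) ∘ₗ (S' : X →ₗ[ℝ] X) ∘ₗ s) (‖g‖ * k) (by
      intro y
      calc ‖⟪g, S' (s y)⟫_ℝ‖ ≤ ‖g‖ * ‖S' (s y)‖ := norm_inner_le_norm _ _
        _ ≤ ‖g‖ * (k * ‖P' (s y)‖) := by gcongr; exact h _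
        _ = ‖g‖ * k * ‖y‖ := by rw [hfs, mul_assoc]; rfl)
  obtain ⟨m, hm, -⟩ := _root_.exists_extension_norm_eq _ ℓ
  refine ⟨(InnerProductSpace.toDual ℝ X).symm m, ext_inner_right ℝ fun x => ?_⟩
  have hx : ‖S' (s (f x) - x)‖ ≤ k * ‖P' (s (f x) - x)‖ := h _
  have hz : P' (s (f x) - x) = 0 := by rw [map_sub, hfs, sub_eq_zero]; rfl
  rw [hz, norm_zero, mul_zero, norm_le_zero_iff, map_sub, sub_eq_zero] at hx
  have e2 : ℓ (f x) = ⟪g, S' (s (f x))⟫_ℝ := rfl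
  have e1 : m (P' x) = ⟪g, S' x⟫_ℝ := by
    rw [← hx, ← e2, ← hm]; rfl
  rw [← ContinuousLinearMap.adjoint_inner_right, InnerProductSpace.toDual_symm_apply,
    ← ContinuousLinearMap.adjoint_inner_right]
  exact e1

end Accretive

/-! ### Functions with a time derivative in the dual space -/

section LionsMagenes

open Filter Topology

variable {E : Type*} [NormedAddCommGroup E] [InnerProductSpace ℝ E] [CompleteSpace E]
  {G : Type*} [NormedAddCommGroup G] [InnerProductSpace ℝ G] [CompleteSpace G] {a b : ℝ}

/-- Truncating `f` to `(a, t)` turns the integral into an inner product of `L²(a, b; E)`, which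
makes the bound uniform in `t`. -/
theorem abs_integral_inner_le (f g : LT a b E) {t : ℝ} (ht : t ∈ Icc a b) :
    |∫ s in a..t, ⟪f s, g s⟫_ℝ| ≤ ‖f‖ * ‖g‖ := by
  have hm : MemLp ((Ioo a t).indicator f) 2 (timeMeasure a b) :=
    (Lp.memLp f).indicator measurableSet_Ioo
  have e : ∫ s in a..t, ⟪f s, g s⟫_ℝ = ⟪hm.toLp _, g⟫_ℝ := by
    rw [L2.inner_def, ← integral_Ioo_eq_intervalIntegral _ ht.1]
    have : ∀ᵐ s ∂(timeMeasure a b), ⟪(hm.toLp _ : ℝ → E) s, g s⟫_ℝ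
        = (Ioo a t).indicator (fun s => ⟪f s, g s⟫_ℝ) s := by
      filter_upwards [hm.coeFn_toLp] with s hs
      rw [hs]
      by_cases h : s ∈ Ioo a t <;> simp [h]
    rw [integral_congr_ae this, setIntegral_indicator measurableSet_Ioo,
      inter_eq_self_of_subset_right (Ioo_subset_Ioo_right ht.2)]
  rw [e]
  refine (abs_real_inner_le_norm _ _).trans ?_
  gcongr
  rw [Lp.norm_toLp, Lp.norm_def]
  exact ENNReal.toReal_mono (Lp.eLpNorm_ne_top f) (eLpNorm_indicator_le _)

theorem intervalIntegrable_inner (f g : LT a b E) {s t : ℝ} (hs : s ∈ Icc a b)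
    (ht : t ∈ Icc a b) : IntervalIntegrable (fun s => ⟪f s, g s⟫_ℝ) volume s t :=
  intervalIntegrable_of_integrable_Ioo (L2.integrable_inner f g) hs ht

/-- The fibrewise Gram operator `ι† ι` on `L²(a, b; E)`. -/
def gram (a b : ℝ) (ι : E →L[ℝ] G) : LT a b E →L[ℝ] LT a b E :=
  ((ContinuousLinearMap.adjoint ι).comp ι).compLpL 2 (timeMeasure a b)

theorem inner_gram (ι : E →L[ℝ] G) (f : LT a b E) :
    ∀ᵐ t ∂(timeMeasure a b), ∀ v, ⟪gram a b ι f t, v⟫_ℝ = ⟪ι (f t), ι v⟫_ℝ := by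
  filter_upwards [((ContinuousLinearMap.adjoint ι).comp ι).coeFn_compLpL (p := 2) f] with t h v
  rw [gram, h, ContinuousLinearMap.comp_apply, ContinuousLinearMap.adjoint_inner_left]

theorem gram_volterra (ι : E →L[ℝ] G) (f : LT a b E) :
    gram a b ι (volterra a b E f) = volterra a b E (gram a b ι f) :=
  volterra_compLpL _ _

theorem inner_gram_gram (ι : E →L[ℝ] G) (f g : LT a b E) :
    ⟪gram a b ι f, g⟫_ℝ = ⟪ι.compLpL 2 (timeMeasure a b) f, ι.compLpL 2 (timeMeasure a b) g⟫_ℝ := by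
  rw [L2.inner_def, L2.inner_def]
  refine integral_congr_ae ?_
  filter_upwards [inner_gram ι f, ι.coeFn_compLpL (p := 2) f, ι.coeFn_compLpL (p := 2) g]
    with t h1 h2 h3
  rw [h1, h2, h3]

theorem norm_prim_sq_gram (ι : E →L[ℝ] G) (ρ : LT a b E) {t : ℝ} (ht : t ∈ Icc a b) :
    ‖ι (prim a ρ t)‖ ^ 2 = 2 * ∫ s in a..t, ⟪gram a b ι ρ s, volterra a b E ρ s⟫_ℝ := by
  have hι : ∀ s ∈ Icc a b, ι (prim a ρ s) = prim a (fun r => ι (ρ r)) s := fun s hs =>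
    (ι.intervalIntegral_comp_comm (ρ.intervalIntegrable (left_mem_Icc.2 (hs.1.trans hs.2)) hs)).symm
  rw [hι t ht, norm_prim_sq (ι.integrable_comp ρ.integrable) ht]
  congr 1
  refine intervalIntegral_congr_timeMeasure (a := a) (b := b) ?_ le_rfl ht.1 ht.2
  filter_upwards [inner_gram ι ρ, coeFn_volterra ρ, ae_restrict_mem measurableSet_Ioo]
    with s h1 h2 hs
  rw [h1, h2, hι s (Ioo_subset_Icc_self hs)]

/-- If `d/dt (ι† ι z) = g` with `z, g ∈ L²(a, b; E)` and zero initial value, then `ι z` has a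
continuous representative, which satisfies the energy identity. -/
theorem exists_continuous_representative (hab : a ≤ b) (ι : E →L[ℝ] G) {z g : LT a b E}
    (h : gram a b ι z = volterra a b E g) :
    ∃ ζ : ℝ → G, ContinuousOn ζ (Icc a b) ∧ ζ a = 0 ∧ (∀ᵐ t ∂(timeMeasure a b), ζ t = ι (z t)) ∧
      ∀ t ∈ Icc a b, ‖ζ t‖ ^ 2 = 2 * ∫ s in a..t, ⟪g s, z s⟫_ℝ := by
  obtain ⟨R, hR, hcomm⟩ := exists_approximation (X := LT a b E) (S := volterra a b E)
    volterra_accretive volterra_injective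
  set S := volterra a b E with hS
  have hSR : ∀ n x, S (R n x) = R n (S x) := hcomm S fun x => rfl
  -- `S (R n z)` approximates `z` and has the time derivative `R n z` with values in `E`. Because `R
  -- n` commutes with the Gram operator and with `S`, this regularization satisfies the equation
  -- with right-hand side `S (R n g)`, and the elementary energy identity applies to it.
  have hgram : ∀ n, gram a b ι (R n z) = S (R n g) := by
    intro n
    rw [hcomm (gram a b ι) (gram_volterra ι), h, hSR]
  let Z : ℕ → ℝ → G := fun n t => ι (prim a (R n z) t)
  have hlin : ∀ n m, ∀ t ∈ Icc a b, Z n t - Z m t = ι (prim a (R n z - R m z : LT a b E) t) := by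
    intro n m t ht
    have : prim a (R n z - R m z : LT a b E) t = prim a (R n z) t - prim a (R m z) t := by
      rw [sub_eq_add_neg, ← neg_one_smul ℝ (R m z), prim_add _ _ ht, prim_smul _ _ ht]
      simp [sub_eq_add_neg]
    rw [this, map_sub]
  -- The energy identity of a difference bounds it uniformly in `t` by `L²` distances that tend to
  -- zero, so the `Z n` converge uniformly.
  have hdiff : ∀ n m, ∀ t ∈ Icc a b, ‖Z n t - Z m t‖ ^ 2 ≤
      2 * (‖S (R n g) - S (R m g)‖ * ‖S (R n z) - S (R m z)‖) := by
    intro n m t ht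
    rw [hlin n m t ht, norm_prim_sq_gram ι _ ht, map_sub, map_sub, hgram, hgram]
    gcongr
    exact (le_abs_self _).trans (abs_integral_inner_le _ _ ht)
  have hcauchy : UniformCauchySeqOn Z atTop (Icc a b) := by
    have hg := (hR g).cauchySeq
    have hz := (hR z).cauchySeq
    rw [Metric.uniformCauchySeqOn_iff]
    intro ε hε
    obtain ⟨N1, h1⟩ := Metric.cauchySeq_iff.1 hg (ε / 2) (by positivity)
    obtain ⟨N2, h2⟩ := Metric.cauchySeq_iff.1 hz (ε / 2) (by positivity)
    refine ⟨max N1 N2, fun m hm n hn t ht => ?_⟩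
    have a1 := h1 m (le_of_max_le_left hm) n (le_of_max_le_left hn)
    have a2 := h2 m (le_of_max_le_right hm) n (le_of_max_le_right hn)
    rw [dist_eq_norm] at a1 a2 ⊢
    have := hdiff m n t ht
    refine lt_of_pow_lt_pow_left₀ 2 hε.le ?_
    have h4 : ‖S (R m g) - S (R n g)‖ * ‖S (R m z) - S (R n z)‖ ≤ ε / 2 * (ε / 2) := by gcongr
    nlinarith
  have hlim : ∀ t ∈ Icc a b, ∃ l, Tendsto (fun n => Z n t) atTop (𝓝 l) := fun t ht =>
    cauchySeq_tendsto_of_complete (hcauchy.cauchy_map ht)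
  choose! ζ hζ using hlim
  have hunif : TendstoUniformlyOn Z ζ atTop (Icc a b) :=
    hcauchy.tendstoUniformlyOn_of_tendsto hζ
  refine ⟨ζ, ?_, ?_, ?_, ?_⟩
  · refine hunif.continuousOn (Frequently.of_forall fun n => ?_)
    exact ι.continuous.comp_continuousOn (continuousOn_prim (R n z).integrable)
  · refine tendsto_nhds_unique (hζ a (left_mem_Icc.2 hab)) ?_
    have : ∀ n, Z n a = 0 := fun n => by simp [Z, prim]
    simp only [this]
    exact tendsto_const_nhds
  -- The same sequence converges to `ι z` in `L²`; a subsequence that converges almost everywhere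
  -- identifies the two limits.
  · have hconv : Tendsto (fun n => ι.compLpL 2 (timeMeasure a b) (S (R n z))) atTop
        (𝓝 (ι.compLpL 2 (timeMeasure a b) z)) :=
      ((ι.compLpL 2 (timeMeasure a b)).continuous.tendsto z).comp (hR z)
    obtain ⟨ns, hns, hae⟩ := (tendstoInMeasure_of_tendsto_Lp hconv).exists_seq_tendsto_ae
    have hall : ∀ᵐ t ∂(timeMeasure a b), ∀ n,
        ι.compLpL 2 (timeMeasure a b) (S (R n z)) t = Z n t := by
      rw [ae_all_iff]
      intro n
      filter_upwards [ι.coeFn_compLpL (p := 2) (S (R n z)), coeFn_volterra (R n z)] with t h1 h2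
      rw [h1, h2]
    filter_upwards [hae, hall, ι.coeFn_compLpL (p := 2) z, ae_restrict_mem measurableSet_Ioo]
      with t h1 h2 h3 ht
    rw [h3] at h1
    refine tendsto_nhds_unique ((hζ t (Ioo_subset_Icc_self ht)).comp hns.tendsto_atTop) ?_
    refine h1.congr fun n => h2 _
  · intro t ht
    have h1 : Tendsto (fun n => ‖Z n t‖ ^ 2) atTop (𝓝 (‖ζ t‖ ^ 2)) := ((hζ t ht).norm).pow 2
    have h2 : Tendsto (fun n => 2 * ∫ s in a..t, ⟪S (R n g) s, S (R n z) s⟫_ℝ) atTop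
        (𝓝 (2 * ∫ s in a..t, ⟪g s, z s⟫_ℝ)) := by
      refine Tendsto.const_mul 2 ?_
      rw [tendsto_iff_norm_sub_tendsto_zero]
      have ha : a ∈ Icc a b := left_mem_Icc.2 hab
      have hb : ∀ n, ‖(∫ s in a..t, ⟪S (R n g) s, S (R n z) s⟫_ℝ) - ∫ s in a..t, ⟪g s, z s⟫_ℝ‖ ≤
          ‖S (R n g) - g‖ * ‖S (R n z)‖ + ‖g‖ * ‖S (R n z) - z‖ := by
        intro n
        have e : (∫ s in a..t, ⟪S (R n g) s, S (R n z) s⟫_ℝ) - ∫ s in a..t, ⟪g s, z s⟫_ℝ =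
            (∫ s in a..t, ⟪(S (R n g) - g : LT a b E) s, S (R n z) s⟫_ℝ) +
            ∫ s in a..t, ⟪g s, (S (R n z) - z : LT a b E) s⟫_ℝ := by
          rw [← intervalIntegral.integral_sub (intervalIntegrable_inner _ _ ha ht)
            (intervalIntegrable_inner _ _ ha ht),
            ← intervalIntegral.integral_add (intervalIntegrable_inner _ _ ha ht)
            (intervalIntegrable_inner _ _ ha ht)]
          refine intervalIntegral_congr_timeMeasure (a := a) (b := b) ?_ le_rfl ht.1 ht.2
          filter_upwards [Lp.coeFn_sub (S (R n g)) g, Lp.coeFn_sub (S (R n z)) z] with s e1 e2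
          rw [e1, e2, Pi.sub_apply, Pi.sub_apply, inner_sub_left, inner_sub_right]
          ring
        rw [e]
        refine (norm_add_le _ _).trans (add_le_add ?_ ?_)
        · exact abs_integral_inner_le _ _ ht
        · exact abs_integral_inner_le _ _ ht
      refine squeeze_zero (fun n => norm_nonneg _) hb ?_
      have t1 := tendsto_iff_norm_sub_tendsto_zero.1 (hR g)
      have t2 := tendsto_iff_norm_sub_tendsto_zero.1 (hR z)
      simpa using (t1.mul (hR z).norm).add (t2.const_mul ‖g‖)
    refine tendsto_nhds_unique h1 (h2.congr fun n => ?_)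
    rw [norm_prim_sq_gram ι _ ht, hgram]

end LionsMagenes

/-! ### The linear parabolic problem with zero initial value -/

section Parabolic

variable {E : Type*} [NormedAddCommGroup E] [InnerProductSpace ℝ E] [CompleteSpace E]
  {G : Type*} [NormedAddCommGroup G] [InnerProductSpace ℝ G] [CompleteSpace G] {a b : ℝ}

theorem inner_compLpL_ge {A : E →L[ℝ] E} {c : ℝ} (hA : ∀ v, c * ‖v‖ ^ 2 ≤ ⟪A v, v⟫_ℝ)
    (z : LT a b E) : c * ‖z‖ ^ 2 ≤ ⟪A.compLpL 2 (timeMeasure a b) z, z⟫_ℝ := by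
  rw [← real_inner_self_eq_norm_sq, L2.inner_def, L2.inner_def, ← integral_const_mul]
  refine integral_mono_ae ((L2.integrable_inner z z).const_mul c) (L2.integrable_inner _ _) ?_
  filter_upwards [A.coeFn_compLpL (p := 2) z] with t ht
  simp only [ht, real_inner_self_eq_norm_sq]
  exact hA _

/-- The equation is `(ι†ι + S A) z = S g`. By `exists_eq_of_adjoint_le` it suffices to bound `y = S†
x` by `(ι†ι + S A)† x`. Pairing the latter with `y` gives a nonnegative Gram term plus `⟪A y, y⟫`,
which is coercive. -/
theorem exists_parabolic (ι : E →L[ℝ] G) {A : E →L[ℝ] E} {c : ℝ} (hc : 0 < c)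
    (hA : ∀ v, c * ‖v‖ ^ 2 ≤ ⟪A v, v⟫_ℝ) (g : LT a b E) :
    ∃ z : LT a b E, gram a b ι z = volterra a b E (g - A.compLpL 2 _ z) := by
  set S := volterra a b E
  set Aop := A.compLpL 2 (timeMeasure a b)
  have key : ∀ x, ‖ContinuousLinearMap.adjoint S x‖ ≤
      c⁻¹ * ‖ContinuousLinearMap.adjoint (gram a b ι + S.comp Aop) x‖ := by
    intro x
    set y := ContinuousLinearMap.adjoint S x with hy
    have h1 : ⟪ContinuousLinearMap.adjoint (gram a b ι + S.comp Aop) x, y⟫_ℝ =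
        ⟪x, gram a b ι y⟫_ℝ + ⟪y, Aop y⟫_ℝ := by
      rw [ContinuousLinearMap.adjoint_inner_left, _root_.add_apply, inner_add_right,
        ContinuousLinearMap.comp_apply, ← ContinuousLinearMap.adjoint_inner_left S, ← hy]
    -- Since the Gram operator commutes with `S`, this pairing equals `⟪S (ι x), ι x⟫`, and `S` is
    -- accretive on `L²(a, b; G)` as well.
    have h2 : 0 ≤ ⟪x, gram a b ι y⟫_ℝ := by
      rw [real_inner_comm, inner_gram_gram, real_inner_comm, ← inner_gram_gram, hy,
        ContinuousLinearMap.adjoint_inner_right, ← gram_volterra, inner_gram_gram, volterra_compLpL]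
      exact volterra_accretive _
    have h3 : c * ‖y‖ ^ 2 ≤ ⟪y, Aop y⟫_ℝ := by rw [real_inner_comm]; exact inner_compLpL_ge hA y
    have h4 := real_inner_le_norm (ContinuousLinearMap.adjoint (gram a b ι + S.comp Aop) x) y
    set N := ‖ContinuousLinearMap.adjoint (gram a b ι + S.comp Aop) x‖
    have h5 : c * ‖y‖ * ‖y‖ ≤ N * ‖y‖ := by nlinarith
    rw [inv_mul_eq_div, le_div_iff₀ hc, mul_comm]
    rcases (norm_nonneg y).eq_or_lt with h0 | h0
    · rw [← h0, mul_zero]; exact norm_nonneg _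
    · exact le_of_mul_le_mul_right h5 h0
  obtain ⟨z, hz⟩ := exists_eq_of_adjoint_le key g
  refine ⟨z, ?_⟩
  rw [map_sub, ← hz]
  simp

/-- The final value in the energy identity at `b` is nonnegative and can be dropped. Applied to
differences this gives uniqueness, hence linearity of the solution map. -/
theorem norm_le_of_parabolic (hab : a ≤ b) (ι : E →L[ℝ] G) {A : E →L[ℝ] E} {c : ℝ} (hc : 0 < c)
    (hA : ∀ v, c * ‖v‖ ^ 2 ≤ ⟪A v, v⟫_ℝ) {g z : LT a b E}
    (h : gram a b ι z = volterra a b E (g - A.compLpL 2 _ z)) : ‖z‖ ≤ c⁻¹ * ‖g‖ := by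
  obtain ⟨ζ, -, -, -, h4⟩ := exists_continuous_representative hab ι h
  have h5 := h4 b (right_mem_Icc.2 hab)
  rw [← inner_eq_intervalIntegral hab, inner_sub_left] at h5
  have h6 := inner_compLpL_ge (a := a) (b := b) hA z
  have h7 := real_inner_le_norm g z
  have h8 : c * ‖z‖ * ‖z‖ ≤ ‖g‖ * ‖z‖ := by nlinarith [sq_nonneg ‖ζ b‖]
  rw [inv_mul_eq_div, le_div_iff₀ hc, mul_comm]
  rcases (norm_nonneg z).eq_or_lt with h0 | h0
  · rw [← h0, mul_zero]; exact norm_nonneg _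
  · exact le_of_mul_le_mul_right h8 h0

/-- The solution operator `g ↦ z` of `z' + A z = g`, `z(a) = 0`. -/
theorem exists_parabolic_operator (hab : a ≤ b) (ι : E →L[ℝ] G) {A : E →L[ℝ] E} {c : ℝ}
    (hc : 0 < c) (hA : ∀ v, c * ‖v‖ ^ 2 ≤ ⟪A v, v⟫_ℝ) :
    ∃ P : LT a b E →L[ℝ] LT a b E, ∀ g,
      gram a b ι (P g) = volterra a b E (g - A.compLpL 2 _ (P g)) := by
  choose P hP using exists_parabolic (a := a) (b := b) ι hc hA
  have huniq : ∀ g z : LT a b E, gram a b ι z = volterra a b E (g - A.compLpL 2 _ z) →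
      z = P g := by
    intro g z h
    have : ‖z - P g‖ ≤ c⁻¹ * ‖(0 : LT a b E)‖ := by
      refine norm_le_of_parabolic hab ι hc hA ?_
      rw [map_sub, h, hP g, ← map_sub]
      congr 1
      rw [map_sub]; abel
    rw [norm_zero, mul_zero, norm_le_zero_iff, sub_eq_zero] at this
    exact this
  refine ⟨LinearMap.mkContinuous ⟨⟨P, fun g h => ?_⟩, fun r g => ?_⟩ c⁻¹ fun g => ?_, hP⟩
  · refine (huniq _ _ ?_).symm
    rw [map_add (gram a b ι), hP, hP, ← map_add (volterra a b E), map_add (A.compLpL 2 _)]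
    congr 1; abel
  · refine (huniq _ _ ?_).symm
    change gram a b ι (r • P g) = volterra a b E (r • g - A.compLpL 2 _ (r • P g))
    rw [map_smul, hP, ← map_smul (volterra a b E), map_smul (A.compLpL 2 _), smul_sub]
  · exact norm_le_of_parabolic hab ι hc hA (hP g)

end Parabolic

/-! ### The method of continuity -/

section Continuation

open Metric

theorem unit_interval_induction {Q : ℝ → Prop} {δ : ℝ} (hδ : 0 < δ) (h0 : Q 0)
    (hs : ∀ s ∈ Icc (0 : ℝ) 1, Q s → ∀ s' ∈ Icc (0 : ℝ) 1, |s' - s| ≤ δ → Q s') : Q 1 := by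
  obtain ⟨n, hn⟩ := exists_nat_one_div_lt hδ
  have hn0 : (0 : ℝ) < n + 1 := by positivity
  have key : ∀ k : ℕ, k ≤ n + 1 → Q (k / (n + 1)) := by
    intro k
    induction k with
    | zero => intro _; simpa using h0
    | succ k ih =>
      intro hk
      have hk' : ((k : ℝ) + 1) ≤ n + 1 := by exact_mod_cast hk
      refine hs _ ⟨by positivity, ?_⟩ (ih (by omega)) _ ⟨by positivity, ?_⟩ ?_
      · rw [div_le_one hn0]; linarith
      · push_cast; rwa [div_le_one hn0]
      · push_cast
        rw [← sub_div, add_sub_cancel_left, abs_of_pos (by positivity)]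
        exact hn.le
  have := key (n + 1) le_rfl
  push_cast at this
  rwa [div_self hn0.ne'] at this

theorem inv_mul_mul_add_one_cancel {k M x : ℝ} (hx : 0 ≤ x) :
    (k * M * (x + 1))⁻¹ * (x + 1) = M⁻¹ / k := by
  rw [mul_inv, mul_assoc, inv_mul_cancel₀ (by linarith), mul_one, mul_inv, mul_comm, div_eq_mul_inv]

variable {X : Type*} [NormedAddCommGroup X] [NormedSpace ℝ X] [CompleteSpace X]
  {Y : Type*} [NormedAddCommGroup Y] [NormedSpace ℝ Y]

/-- A map close to a surjective linear map that is bounded below takes every value near its value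
at the centre of a ball. -/
theorem exists_eq_zero_of_approximates {f : X → X} {L : X →L[ℝ] X} {M c ε : ℝ} (hM : 0 < M)
    (hL : Function.Surjective L) (hb : ∀ h, ‖h‖ ≤ M * ‖L h‖) (hc : 0 ≤ c) (hε : 0 ≤ ε) {g : X}
    (happ : ∀ x ∈ closedBall g ε, ∀ y ∈ closedBall g ε, ‖f x - f y - L (x - y)‖ ≤ c * ‖x - y‖)
    (y : X) (hg : ‖y - f g‖ ≤ (M⁻¹ - c) * ε) : ∃ x, f x = y := by
  let R : L.NonlinearRightInverse :=
    { toFun := Function.surjInv hL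
      nnnorm := ⟨M, hM.le⟩
      bound' := fun y => by
        have := hb (Function.surjInv hL y)
        rwa [Function.surjInv_eq hL] at this
      right_inv' := Function.surjInv_eq hL }
  have hA : ApproximatesLinearOn f L (closedBall g ε) ⟨c, hc⟩ := by
    intro x hx y hy
    exact happ x hx y hy
  obtain ⟨x, -, hx⟩ := hA.surjOn_closedBall_of_nonlinearRightInverse R hε Subset.rfl
    (show y ∈ closedBall (f g) (((R.nnnorm : ℝ)⁻¹ - (⟨c, hc⟩ : NNReal)) * ε) by
      rw [mem_closedBall, dist_eq_norm]; exact hg)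
  exact ⟨x, hx⟩

/-- The linear method of continuity. -/
theorem surjective_of_bounded_below {T : X →L[ℝ] X} {M : ℝ} (hM : 0 < M)
    (h : ∀ s ∈ Icc (0 : ℝ) 1, ∀ x, ‖x‖ ≤ M * ‖x + s • T x‖) :
    Function.Surjective (ContinuousLinearMap.id ℝ X + T) := by
  -- Surjectivity spreads from `s` to `s'` once `|s' - s| * ‖T‖ ≤ M⁻¹ / 2`, half of the lower bound
  -- of the operator. The `+ 1` covers `T = 0`.
  have key := unit_interval_induction
    (Q := fun s => Function.Surjective (ContinuousLinearMap.id ℝ X + s • T))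
    (δ := (2 * M * (‖T‖ + 1))⁻¹) (by positivity) ?_ ?_
  · simpa using key
  · simpa using Function.surjective_id
  intro s hs hsurj s' _ hss y
  have hcM : (2 * M * (‖T‖ + 1))⁻¹ * ‖T‖ ≤ M⁻¹ / 2 := by
    rw [inv_mul_eq_div, div_le_iff₀ (by positivity)]
    have : M⁻¹ / 2 * (2 * M * (‖T‖ + 1)) = ‖T‖ + 1 := by field_simp
    linarith
  -- The radius satisfies `(M⁻¹ - M⁻¹ / 2) * ε = ‖y‖`, just enough to reach `y` from `0`.
  refine exists_eq_zero_of_approximates (f := ContinuousLinearMap.id ℝ X + s' • T)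
    (L := ContinuousLinearMap.id ℝ X + s • T) (c := M⁻¹ / 2) (ε := 2 * M * ‖y‖) (g := 0) hM hsurj
    (h s hs) (by positivity) (by positivity) ?_ y ?_
  · intro x _ z _
    have e : (ContinuousLinearMap.id ℝ X + s' • T) x - (ContinuousLinearMap.id ℝ X + s' • T) z -
        (ContinuousLinearMap.id ℝ X + s • T) (x - z) = (s' - s) • T (x - z) := by
      simp [sub_smul, smul_sub]; abel
    rw [e, norm_smul, Real.norm_eq_abs]
    calc _ ≤ (2 * M * (‖T‖ + 1))⁻¹ * (‖T‖ * ‖x - z‖) := by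
          gcongr; exact T.le_opNorm _
      _ ≤ _ := by rw [← mul_assoc]; gcongr
  · rw [map_zero, sub_zero]
    refine le_of_eq ?_
    field_simp
    ring

/-- A quadratic equation `g + D₁ u + B(u, u) = D₀ p₀ + B(p₀, p₀)`, `u = p₀ + P g`, has a solution
if its linearizations along the homotopy from `D₀` to `D₁` satisfy uniform a priori estimates. -/
theorem exists_solution_of_apriori (P : X →L[ℝ] Y) (D₀ D₁ : Y →L[ℝ] X) (B : Y →L[ℝ] Y →L[ℝ] X)
    (p₀ : Y)
    (hap : ∀ R : ℝ, ∃ M : ℝ, 0 < M ∧ ∀ l ∈ Icc (0 : ℝ) 1, ∀ s ∈ Icc (0 : ℝ) 1, ∀ p q : Y,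
      ‖q‖ ≤ R → ∀ h : X,
        ‖P h‖ ≤ M * ‖h + s • ((D₀ + l • (D₁ - D₀)) (P h) + B p (P h) + B (P h) q)‖) :
    ∃ g : X, g + D₁ (p₀ + P g) + B (p₀ + P g) (p₀ + P g) = D₀ p₀ + B p₀ p₀ := by
  -- Solutions `u = p₀ + P g` along the homotopy are bounded first. As `B u u - B p₀ p₀ = B u (P g)
  -- + B (P g) p₀`, the nonlinear equation is a linearized one with `p = u` and `q = p₀`. The
  -- estimate requires no bound on `p`, so there is no circularity.
  obtain ⟨M₀, hM₀, h₀⟩ := hap ‖p₀‖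
  set Δ := ‖D₁ - D₀‖ with hΔ
  set R₁ := ‖p₀‖ + M₀ * (Δ * ‖p₀‖) with hR₁
  have hR₁0 : 0 ≤ R₁ := by positivity
  have hbound : ∀ l ∈ Icc (0 : ℝ) 1, ∀ g : X,
      g + (D₀ + l • (D₁ - D₀)) (p₀ + P g) + B (p₀ + P g) (p₀ + P g) = D₀ p₀ + B p₀ p₀ →
      ‖p₀ + P g‖ ≤ R₁ := by
    intro l hl g hg
    have h := h₀ l hl 1 (by simp) (p₀ + P g) p₀ le_rfl g
    have e : g + (1 : ℝ) • ((D₀ + l • (D₁ - D₀)) (P g) + B (p₀ + P g) (P g) + B (P g) p₀) =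
        -(l • (D₁ - D₀) p₀) := by
      simp only [map_add, _root_.add_apply, _root_.smul_apply, one_smul] at hg ⊢
      rw [← sub_eq_zero] at hg ⊢
      rw [← hg]; abel
    rw [e, norm_neg, norm_smul, Real.norm_of_nonneg hl.1] at h
    have h2 : l * ‖(D₁ - D₀) p₀‖ ≤ 1 * (Δ * ‖p₀‖) := by
      gcongr
      · exact hl.2
      · exact (D₁ - D₀).le_opNorm _
    calc _ ≤ ‖p₀‖ + ‖P g‖ := norm_add_le _ _
      _ ≤ _ := by rw [hR₁, ← one_mul (Δ * ‖p₀‖)]; gcongr; exact h.trans (by gcongr)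
  -- The derivative at a solution `u` is the case `p = q = u` with `‖u‖ ≤ R₁`. The constant `M`
  -- below upgrades the estimate of `P h` to one of `h`.
  obtain ⟨M₁, hM₁, h₁⟩ := hap R₁
  set N := ‖D₀‖ + Δ + ‖B‖ * R₁ + ‖B‖ * R₁ with hN
  set M := 1 + N * M₁ with hM
  have hMpos : 0 < M := by positivity
  have hlin : ∀ l ∈ Icc (0 : ℝ) 1, ∀ u : Y, ‖u‖ ≤ R₁ → ∀ s ∈ Icc (0 : ℝ) 1, ∀ h : X,
      ‖h‖ ≤ M * ‖h + s • ((D₀ + l • (D₁ - D₀)) (P h) + B u (P h) + B (P h) u)‖ := by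
    intro l hl u hu s hs h
    have h2 := h₁ l hl s hs u u hu h
    set r := h + s • ((D₀ + l • (D₁ - D₀)) (P h) + B u (P h) + B (P h) u) with hr
    set w := (D₀ + l • (D₁ - D₀)) (P h) + B u (P h) + B (P h) u with hw
    have hwn : ‖w‖ ≤ N * ‖P h‖ := by
      have a1 : ‖(D₀ + l • (D₁ - D₀)) (P h)‖ ≤ (‖D₀‖ + Δ) * ‖P h‖ := by
        refine (ContinuousLinearMap.le_opNorm _ _).trans ?_
        gcongr
        refine (norm_add_le _ _).trans ?_
        gcongr
        rw [norm_smul, Real.norm_of_nonneg hl.1]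
        exact mul_le_of_le_one_left (norm_nonneg _) hl.2
      have a2 : ‖B u (P h)‖ ≤ ‖B‖ * R₁ * ‖P h‖ := (B.le_opNorm₂ u (P h)).trans (by gcongr)
      have a3 : ‖B (P h) u‖ ≤ ‖B‖ * R₁ * ‖P h‖ :=
        (B.le_opNorm₂ (P h) u).trans (by rw [mul_right_comm]; gcongr)
      refine (norm_add₃_le).trans ?_
      rw [hN]; linarith
    have e : h = r - s • w := by rw [hr]; abel
    calc ‖h‖ = ‖r - s • w‖ := by rw [← e]
      _ ≤ ‖r‖ + ‖s • w‖ := norm_sub_le _ _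
      _ ≤ ‖r‖ + 1 * (N * (M₁ * ‖r‖)) := by
          rw [norm_smul, Real.norm_of_nonneg hs.1]
          gcongr
          · exact hs.2
          · exact hwn.trans (by gcongr)
      _ = M * ‖r‖ := by rw [hM]; ring
  -- `ε` keeps the quadratic remainder below `M⁻¹ / 4`, and the first entry of `δ` does the same for
  -- the change of the linear term. The second entry keeps the residual at `g`, at most `δ * Δ *
  -- R₁`, within `(M⁻¹ / 2) * ε`.
  set ε := (8 * M * (‖B‖ * ‖P‖ * ‖P‖ + 1))⁻¹ with hε
  have hε0 : 0 < ε := by positivity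
  set δ := min (4 * M * (Δ * ‖P‖ + 1))⁻¹ (ε * (2 * M * (Δ * R₁ + 1))⁻¹) with hδ
  have hδ0 : 0 < δ := by positivity
  have key := unit_interval_induction (Q := fun l => ∃ g : X,
    g + (D₀ + l • (D₁ - D₀)) (p₀ + P g) + B (p₀ + P g) (p₀ + P g) = D₀ p₀ + B p₀ p₀) hδ0 ?_ ?_
  · simpa using key
  · exact ⟨0, by simp⟩
  rintro l hl ⟨g, hg⟩ l' hl' hll
  set u := p₀ + P g with hu
  have huR := hbound l hl g hg
  let T : X →L[ℝ] X := ((D₀ + l • (D₁ - D₀)) + B u + B.flip u).comp P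
  have hT : ∀ h, T h = (D₀ + l • (D₁ - D₀)) (P h) + B u (P h) + B (P h) u := fun h => rfl
  have hTb : ∀ s ∈ Icc (0 : ℝ) 1, ∀ x, ‖x‖ ≤ M * ‖x + s • T x‖ := fun s hs x =>
    hlin l hl u huR s hs x
  have hsurj := surjective_of_bounded_below hMpos hTb
  refine exists_eq_zero_of_approximates
    (f := fun g => g + (D₀ + l' • (D₁ - D₀)) (p₀ + P g) + B (p₀ + P g) (p₀ + P g))
    (L := ContinuousLinearMap.id ℝ X + T) (c := M⁻¹ / 2) (ε := ε) (g := g) hMpos hsurj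
    (fun h => by simpa using hTb 1 (by simp) h) (by positivity) hε0.le ?_ _ ?_
  · intro x hx y hy
    rw [mem_closedBall, dist_eq_norm] at hx hy
    have e : x + (D₀ + l' • (D₁ - D₀)) (p₀ + P x) + B (p₀ + P x) (p₀ + P x) -
        (y + (D₀ + l' • (D₁ - D₀)) (p₀ + P y) + B (p₀ + P y) (p₀ + P y)) -
        (ContinuousLinearMap.id ℝ X + T) (x - y) =
        (l' - l) • (D₁ - D₀) (P (x - y)) + (B (P (x - g)) (P (x - y)) + B (P (x - y)) (P (y - g))) := by
      have : (ContinuousLinearMap.id ℝ X + T) (x - y) = (x - y) +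
        ((D₀ + l • (D₁ - D₀)) (P (x - y)) + B u (P (x - y)) + B (P (x - y)) u) := rfl
      rw [this, hu]
      simp only [map_add, map_sub, _root_.add_apply, _root_.sub_apply, _root_.smul_apply, sub_smul,
        smul_sub]
      abel
    rw [e]
    have b1 : ‖(l' - l) • (D₁ - D₀) (P (x - y))‖ ≤ M⁻¹ / 4 * ‖x - y‖ := by
      rw [norm_smul, Real.norm_eq_abs]
      have c1 : δ * (Δ * ‖P‖) ≤ M⁻¹ / 4 := by
        calc δ * (Δ * ‖P‖) ≤ (4 * M * (Δ * ‖P‖ + 1))⁻¹ * (Δ * ‖P‖ + 1) := by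
              gcongr
              · exact min_le_left _ _
              · linarith
          _ = M⁻¹ / 4 := inv_mul_mul_add_one_cancel (by positivity)
      calc |l' - l| * ‖(D₁ - D₀) (P (x - y))‖ ≤ δ * (Δ * (‖P‖ * ‖x - y‖)) := by
            gcongr
            exact (ContinuousLinearMap.le_opNorm _ _).trans
              (by gcongr; exact ContinuousLinearMap.le_opNorm _ _)
        _ = δ * (Δ * ‖P‖) * ‖x - y‖ := by ring
        _ ≤ _ := by gcongr
    have hPε : ∀ x : X, ‖x - g‖ ≤ ε → ‖P (x - g)‖ ≤ ‖P‖ * ε := fun x hx =>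
      (P.le_opNorm _).trans (by gcongr)
    have c2 : ‖B‖ * (‖P‖ * ε) * ‖P‖ ≤ M⁻¹ / 8 := by
      calc ‖B‖ * (‖P‖ * ε) * ‖P‖ = (8 * M * (‖B‖ * ‖P‖ * ‖P‖ + 1))⁻¹ * (‖B‖ * ‖P‖ * ‖P‖) := by
            rw [hε]; ring
        _ ≤ (8 * M * (‖B‖ * ‖P‖ * ‖P‖ + 1))⁻¹ * (‖B‖ * ‖P‖ * ‖P‖ + 1) := by gcongr; linarith
        _ = M⁻¹ / 8 := inv_mul_mul_add_one_cancel (by positivity)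
    have b2 : ‖B (P (x - g)) (P (x - y))‖ ≤ M⁻¹ / 8 * ‖x - y‖ := by
      calc _ ≤ ‖B‖ * ‖P (x - g)‖ * ‖P (x - y)‖ := B.le_opNorm₂ _ _
        _ ≤ ‖B‖ * (‖P‖ * ε) * (‖P‖ * ‖x - y‖) := by
            gcongr
            · exact hPε x hx
            · exact P.le_opNorm _
        _ ≤ _ := by rw [← mul_assoc]; gcongr
    have b3 : ‖B (P (x - y)) (P (y - g))‖ ≤ M⁻¹ / 8 * ‖x - y‖ := by
      calc _ ≤ ‖B‖ * ‖P (x - y)‖ * ‖P (y - g)‖ := B.le_opNorm₂ _ _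
        _ ≤ ‖B‖ * (‖P‖ * ‖x - y‖) * (‖P‖ * ε) := by
            gcongr
            · exact P.le_opNorm _
            · exact hPε y hy
        _ = ‖B‖ * (‖P‖ * ε) * ‖P‖ * ‖x - y‖ := by ring
        _ ≤ _ := by gcongr
    refine (norm_add_le _ _).trans ((add_le_add b1 ((norm_add_le _ _).trans
      (add_le_add b2 b3))).trans (le_of_eq (by ring)))
  · have e : D₀ p₀ + B p₀ p₀ - (g + (D₀ + l' • (D₁ - D₀)) (p₀ + P g) +
        B (p₀ + P g) (p₀ + P g)) = (l - l') • (D₁ - D₀) u := by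
      rw [← hg, ← hu]
      simp only [_root_.add_apply, _root_.smul_apply, sub_smul]
      abel
    rw [e, norm_smul, Real.norm_eq_abs, abs_sub_comm]
    calc |l' - l| * ‖(D₁ - D₀) u‖ ≤ (ε * (2 * M * (Δ * R₁ + 1))⁻¹) * (Δ * R₁ + 1) := by
          gcongr
          · exact hll.trans (min_le_right _ _)
          · refine ((D₁ - D₀).le_opNorm _).trans ?_
            have : Δ * ‖u‖ ≤ Δ * R₁ := by gcongr
            linarith
      _ = (M⁻¹ - M⁻¹ / 2) * ε := by
          rw [mul_assoc, inv_mul_mul_add_one_cancel (by positivity)]; ring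

end Continuation

/-! ### A Gronwall inequality with an integrable kernel -/

/-- Where `k` has mass at most `1/2`, the majorant `A + ∫ k y` at most doubles, because half of the
maximum of `y` can be absorbed. The intermediate value theorem cuts `[a, t]` into stretches of mass
`1/2`. -/
theorem gronwall_doubling {a b : ℝ} {y k : ℝ → ℝ} {A : ℝ} (hA : 0 ≤ A)
    (hy : ContinuousOn y (Icc a b)) (hy0 : ∀ t ∈ Icc a b, 0 ≤ y t)
    (hk : Integrable k (timeMeasure a b)) (hk0 : ∀ t, 0 ≤ k t)
    (h : ∀ t ∈ Icc a b, y t ≤ A + ∫ s in a..t, k s * y s) (n : ℕ) :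
    ∀ t ∈ Icc a b, ∫ s in a..t, k s ≤ (n + 1) / 2 → y t ≤ 2 ^ (n + 1) * A := by
  have hkI : ∀ {s t}, s ∈ Icc a b → t ∈ Icc a b → IntervalIntegrable k volume s t :=
    fun hs ht => intervalIntegrable_of_integrable_Ioo hk hs ht
  have hkyI : ∀ {s t}, s ∈ Icc a b → t ∈ Icc a b →
      IntervalIntegrable (fun r => k r * y r) volume s t := fun hs ht =>
    (hkI hs ht).mul_continuousOn (hy.mono (uIcc_subset_Icc hs ht))
  have step : ∀ s ∈ Icc a b, ∀ t ∈ Icc a b, s ≤ t → ∫ r in s..t, k r ≤ 1 / 2 →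
      A + ∫ r in a..t, k r * y r ≤ 2 * (A + ∫ r in a..s, k r * y r) := by
    intro s hs t ht hst hK
    have ha : a ∈ Icc a b := left_mem_Icc.2 (hs.1.trans hs.2)
    obtain ⟨t₀, ht₀, hmax⟩ := isCompact_Icc.exists_isMaxOn (nonempty_Icc.2 hst)
      (hy.mono (Icc_subset_Icc hs.1 ht.2))
    have ht₀' : t₀ ∈ Icc a b := ⟨hs.1.trans ht₀.1, ht₀.2.trans ht.2⟩
    have hm0 := hy0 t₀ ht₀'
    have hle : ∀ τ ∈ Icc s t, ∫ r in s..τ, k r * y r ≤ 1 / 2 * y t₀ := by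
      intro τ hτ
      have hτ' : τ ∈ Icc a b := ⟨hs.1.trans hτ.1, hτ.2.trans ht.2⟩
      calc ∫ r in s..τ, k r * y r ≤ ∫ r in s..τ, k r * y t₀ := by
            refine intervalIntegral.integral_mono_on hτ.1 (hkyI hs hτ')
              ((hkI hs hτ').mul_const _) fun r hr => ?_
            exact mul_le_mul_of_nonneg_left (hmax ⟨hr.1, hr.2.trans hτ.2⟩) (hk0 r)
        _ = (∫ r in s..τ, k r) * y t₀ := intervalIntegral.integral_mul_const _ _
        _ ≤ (∫ r in s..t, k r) * y t₀ := by
            gcongr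
            refine intervalIntegral.integral_mono_interval le_rfl hτ.1 hτ.2
              (Filter.Eventually.of_forall hk0) (hkI hs ht)
        _ ≤ _ := by gcongr
    have e : ∀ τ ∈ Icc a b, ∫ r in a..τ, k r * y r =
        (∫ r in a..s, k r * y r) + ∫ r in s..τ, k r * y r := fun τ hτ =>
      (intervalIntegral.integral_add_adjacent_intervals (hkyI ha hs) (hkyI hs hτ)).symm
    have h1 := h t₀ ht₀'
    rw [e t₀ ht₀'] at h1
    rw [e t ht]
    linarith [hle t₀ ht₀, hle t (right_mem_Icc.2 hst)]
  have main : ∀ n : ℕ, ∀ t ∈ Icc a b, ∫ s in a..t, k s ≤ (n + 1) / 2 →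
      A + ∫ s in a..t, k s * y s ≤ 2 ^ (n + 1) * A := by
    intro n
    induction n with
    | zero =>
      intro t ht hK
      have ha : a ∈ Icc a b := left_mem_Icc.2 (ht.1.trans ht.2)
      have := step a ha t ht ht.1 (by simpa using hK)
      simpa using this
    | succ n ih =>
      intro t ht hK
      have ha : a ∈ Icc a b := left_mem_Icc.2 (ht.1.trans ht.2)
      rcases le_or_gt (∫ s in a..t, k s) ((n + 1) / 2) with hle | hgt
      · refine (ih t ht hle).trans ?_
        rw [pow_succ 2 (n + 1)]
        have : 0 ≤ (2 : ℝ) ^ (n + 1) * A := by positivity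
        linarith
      · have hc : ContinuousOn (prim a k) (Icc a t) :=
          (continuousOn_prim hk).mono (Icc_subset_Icc_right ht.2)
        obtain ⟨s, hs, hKs⟩ := intermediate_value_Icc ht.1 hc
          (show ((n : ℝ) + 1) / 2 ∈ Icc (prim a k a) (prim a k t) from
            ⟨by simp only [prim, intervalIntegral.integral_same]; positivity, hgt.le⟩)
        have hs' : s ∈ Icc a b := ⟨hs.1, hs.2.trans ht.2⟩
        have h1 := ih s hs' hKs.le
        have h2 := step s hs' t ht hs.2 (by
          rw [← intervalIntegral.integral_interval_sub_left (hkI ha ht) (hkI ha hs')]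
          have : ∫ r in a..s, k r = ((n : ℝ) + 1) / 2 := hKs
          rw [this]
          push_cast at hK
          linarith)
        rw [pow_succ 2 (n + 1)]
        linarith
  exact fun t ht hK => (h t ht).trans (main n t ht hK)

/-! ### Quadratic perturbations of the parabolic problem -/

section Quadratic

variable {E : Type*} [NormedAddCommGroup E] [InnerProductSpace ℝ E] [CompleteSpace E]
  {G : Type*} [NormedAddCommGroup G] [InnerProductSpace ℝ G] [CompleteSpace G] {a b : ℝ}

theorem norm_sq_eq_integral {α : Type*} [MeasurableSpace α] {μ : Measure α} (f : Lp E 2 μ) :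
    ‖f‖ ^ 2 = ∫ t, ‖f t‖ ^ 2 ∂μ := by
  rw [← real_inner_self_eq_norm_sq, L2.inner_def]
  simp only [real_inner_self_eq_norm_sq]

theorem integrable_norm_sq {α : Type*} [MeasurableSpace α] {μ : Measure α} (f : Lp E 2 μ) :
    Integrable (fun t => ‖f t‖ ^ 2) μ :=
  (memLp_two_iff_integrable_sq_norm (Lp.aestronglyMeasurable f)).1 (Lp.memLp f)

theorem integrable_norm_mul_norm {α : Type*} [MeasurableSpace α] {μ : Measure α}
    {F : Type*} [NormedAddCommGroup F] (f : Lp E 2 μ) (g : Lp F 2 μ) :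
    Integrable (fun t => ‖f t‖ * ‖g t‖) μ :=
  MemLp.integrable_mul (Lp.memLp f).norm (Lp.memLp g).norm

theorem integral_norm_mul_norm_le {α : Type*} [MeasurableSpace α] {μ : Measure α}
    {F : Type*} [NormedAddCommGroup F] (f : Lp E 2 μ) (g : Lp F 2 μ) :
    ∫ t, ‖f t‖ * ‖g t‖ ∂μ ≤ ‖f‖ * ‖g‖ := by
  have hf := (Lp.memLp f).norm
  have hg := (Lp.memLp g).norm
  have e : ∫ t, ‖f t‖ * ‖g t‖ ∂μ = ⟪hf.toLp _, hg.toLp _⟫_ℝ := by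
    rw [L2.inner_def]
    refine integral_congr_ae ?_
    filter_upwards [hf.coeFn_toLp, hg.coeFn_toLp] with t h1 h2
    rw [h1, h2, real_inner_eq_re_inner]
    simp [mul_comm]
  rw [e]
  refine (real_inner_le_norm _ _).trans (le_of_eq ?_)
  rw [Lp.norm_toLp, Lp.norm_toLp, eLpNorm_norm, eLpNorm_norm, Lp.norm_def, Lp.norm_def]

/-- The space `L²(a, b; E) ∩ L^∞(a, b; G)`, where `E` is mapped to `G` by `ι`. -/
def energySpace (a b : ℝ) (ι : E →L[ℝ] G) : Submodule ℝ (LT a b E × Lp G ⊤ (timeMeasure a b)) where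
  carrier := {p | p.2 =ᵐ[timeMeasure a b] fun t => ι (p.1 t)}
  zero_mem' := by
    change ((0 : Lp G ⊤ (timeMeasure a b)) : ℝ → G) =ᵐ[timeMeasure a b]
      fun t => ι ((0 : LT a b E) t)
    filter_upwards [Lp.coeFn_zero G ⊤ (timeMeasure a b), Lp.coeFn_zero E 2 (timeMeasure a b)]
      with t h1 h2
    rw [h1, h2]; simp
  add_mem' := by
    intro p q hp hq
    change ((p.2 + q.2 : Lp G ⊤ (timeMeasure a b)) : ℝ → G) =ᵐ[timeMeasure a b]
      fun t => ι ((p.1 + q.1 : LT a b E) t)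
    filter_upwards [hp, hq, Lp.coeFn_add p.1 q.1, Lp.coeFn_add p.2 q.2] with t h1 h2 h3 h4
    rw [h3, h4]; simp [h1, h2]
  smul_mem' := by
    intro c p hp
    change ((c • p.2 : Lp G ⊤ (timeMeasure a b)) : ℝ → G) =ᵐ[timeMeasure a b]
      fun t => ι ((c • p.1 : LT a b E) t)
    filter_upwards [hp, Lp.coeFn_smul c p.1, Lp.coeFn_smul c p.2] with t h1 h3 h4
    rw [h3, h4]; simp [h1]

theorem ae_norm_le_norm_top (f : Lp G ⊤ (timeMeasure a b)) :
    ∀ᵐ t ∂(timeMeasure a b), ‖f t‖ ≤ ‖f‖ := by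
  have h := ae_le_eLpNormEssSup (f := f) (μ := timeMeasure a b)
  filter_upwards [h] with t ht
  rw [Lp.norm_def, eLpNorm_exponent_top, ← toReal_enorm]
  refine ENNReal.toReal_mono ?_ ht
  rw [← eLpNorm_exponent_top]
  exact Lp.eLpNorm_ne_top f

theorem energySpace_ae_le (ι : E →L[ℝ] G) (p : energySpace a b ι) :
    ∀ᵐ t ∂(timeMeasure a b), ‖ι (p.1.1 t)‖ ≤ ‖p‖ := by
  filter_upwards [p.2, ae_norm_le_norm_top p.1.2] with t h1 h2
  rw [← h1]
  exact h2.trans (norm_snd_le p.1)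

theorem energySpace_norm_fst_le (ι : E →L[ℝ] G) (p : energySpace a b ι) : ‖p.1.1‖ ≤ ‖p‖ :=
  norm_fst_le p.1

theorem exists_mem_energySpace (ι : E →L[ℝ] G) {z : LT a b E} {C : ℝ} (hC : 0 ≤ C)
    (h : ∀ᵐ t ∂(timeMeasure a b), ‖ι (z t)‖ ≤ C) :
    ∃ p : energySpace a b ι, p.1.1 = z ∧ ‖p‖ ≤ max ‖z‖ C := by
  have hm : MemLp (fun t => ι (z t)) ⊤ (timeMeasure a b) :=
    memLp_top_of_bound (ι.continuous.comp_aestronglyMeasurable (Lp.aestronglyMeasurable z)) C h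
  refine ⟨⟨(z, hm.toLp _), hm.coeFn_toLp⟩, rfl, ?_⟩
  refine max_le_max le_rfl ?_
  change ‖hm.toLp _‖ ≤ C
  rw [Lp.norm_toLp]
  refine ENNReal.toReal_le_of_le_ofReal hC ?_
  rw [eLpNorm_exponent_top]
  exact eLpNormEssSup_le_of_ae_bound h

theorem energySpace_ext (ι : E →L[ℝ] G) {p q : energySpace a b ι} (h : p.1.1 = q.1.1) : p = q := by
  refine Subtype.ext (Prod.ext h (Lp.ext ?_))
  filter_upwards [p.2, q.2] with t h1 h2
  rw [h1, h2, h]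

/-- An operator into `L²(a, b; E)` that is bounded into `L^∞(a, b; G)`, as an operator into the
energy space. -/
theorem exists_lift_energySpace {X : Type*} [NormedAddCommGroup X] [NormedSpace ℝ X]
    (ι : E →L[ℝ] G) (P : X →L[ℝ] LT a b E) {C : ℝ} (hC : 0 ≤ C)
    (h : ∀ x, ∀ᵐ t ∂(timeMeasure a b), ‖ι (P x t)‖ ≤ C * ‖x‖) :
    ∃ Q : X →L[ℝ] energySpace a b ι, ∀ x, (Q x).1.1 = P x := by
  choose Q hQ hQn using fun x => exists_mem_energySpace ι (mul_nonneg hC (norm_nonneg x)) (h x)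
  refine ⟨LinearMap.mkContinuous ⟨⟨Q, fun x y => ?_⟩, fun r x => ?_⟩ (max ‖P‖ C) fun x => ?_, hQ⟩
  · refine energySpace_ext ι ?_
    rw [hQ, map_add, ← hQ, ← hQ]; rfl
  · refine energySpace_ext ι ?_
    change (Q (r • x)).1.1 = r • (Q x).1.1
    rw [hQ, map_smul, ← hQ]
  · refine (hQn x).trans ?_
    rw [max_mul_of_nonneg _ _ (norm_nonneg x)]
    exact max_le_max (P.le_opNorm x) le_rfl

/-- The estimate of the quadratic term on the energy space. -/
theorem memLp_quadratic (ι : E →L[ℝ] G) (B : E →L[ℝ] E →L[ℝ] E) {K : ℝ} (hK : 0 ≤ K)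
    (hB : ∀ u v, ‖B u v‖ ^ 2 ≤ K * ((‖ι u‖ * ‖u‖) * (‖ι v‖ * ‖v‖))) (p q : energySpace a b ι) :
    ∃ h : MemLp (fun t => B (p.1.1 t) (q.1.1 t)) 2 (timeMeasure a b),
      ‖h.toLp _‖ ≤ √K * ‖p‖ * ‖q‖ := by
  have hmeas : AEStronglyMeasurable (fun t => B (p.1.1 t) (q.1.1 t)) (timeMeasure a b) :=
    B.aestronglyMeasurable_comp₂ (Lp.aestronglyMeasurable p.1.1) (Lp.aestronglyMeasurable q.1.1)
  have hI := (integrable_norm_mul_norm p.1.1 q.1.1).const_mul (K * (‖p‖ * ‖q‖))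
  have hle : ∀ᵐ t ∂(timeMeasure a b), ‖B (p.1.1 t) (q.1.1 t)‖ ^ 2 ≤
      K * (‖p‖ * ‖q‖) * (‖p.1.1 t‖ * ‖q.1.1 t‖) := by
    filter_upwards [energySpace_ae_le ι p, energySpace_ae_le ι q] with t h1 h2
    refine (hB _ _).trans ?_
    calc _ ≤ K * ((‖p‖ * ‖p.1.1 t‖) * (‖q‖ * ‖q.1.1 t‖)) := by gcongr
      _ = _ := by ring
  have hI2 : Integrable (fun t => ‖B (p.1.1 t) (q.1.1 t)‖ ^ 2) (timeMeasure a b) := by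
    refine hI.mono' (hmeas.norm.pow 2) ?_
    filter_upwards [hle] with t ht
    rwa [Real.norm_of_nonneg (by positivity)]
  have hm := (memLp_two_iff_integrable_sq_norm hmeas).2 hI2
  refine ⟨hm, ?_⟩
  refine le_of_sq_le_sq ?_ (by positivity)
  have e : ‖hm.toLp _‖ ^ 2 = ∫ t, ‖B (p.1.1 t) (q.1.1 t)‖ ^ 2 ∂(timeMeasure a b) := by
    rw [norm_sq_eq_integral]
    refine integral_congr_ae ?_
    filter_upwards [hm.coeFn_toLp] with t ht
    rw [ht]
  rw [e]
  calc _ ≤ ∫ t, K * (‖p‖ * ‖q‖) * (‖p.1.1 t‖ * ‖q.1.1 t‖) ∂(timeMeasure a b) :=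
        integral_mono_ae hI2 hI hle
    _ = K * (‖p‖ * ‖q‖) * ∫ t, ‖p.1.1 t‖ * ‖q.1.1 t‖ ∂(timeMeasure a b) := integral_const_mul _ _
    _ ≤ K * (‖p‖ * ‖q‖) * (‖p‖ * ‖q‖) := by
        gcongr
        refine (integral_norm_mul_norm_le _ _).trans ?_
        gcongr
        · exact energySpace_norm_fst_le ι p
        · exact energySpace_norm_fst_le ι q
    _ = _ := by rw [mul_pow, mul_pow, Real.sq_sqrt hK]; ring

/-- The quadratic term as a bounded bilinear map from the energy space to `L²(a, b; E)`. -/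
theorem exists_quadratic_operator (ι : E →L[ℝ] G) (B : E →L[ℝ] E →L[ℝ] E) {K : ℝ} (hK : 0 ≤ K)
    (hB : ∀ u v, ‖B u v‖ ^ 2 ≤ K * ((‖ι u‖ * ‖u‖) * (‖ι v‖ * ‖v‖))) :
    ∃ Q : energySpace a b ι →L[ℝ] energySpace a b ι →L[ℝ] LT a b E, ∀ p q,
      Q p q =ᵐ[timeMeasure a b] fun t => B (p.1.1 t) (q.1.1 t) := by
  choose hm hn using memLp_quadratic (a := a) (b := b) ι B hK hB
  refine ⟨LinearMap.mkContinuous₂ (LinearMap.mk₂ ℝ (fun p q => (hm p q).toLp _)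
    ?_ ?_ ?_ ?_) (√K) ?_, fun p q => (hm p q).coeFn_toLp⟩
  · intro p p' q
    rw [← MemLp.toLp_add, MemLp.toLp_eq_toLp_iff]
    filter_upwards [Lp.coeFn_add p.1.1 p'.1.1] with t h1
    have : (p + p').1.1 t = p.1.1 t + p'.1.1 t := h1
    rw [this, Pi.add_apply, map_add, _root_.add_apply]
  · intro c p q
    rw [← MemLp.toLp_const_smul, MemLp.toLp_eq_toLp_iff]
    filter_upwards [Lp.coeFn_smul c p.1.1] with t h1
    have : (c • p).1.1 t = c • p.1.1 t := h1
    rw [this, Pi.smul_apply, map_smul, _root_.smul_apply]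
  · intro p q q'
    rw [← MemLp.toLp_add, MemLp.toLp_eq_toLp_iff]
    filter_upwards [Lp.coeFn_add q.1.1 q'.1.1] with t h1
    have : (q + q').1.1 t = q.1.1 t + q'.1.1 t := h1
    rw [this, Pi.add_apply, map_add]
  · intro c p q
    rw [← MemLp.toLp_const_smul, MemLp.toLp_eq_toLp_iff]
    filter_upwards [Lp.coeFn_smul c q.1.1] with t h1
    have : (c • q).1.1 t = c • q.1.1 t := h1
    rw [this, Pi.smul_apply, map_smul]
  · intro p q
    exact hn p q

/-- Two applications of Young's inequality, each costing `c / 8 * m ^ 2`. With `m` the norm of `y`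
in `E` and `x` that of `ι y` in `G`, the strong norm is left with a small factor and the remainder
is fit for Gronwall's inequality. -/
theorem young_quadratic {c K m x Q β : ℝ} (hc : 0 < c)
    (h : β ^ 2 ≤ K * ((x * m) * Q)) :
    β * m ≤ c / 4 * m ^ 2 + 8 * K ^ 2 / c ^ 3 * (Q ^ 2 * x ^ 2) := by
  have h1 : β * m ≤ c / 8 * m ^ 2 + 2 / c * β ^ 2 := by
    have : 0 ≤ (c / 4 * m - β) ^ 2 * (2 / c) := by positivity
    have e : (c / 4 * m - β) ^ 2 * (2 / c) = c / 8 * m ^ 2 + 2 / c * β ^ 2 - β * m := by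
      field_simp; ring
    linarith
  have h2 : 2 / c * β ^ 2 ≤ 2 / c * (K * ((x * m) * Q)) := by gcongr
  have h3 : 2 / c * (K * ((x * m) * Q)) ≤ c / 8 * m ^ 2 + 8 * K ^ 2 / c ^ 3 * (Q ^ 2 * x ^ 2) := by
    have : 0 ≤ (c / 4 * m - 2 / c * (K * x * Q)) ^ 2 * (2 / c) := by positivity
    have e : (c / 4 * m - 2 / c * (K * x * Q)) ^ 2 * (2 / c) =
        c / 8 * m ^ 2 + 8 * K ^ 2 / c ^ 3 * (Q ^ 2 * x ^ 2) - 2 / c * (K * ((x * m) * Q)) := by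
      field_simp; ring
    linarith
  linarith

/-- The a priori estimate for the linearized problem, in integrated form. -/
theorem energy_inequality (hab : a ≤ b) (ι : E →L[ℝ] G) {A D : E →L[ℝ] E} {c : ℝ} (hc : 0 < c)
    (hA : ∀ v, c * ‖v‖ ^ 2 ≤ ⟪A v, v⟫_ℝ) (hD : ∀ v, 0 ≤ ⟪D v, v⟫_ℝ)
    (B : E →L[ℝ] E →L[ℝ] E) {K : ℝ}
    (hB : ∀ u v, ‖B u v‖ ^ 2 ≤ K * ((‖ι u‖ * ‖u‖) * (‖ι v‖ * ‖v‖)))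
    (hB0 : ∀ u v, ⟪B u v, v⟫_ℝ = 0) {s : ℝ} (hs : s ∈ Icc (0 : ℝ) 1) {h y r : LT a b E}
    {p q : ℝ → E}
    (hy : gram a b ι y = volterra a b E (h - A.compLpL 2 _ y))
    (hr : ∀ᵐ t ∂(timeMeasure a b), r t = h t + s • (D (y t) + B (p t) (y t) + B (y t) (q t))) :
    ∃ ζ : ℝ → G, ContinuousOn ζ (Icc a b) ∧ (∀ᵐ t ∂(timeMeasure a b), ζ t = ι (y t)) ∧
      ∀ k : ℝ → ℝ, Integrable k (timeMeasure a b) →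
        (∀ᵐ t ∂(timeMeasure a b), 16 * K ^ 2 / c ^ 3 * (‖ι (q t)‖ * ‖q t‖) ^ 2 ≤ k t) →
        ∀ t ∈ Icc a b, ‖ζ t‖ ^ 2 + c * ∫ τ in a..t, ‖y τ‖ ^ 2 ≤
          2 / c * ‖r‖ ^ 2 + ∫ τ in a..t, k τ * ‖ζ τ‖ ^ 2 := by
  obtain ⟨ζ, hζc, -, hζ, hE⟩ := exists_continuous_representative hab ι hy
  refine ⟨ζ, hζc, hζ, fun k hk hkq t ht => ?_⟩
  have ha : a ∈ Icc a b := left_mem_Icc.2 hab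
  have hζ2 : ContinuousOn (fun τ => ‖ζ τ‖ ^ 2) (Icc a b) := hζc.norm.pow 2
  have i1 : IntervalIntegrable (fun τ => ‖y τ‖ ^ 2) volume a t :=
    intervalIntegrable_of_integrable_Ioo (integrable_norm_sq y) ha ht
  have i2 : IntervalIntegrable (fun τ => ‖r τ‖ ^ 2) volume a t :=
    intervalIntegrable_of_integrable_Ioo (integrable_norm_sq r) ha ht
  have i3 : IntervalIntegrable (fun τ => k τ * ‖ζ τ‖ ^ 2) volume a t :=
    (intervalIntegrable_of_integrable_Ioo hk ha ht).mul_continuousOn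
      (hζ2.mono (uIcc_subset_Icc ha ht))
  have i4 := intervalIntegrable_inner (h - A.compLpL 2 _ y) y ha ht
  -- `B p y` is orthogonal to `y`, so `p` does not enter. The terms with `r` and with `B y q` take
  -- `c / 4` each from the coercivity; the remaining half becomes `c` after doubling.
  have hpt : ∀ᵐ τ ∂(timeMeasure a b),
      2 * ⟪(h - A.compLpL 2 _ y : LT a b E) τ, y τ⟫_ℝ ≤
        -c * ‖y τ‖ ^ 2 + 2 / c * ‖r τ‖ ^ 2 + k τ * ‖ζ τ‖ ^ 2 := by
    filter_upwards [hr, hζ, hkq, Lp.coeFn_sub h (A.compLpL 2 _ y), A.coeFn_compLpL (p := 2) y]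
      with τ e1 e2 e3 e4 e5
    rw [e4, Pi.sub_apply, e5, e2]
    have e6 : h τ = r τ - s • (D (y τ) + B (p τ) (y τ) + B (y τ) (q τ)) := by rw [e1]; abel
    rw [e6, inner_sub_left, inner_sub_left, real_inner_smul_left, inner_add_left, inner_add_left,
      hB0, add_zero]
    have f1 := hA (y τ)
    have f2 := mul_nonneg hs.1 (hD (y τ))
    have f3 : -(s * ⟪B (y τ) (q τ), y τ⟫_ℝ) ≤ ‖B (y τ) (q τ)‖ * ‖y τ‖ := by
      have g1 := abs_real_inner_le_norm (B (y τ) (q τ)) (y τ)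
      have g2 : |s * ⟪B (y τ) (q τ), y τ⟫_ℝ| ≤ ‖B (y τ) (q τ)‖ * ‖y τ‖ := by
        rw [abs_mul, abs_of_nonneg hs.1]
        exact (mul_le_of_le_one_left (abs_nonneg _) hs.2).trans g1
      exact (neg_le_abs _).trans g2
    have f4 := young_quadratic (c := c) hc (hB (y τ) (q τ))
    have f5 : ⟪r τ, y τ⟫_ℝ ≤ c / 4 * ‖y τ‖ ^ 2 + 1 / c * ‖r τ‖ ^ 2 := by
      refine (real_inner_le_norm _ _).trans ?_
      have : 0 ≤ (c / 2 * ‖y τ‖ - ‖r τ‖) ^ 2 * (1 / c) := by positivity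
      have e : (c / 2 * ‖y τ‖ - ‖r τ‖) ^ 2 * (1 / c) =
          c / 4 * ‖y τ‖ ^ 2 + 1 / c * ‖r τ‖ ^ 2 - ‖r τ‖ * ‖y τ‖ := by field_simp; ring
      linarith
    have f6 : 16 * K ^ 2 / c ^ 3 * (‖ι (q τ)‖ * ‖q τ‖) ^ 2 * ‖ι (y τ)‖ ^ 2 ≤
        k τ * ‖ι (y τ)‖ ^ 2 := by gcongr
    have f7 : 2 * (8 * K ^ 2 / c ^ 3 * ((‖ι (q τ)‖ * ‖q τ‖) ^ 2 * ‖ι (y τ)‖ ^ 2)) =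
        16 * K ^ 2 / c ^ 3 * (‖ι (q τ)‖ * ‖q τ‖) ^ 2 * ‖ι (y τ)‖ ^ 2 := by ring
    have f8 : 2 / c * ‖r τ‖ ^ 2 = 2 * (1 / c * ‖r τ‖ ^ 2) := by ring
    rw [f8]
    linarith
  have hInt : ∫ τ in a..t, 2 * ⟪(h - A.compLpL 2 _ y : LT a b E) τ, y τ⟫_ℝ ≤
      ∫ τ in a..t, (-c * ‖y τ‖ ^ 2 + 2 / c * ‖r τ‖ ^ 2 + k τ * ‖ζ τ‖ ^ 2) := by
    refine intervalIntegral.integral_mono_ae_restrict ht.1 (i4.const_mul 2)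
      (((i1.const_mul _).add (i2.const_mul _)).add i3) ?_
    rw [Filter.EventuallyLE, ← restrict_Ioo_eq_restrict_Icc]
    exact ae_Ioo_of_ae_timeMeasure hpt le_rfl ht.2
  rw [intervalIntegral.integral_const_mul, ← hE t ht,
    intervalIntegral.integral_add ((i1.const_mul _).add (i2.const_mul _)) i3,
    intervalIntegral.integral_add (i1.const_mul _) (i2.const_mul _),
    intervalIntegral.integral_const_mul, intervalIntegral.integral_const_mul] at hInt
  have hrn : ∫ τ in a..t, ‖r τ‖ ^ 2 ≤ ‖r‖ ^ 2 := by
    have := abs_integral_inner_le r r ht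
    simp only [real_inner_self_eq_norm_sq] at this
    rw [sq ‖r‖]
    exact (le_abs_self _).trans this
  have : 2 / c * ∫ τ in a..t, ‖r τ‖ ^ 2 ≤ 2 / c * ‖r‖ ^ 2 := by gcongr
  linarith

/-- The a priori estimate for the linearized problem. -/
theorem apriori_estimate (hab : a ≤ b) (ι : E →L[ℝ] G) {A : E →L[ℝ] E} {c : ℝ} (hc : 0 < c)
    (hA : ∀ v, c * ‖v‖ ^ 2 ≤ ⟪A v, v⟫_ℝ)
    (B : E →L[ℝ] E →L[ℝ] E) {K : ℝ}
    (hB : ∀ u v, ‖B u v‖ ^ 2 ≤ K * ((‖ι u‖ * ‖u‖) * (‖ι v‖ * ‖v‖)))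
    (hB0 : ∀ u v, ⟪B u v, v⟫_ℝ = 0) (R : ℝ) :
    ∃ M : ℝ, 0 < M ∧ ∀ D : E →L[ℝ] E, (∀ v, 0 ≤ ⟪D v, v⟫_ℝ) → ∀ s ∈ Icc (0 : ℝ) 1,
      ∀ (p q y : energySpace a b ι) (h r : LT a b E), ‖q‖ ≤ R →
        gram a b ι y.1.1 = volterra a b E (h - A.compLpL 2 _ y.1.1) →
        (∀ᵐ t ∂(timeMeasure a b), r t =
          h t + s • (D (y.1.1 t) + B (p.1.1 t) (y.1.1 t) + B (y.1.1 t) (q.1.1 t))) →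
        ‖y‖ ≤ M * ‖r‖ := by
  -- `κ` bounds the mass of the Gronwall kernel: one factor `R ^ 2` comes from the supremum in `G`,
  -- the other from the `L²` norm in `E`. The choice `2 κ < n` ensures mass at most `(n + 1) / 2`.
  set κ := 16 * K ^ 2 / c ^ 3 * R ^ 2 * R ^ 2 with hκ
  have hκ0 : 0 ≤ κ := by positivity
  obtain ⟨n, hn⟩ := exists_nat_gt (2 * κ)
  set L := 2 ^ (n + 1) * (2 / c) with hL
  have hL0 : 0 < L := by positivity
  refine ⟨max (√L) (√((2 / c + κ * L) / c)), lt_max_of_lt_left (Real.sqrt_pos.2 hL0), ?_⟩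
  intro D hD s hs p q y h r hq hy hr
  have hR : 0 ≤ R := (norm_nonneg q).trans hq
  obtain ⟨ζ, hζc, hζ, hE⟩ := energy_inequality hab ι hc hA hD B hB hB0 hs hy hr
  let k : ℝ → ℝ := fun t => 16 * K ^ 2 / c ^ 3 * R ^ 2 * ‖q.1.1 t‖ ^ 2
  have hk : Integrable k (timeMeasure a b) := (integrable_norm_sq q.1.1).const_mul _
  have hkq : ∀ᵐ t ∂(timeMeasure a b),
      16 * K ^ 2 / c ^ 3 * (‖ι (q.1.1 t)‖ * ‖q.1.1 t‖) ^ 2 ≤ k t := by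
    filter_upwards [energySpace_ae_le ι q] with t ht
    have : ‖ι (q.1.1 t)‖ ≤ R := ht.trans hq
    simp only [k]
    rw [mul_pow, ← mul_assoc]
    gcongr
  have hkint : ∀ t ∈ Icc a b, ∫ τ in a..t, k τ ≤ κ := by
    intro t ht
    have h1 := abs_integral_inner_le q.1.1 q.1.1 ht
    simp only [real_inner_self_eq_norm_sq] at h1
    have h2 : ∫ τ in a..t, ‖q.1.1 τ‖ ^ 2 ≤ R ^ 2 := by
      refine (le_abs_self _).trans (h1.trans ?_)
      have := (energySpace_norm_fst_le ι q).trans hq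
      rw [sq]; gcongr
    simp only [k]
    rw [intervalIntegral.integral_const_mul, hκ]
    gcongr
  have hE' := hE k hk hkq
  have hyint0 : ∀ t ∈ Icc a b, 0 ≤ c * ∫ τ in a..t, ‖y.1.1 τ‖ ^ 2 := fun t ht =>
    mul_nonneg hc.le (intervalIntegral.integral_nonneg ht.1 fun _ _ => by positivity)
  have hgr : ∀ t ∈ Icc a b, ‖ζ t‖ ^ 2 ≤ L * ‖r‖ ^ 2 := by
    intro t ht
    have := gronwall_doubling (A := 2 / c * ‖r‖ ^ 2) (by positivity)
      (y := fun t => ‖ζ t‖ ^ 2) (hζc.norm.pow 2)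
      (fun _ _ => by positivity) hk (fun t => by positivity)
      (fun t ht => by linarith [hE' t ht, hyint0 t ht]) n t ht
      ((hkint t ht).trans (by linarith))
    rw [hL, mul_assoc]; exact this
  have hfst : ‖y.1.1‖ ^ 2 ≤ (2 / c + κ * L) / c * ‖r‖ ^ 2 := by
    have hb : b ∈ Icc a b := right_mem_Icc.2 hab
    have ha : a ∈ Icc a b := left_mem_Icc.2 hab
    have h1 := hE' b hb
    have h2 : ∫ τ in a..b, k τ * ‖ζ τ‖ ^ 2 ≤ κ * (L * ‖r‖ ^ 2) := by
      calc _ ≤ ∫ τ in a..b, k τ * (L * ‖r‖ ^ 2) := by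
            have hkI := intervalIntegrable_of_integrable_Ioo hk ha hb
            refine intervalIntegral.integral_mono_on hab
              (hkI.mul_continuousOn ((hζc.norm.pow 2).mono (uIcc_subset_Icc ha hb)))
              (hkI.mul_const _) fun τ hτ => ?_
            exact mul_le_mul_of_nonneg_left (hgr τ hτ) (by positivity)
        _ = (∫ τ in a..b, k τ) * (L * ‖r‖ ^ 2) := intervalIntegral.integral_mul_const _ _
        _ ≤ _ := by gcongr; exact hkint b hb
    rw [← integral_Ioo_eq_intervalIntegral (fun τ => ‖y.1.1 τ‖ ^ 2) hab,
      ← norm_sq_eq_integral] at h1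
    rw [div_mul_eq_mul_div, le_div_iff₀ hc]
    nlinarith [sq_nonneg ‖ζ b‖]
  have hsnd : ‖y.1.2‖ ≤ √L * ‖r‖ := by
    have hae : ∀ᵐ t ∂(timeMeasure a b), ‖y.1.2 t‖ ≤ √L * ‖r‖ := by
      filter_upwards [y.2, hζ, ae_restrict_mem measurableSet_Ioo] with t h1 h2 ht
      rw [h1, ← h2]
      refine le_of_sq_le_sq ?_ (by positivity)
      rw [mul_pow, Real.sq_sqrt hL0.le]
      exact hgr t (Ioo_subset_Icc_self ht)
    rw [Lp.norm_def, eLpNorm_exponent_top]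
    exact ENNReal.toReal_le_of_le_ofReal (by positivity) (eLpNormEssSup_le_of_ae_bound hae)
  have hfst' : ‖y.1.1‖ ≤ √((2 / c + κ * L) / c) * ‖r‖ := by
    refine le_of_sq_le_sq ?_ (by positivity)
    rwa [mul_pow, Real.sq_sqrt (by positivity)]
  have : ‖y‖ = max ‖y.1.1‖ ‖y.1.2‖ := rfl
  rw [this]
  refine max_le ?_ ?_
  · refine hfst'.trans ?_
    gcongr; exact le_max_right _ _
  · refine hsnd.trans ?_
    gcongr; exact le_max_left _ _

/-- A solution for the lower-order term `D₀` can be continued to a solution for `D₁`. -/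
theorem exists_perturbed_solution (hab : a ≤ b) (ι : E →L[ℝ] G) {A : E →L[ℝ] E} {c : ℝ}
    (hc : 0 < c) (hA : ∀ v, c * ‖v‖ ^ 2 ≤ ⟪A v, v⟫_ℝ)
    (B : E →L[ℝ] E →L[ℝ] E) {K : ℝ} (hK : 0 ≤ K)
    (hB : ∀ u v, ‖B u v‖ ^ 2 ≤ K * ((‖ι u‖ * ‖u‖) * (‖ι v‖ * ‖v‖)))
    (hB0 : ∀ u v, ⟪B u v, v⟫_ℝ = 0) {D₀ D₁ : E →L[ℝ] E} (hD₀ : ∀ v, 0 ≤ ⟪D₀ v, v⟫_ℝ)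
    (hD₁ : ∀ v, 0 ≤ ⟪D₁ v, v⟫_ℝ) (p : energySpace a b ι) :
    ∃ g z : LT a b E, gram a b ι z = volterra a b E (g - A.compLpL 2 _ z) ∧
      ∀ᵐ t ∂(timeMeasure a b), g t + D₁ (p.1.1 t + z t) + B (p.1.1 t + z t) (p.1.1 t + z t) =
        D₀ (p.1.1 t) + B (p.1.1 t) (p.1.1 t) := by
  obtain ⟨P, hP⟩ := exists_parabolic_operator hab ι hc hA
  -- The energy identity bounds the solution operator into `L^∞(a, b; G)`, hence into the energy
  -- space, where the quadratic term is bounded.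
  obtain ⟨C, hC0, hC⟩ : ∃ C : ℝ, 0 ≤ C ∧ ∀ g : LT a b E,
      ∀ᵐ t ∂(timeMeasure a b), ‖ι (P g t)‖ ≤ C * ‖g‖ := by
    set N := 1 + ‖A.compLpL 2 (timeMeasure a b)‖ * ‖P‖ with hN
    refine ⟨√(2 * (N * ‖P‖)), by positivity, fun g => ?_⟩
    obtain ⟨ζ, -, -, hζ, hE⟩ := exists_continuous_representative hab ι (hP g)
    filter_upwards [hζ, ae_restrict_mem measurableSet_Ioo] with t h1 ht
    rw [← h1]
    refine le_of_sq_le_sq ?_ (by positivity)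
    rw [mul_pow, Real.sq_sqrt (by positivity), hE t (Ioo_subset_Icc_self ht)]
    have h2 := (le_abs_self _).trans
      (abs_integral_inner_le (g - A.compLpL 2 _ (P g)) (P g) (Ioo_subset_Icc_self ht))
    have h3 : ‖g - A.compLpL 2 (timeMeasure a b) (P g)‖ ≤ N * ‖g‖ := by
      refine (norm_sub_le _ _).trans ?_
      have : ‖A.compLpL 2 (timeMeasure a b) (P g)‖ ≤
          ‖A.compLpL 2 (timeMeasure a b)‖ * (‖P‖ * ‖g‖) :=
        (ContinuousLinearMap.le_opNorm _ _).trans (by gcongr; exact P.le_opNorm g)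
      rw [hN, add_mul, one_mul, mul_assoc]
      gcongr
    have h4 := P.le_opNorm g
    calc _ ≤ 2 * ((N * ‖g‖) * (‖P‖ * ‖g‖)) := by
          refine mul_le_mul_of_nonneg_left (h2.trans ?_) (by norm_num)
          gcongr
      _ = _ := by ring
  obtain ⟨H, hH⟩ := exists_lift_energySpace ι P hC0 hC
  obtain ⟨Q, hQ⟩ := exists_quadratic_operator (a := a) (b := b) ι B hK hB
  let fst : energySpace a b ι →L[ℝ] LT a b E :=
    (ContinuousLinearMap.fst ℝ _ _).comp (energySpace a b ι).subtypeL
  -- Convex combinations of `D₀` and `D₁` stay nonnegative, so one constant serves the whole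
  -- homotopy.
  have hap : ∀ R : ℝ, ∃ M : ℝ, 0 < M ∧ ∀ l ∈ Icc (0 : ℝ) 1, ∀ s ∈ Icc (0 : ℝ) 1,
      ∀ u q : energySpace a b ι, ‖q‖ ≤ R → ∀ h : LT a b E,
        ‖H h‖ ≤ M * ‖h + s • (((D₀.compLpL 2 _).comp fst + l • ((D₁.compLpL 2 _).comp fst -
          (D₀.compLpL 2 _).comp fst)) (H h) + Q u (H h) + Q (H h) q)‖ := by
    intro R
    obtain ⟨M, hM, hest⟩ := apriori_estimate (a := a) (b := b) hab ι hc hA B hB hB0 R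
    refine ⟨M, hM, fun l hl s hs u q hq h => ?_⟩
    refine hest (D₀ + l • (D₁ - D₀)) ?_ s hs u q (H h) h _ hq ?_ ?_
    · intro v
      have e : ⟪(D₀ + l • (D₁ - D₀)) v, v⟫_ℝ = (1 - l) * ⟪D₀ v, v⟫_ℝ + l * ⟪D₁ v, v⟫_ℝ := by
        simp only [_root_.add_apply, _root_.smul_apply, _root_.sub_apply, inner_add_left,
          real_inner_smul_left, inner_sub_left]
        ring
      rw [e]
      exact add_nonneg (mul_nonneg (by linarith [hl.2]) (hD₀ v)) (mul_nonneg hl.1 (hD₁ v))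
    · rw [hH]; exact hP h
    · set y := (H h).1.1 with hy
      set D := D₀ + l • (D₁ - D₀) with hD
      have e : ((D₀.compLpL 2 (timeMeasure a b)).comp fst + l • ((D₁.compLpL 2 _).comp fst -
          (D₀.compLpL 2 _).comp fst)) (H h) = D.compLpL 2 (timeMeasure a b) y := by
        rw [hD, ContinuousLinearMap.add_compLpL, ContinuousLinearMap.smul_compLpL,
          sub_eq_add_neg D₁, ← neg_one_smul ℝ D₀, ContinuousLinearMap.add_compLpL,
          ContinuousLinearMap.smul_compLpL, neg_one_smul ℝ, ← sub_eq_add_neg]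
        rfl
      rw [e]
      filter_upwards [Lp.coeFn_add h (s • (D.compLpL 2 _ y + Q u (H h) + Q (H h) q)),
        Lp.coeFn_smul s (D.compLpL 2 (timeMeasure a b) y + Q u (H h) + Q (H h) q),
        Lp.coeFn_add (D.compLpL 2 (timeMeasure a b) y + Q u (H h)) (Q (H h) q),
        Lp.coeFn_add (D.compLpL 2 (timeMeasure a b) y) (Q u (H h)),
        D.coeFn_compLpL (p := 2) (μ := timeMeasure a b) y, hQ u (H h), hQ (H h) q]
        with t t1 t2 t3 t4 t5 t6 t7
      rw [t1, Pi.add_apply, t2, Pi.smul_apply, t3, Pi.add_apply, t4, Pi.add_apply, t5, t6, t7]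
  obtain ⟨g, hg⟩ := exists_solution_of_apriori H ((D₀.compLpL 2 _).comp fst)
    ((D₁.compLpL 2 _).comp fst) Q p hap
  refine ⟨g, P g, hP g, ?_⟩
  have e : (p + H g).1.1 =ᵐ[timeMeasure a b] fun t => p.1.1 t + P g t := by
    have : (p + H g).1.1 = p.1.1 + P g := by rw [← hH]; rfl
    rw [this]
    exact Lp.coeFn_add _ _
  have e2 : (g + D₁.compLpL 2 _ (p + H g).1.1 + Q (p + H g) (p + H g) : LT a b E) =
      D₀.compLpL 2 _ p.1.1 + Q p p := hg
  have e3 := Lp.ext_iff.1 e2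
  filter_upwards [e, e3, Lp.coeFn_add (g + D₁.compLpL 2 _ (p + H g).1.1) (Q (p + H g) (p + H g)),
    Lp.coeFn_add g (D₁.compLpL 2 _ (p + H g).1.1), D₁.coeFn_compLpL (p := 2) (p + H g).1.1,
    Lp.coeFn_add (D₀.compLpL 2 _ p.1.1) (Q p p), D₀.coeFn_compLpL (p := 2) p.1.1,
    hQ (p + H g) (p + H g), hQ p p] with t t1 t2 t3 t4 t5 t6 t7 t8 t9
  rw [t3, t6, Pi.add_apply, Pi.add_apply, t4, Pi.add_apply, t5, t7, t8, t9, t1] at t2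
  exact t2

end Quadratic

/-! ### The function spaces -/

section Spaces

variable {Ω : Set Plane}

/-- The trace of a matrix. -/
def traceL : Mat2 →L[ℝ] ℝ := ∑ i : Fin 2, EuclideanSpace.proj (i, i)

theorem traceL_apply (M : Mat2) : traceL M = ∑ i : Fin 2, M (i, i) := by
  simp [traceL]

theorem isClosed_traceFree (Ω : Set Plane) : IsClosed (traceFree Ω : Set (FieldPair Ω)) := by
  have e : (traceFree Ω : Set (FieldPair Ω)) =
      (fun p : FieldPair Ω => traceL.compLpL 2 (volume.restrict Ω) p.snd) ⁻¹' {0} := by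
    ext p
    rw [mem_preimage, mem_singleton_iff, Lp.eq_zero_iff_ae_eq_zero]
    have h := traceL.coeFn_compLpL (p := 2) p.snd
    constructor
    · intro hp
      have hp' : ∀ᵐ x ∂((volume : Measure Plane).restrict Ω), ∑ i : Fin 2, p.snd x (i, i) = 0 := hp
      filter_upwards [h, hp'] with x h1 h2
      rw [h1, traceL_apply, h2]; rfl
    · intro hp
      change ∀ᵐ x ∂((volume : Measure Plane).restrict Ω), ∑ i : Fin 2, p.snd x (i, i) = 0
      filter_upwards [h, hp] with x h1 h2
      rw [← traceL_apply, ← h1, h2]; rfl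
  rw [e]
  exact IsClosed.preimage ((traceL.compLpL 2 (volume.restrict Ω)).continuous.comp
    (WithLp.sndL 2 ℝ _ _).continuous) isClosed_singleton

theorem isClosed_V (Ω : Set Plane) : IsClosed (V Ω : Set (FieldPair Ω)) :=
  (Submodule.isClosed_topologicalClosure _).inter (isClosed_traceFree Ω)

instance instCompleteSpaceV (Ω : Set Plane) : CompleteSpace (V Ω) :=
  (isClosed_V Ω).completeSpace_coe

/-- The embedding of `V` in `L²`. -/
def embedL (Ω : Set Plane) : V Ω →L[ℝ] L2 Ω Plane := (WithLp.fstL 2 ℝ _ _).comp (V Ω).subtypeL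

/-- The gradient on `V`. -/
def gradL (Ω : Set Plane) : V Ω →L[ℝ] L2 Ω Mat2 := (WithLp.sndL 2 ℝ _ _).comp (V Ω).subtypeL

theorem embedL_apply (v : V Ω) : embedL Ω v = v.1.fst := rfl

theorem gradL_apply (v : V Ω) : gradL Ω v = v.1.snd := rfl

theorem norm_sq_V (v : V Ω) : ‖v‖ ^ 2 = ‖v.1.fst‖ ^ 2 + ‖v.1.snd‖ ^ 2 :=
  WithLp.prod_norm_sq_eq_of_L2 v.1

theorem norm_snd_le_V (v : V Ω) : ‖v.1.snd‖ ≤ ‖v‖ := by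
  refine le_of_sq_le_sq ?_ (norm_nonneg _)
  rw [norm_sq_V]; nlinarith [sq_nonneg ‖v.1.fst‖]

theorem norm_sq_V_le {c_P : ℝ} (hP : IsPoincareConstant Ω c_P) (v : V Ω) :
    ‖v‖ ^ 2 ≤ (1 + c_P ^ 2) * ‖v.1.snd‖ ^ 2 := by
  rw [norm_sq_V]
  have h := hP.2 v.1 v.2.1
  have : ‖v.1.fst‖ ^ 2 ≤ (c_P * ‖v.1.snd‖) ^ 2 := by gcongr
  nlinarith

end Spaces

/-! ### The trilinear form -/

section Trilinear

variable {Ω : Set Plane}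

/-- The integrand `[(u · ∇) v] · w` of the trilinear form. -/
def advect (u : Plane) (M : Mat2) (w : Plane) : ℝ :=
  ∑ i : Fin 2, (∑ j : Fin 2, u j * M (i, j)) * w i

theorem bForm_eq (u v w : FieldPair Ω) :
    bForm u v w = ∫ x in Ω, advect (u.fst x) (v.snd x) (w.fst x) := rfl

/-- The integrand is the Frobenius product of `M` with `w ⊗ u`, whose norm is `‖u‖ * ‖w‖`. The
constant one matters for the explicit smallness condition. -/
theorem abs_advect_le (u : Plane) (M : Mat2) (w : Plane) :
    |advect u M w| ≤ ‖u‖ * ‖w‖ * ‖M‖ := by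
  let T : Mat2 := WithLp.toLp 2 fun ij : Fin 2 × Fin 2 => u ij.2 * w ij.1
  have e : advect u M w = ⟪T, M⟫_ℝ := by
    simp only [advect, T, PiLp.inner_apply, Fintype.sum_prod_type, Fin.sum_univ_two]
    simp
    ring
  have hT : ‖T‖ = ‖u‖ * ‖w‖ := by
    have : ‖T‖ ^ 2 = (‖u‖ * ‖w‖) ^ 2 := by
      rw [mul_pow, EuclideanSpace.real_norm_sq_eq, EuclideanSpace.real_norm_sq_eq,
        EuclideanSpace.real_norm_sq_eq]
      simp only [T, Fintype.sum_prod_type, Fin.sum_univ_two]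
      ring
    exact (sq_eq_sq₀ (norm_nonneg _) (by positivity)).1 this
  rw [e, ← hT]
  exact abs_real_inner_le_norm _ _

theorem continuous_advect : Continuous fun p : Plane × Mat2 × Plane => advect p.1 p.2.1 p.2.2 := by
  unfold advect
  fun_prop

attribute [irreducible] advect

instance holderTriple_four_four_two : ENNReal.HolderTriple 4 4 2 := by
  constructor
  have h : (4 : ENNReal)⁻¹ + 4⁻¹ = 2 * 4⁻¹ := (two_mul _).symm
  rw [h, show (4 : ENNReal) = 2 * 2 by norm_num, ENNReal.mul_inv (by simp) (by simp), ← mul_assoc,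
    ENNReal.mul_inv_cancel (by simp) (by simp), one_mul]

/-- The `L⁴` norm of a field. -/
def normL4 (f : L2 Ω Plane) : ℝ := (eLpNorm f 4 (volume.restrict Ω)).toReal

theorem normL4_nonneg (f : L2 Ω Plane) : 0 ≤ normL4 f := ENNReal.toReal_nonneg

theorem memLp_four {c_L : ℝ} (hL : IsLadyzhenskayaConstant Ω c_L) {v : FieldPair Ω}
    (hv : v ∈ H10 Ω) : MemLp v.fst 4 (volume.restrict Ω) :=
  ⟨Lp.aestronglyMeasurable _, (hL.2 v hv).trans_lt ENNReal.ofReal_lt_top⟩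

theorem normL4_sq_le {c_L : ℝ} (hL : IsLadyzhenskayaConstant Ω c_L) {v : FieldPair Ω}
    (hv : v ∈ H10 Ω) : normL4 v.fst ^ 2 ≤ c_L * (‖v.fst‖ * ‖v.snd‖) := by
  have h : normL4 v.fst ≤ √c_L * (√‖v.fst‖ * √‖v.snd‖) :=
    ENNReal.toReal_le_of_le_ofReal (by positivity) (hL.2 v hv)
  calc normL4 v.fst ^ 2 ≤ (√c_L * (√‖v.fst‖ * √‖v.snd‖)) ^ 2 := by
        gcongr; exact normL4_nonneg _
    _ = _ := by
        rw [mul_pow, mul_pow, Real.sq_sqrt hL.1.le, Real.sq_sqrt (norm_nonneg _),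
          Real.sq_sqrt (norm_nonneg _)]

/-- Hölder's inequality with exponents 4, 4, 2; the product can then be paired with a gradient in
`L²`. -/
theorem exists_product_L2 {u w : L2 Ω Plane}
    (hu : MemLp u 4 (volume.restrict Ω)) (hw : MemLp w 4 (volume.restrict Ω)) :
    ∃ g : Lp ℝ 2 ((volume : Measure Plane).restrict Ω),
      (g =ᵐ[volume.restrict Ω] fun x => ‖u x‖ * ‖w x‖) ∧ ‖g‖ ≤ normL4 u * normL4 w := by
  have hprod : MemLp (fun x => ‖u x‖ * ‖w x‖) 2 (volume.restrict Ω) :=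
    MemLp.mul (p := 4) (q := 4) (r := 2) hw.norm hu.norm
  refine ⟨hprod.toLp _, hprod.coeFn_toLp, ?_⟩
  rw [Lp.norm_toLp, normL4, normL4, ← ENNReal.toReal_mul]
  refine ENNReal.toReal_mono (ENNReal.mul_ne_top hu.2.ne hw.2.ne) ?_
  have h := eLpNorm_smul_le_mul_eLpNorm (p := 4) (q := 4) (r := 2) hw.1.norm hu.1.norm
  rw [eLpNorm_norm, eLpNorm_norm] at h
  refine le_trans (le_of_eq ?_) h
  congr 1

theorem integrable_advect_aux {u w : L2 Ω Plane} (M : L2 Ω Mat2)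
    (hu : MemLp u 4 (volume.restrict Ω)) (hw : MemLp w 4 (volume.restrict Ω)) :
    Integrable (fun x => ‖u x‖ * ‖w x‖ * ‖M x‖) (volume.restrict Ω) ∧
    Integrable (fun x => advect (u x) (M x) (w x)) (volume.restrict Ω) := by
  obtain ⟨g, hg, -⟩ := exists_product_L2 hu hw
  have hInt : Integrable (fun x => ‖u x‖ * ‖w x‖ * ‖M x‖) (volume.restrict Ω) := by
    refine (integrable_norm_mul_norm g M).congr ?_
    filter_upwards [hg] with x hx
    rw [hx, Real.norm_of_nonneg (by positivity)]
  have hm : AEStronglyMeasurable (fun x => (u x, M x, w x)) (volume.restrict Ω) :=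
    (Lp.aestronglyMeasurable u).prodMk ((Lp.aestronglyMeasurable M).prodMk
      (Lp.aestronglyMeasurable w))
  have hm' : AEStronglyMeasurable (fun x => advect (u x) (M x) (w x)) (volume.restrict Ω) :=
    continuous_advect.comp_aestronglyMeasurable hm
  refine ⟨hInt, hInt.mono' hm' (Filter.Eventually.of_forall fun x => ?_)⟩
  rw [Real.norm_eq_abs]
  exact abs_advect_le (u x) (M x) (w x)

theorem advect_estimate {u w : L2 Ω Plane} (M : L2 Ω Mat2)
    (hu : MemLp u 4 (volume.restrict Ω)) (hw : MemLp w 4 (volume.restrict Ω)) :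
    |∫ x in Ω, advect (u x) (M x) (w x)| ≤ normL4 u * normL4 w * ‖M‖ := by
  obtain ⟨g, hg, hgn⟩ := exists_product_L2 hu hw
  obtain ⟨hInt, hI⟩ := integrable_advect_aux M hu hw
  have h1 : |∫ x in Ω, advect (u x) (M x) (w x)| ≤ ∫ x in Ω, ‖u x‖ * ‖w x‖ * ‖M x‖ :=
    (abs_integral_le_integral_abs).trans (integral_mono hI.abs hInt fun x => abs_advect_le _ _ _)
  have h2 : ∫ x in Ω, ‖u x‖ * ‖w x‖ * ‖M x‖ = ∫ x in Ω, ‖g x‖ * ‖M x‖ := by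
    refine integral_congr_ae ?_
    filter_upwards [hg] with x hx
    rw [hx, Real.norm_of_nonneg (by positivity)]
  rw [h2] at h1
  exact h1.trans ((integral_norm_mul_norm_le g M).trans
    (mul_le_mul_of_nonneg_right hgn (norm_nonneg M)))

variable {c_L : ℝ}

theorem abs_bForm_le (hL : IsLadyzhenskayaConstant Ω c_L) {u v w : FieldPair Ω}
    (hu : u ∈ H10 Ω) (hw : w ∈ H10 Ω) :
    |bForm u v w| ≤ normL4 u.fst * normL4 w.fst * ‖v.snd‖ := by
  rw [bForm_eq]
  exact advect_estimate v.snd (memLp_four hL hu) (memLp_four hL hw)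

theorem integrable_advect (hL : IsLadyzhenskayaConstant Ω c_L) {u v w : FieldPair Ω}
    (hu : u ∈ H10 Ω) (hw : w ∈ H10 Ω) :
    Integrable (fun x => advect (u.fst x) (v.snd x) (w.fst x)) (volume.restrict Ω) :=
  (integrable_advect_aux v.snd (memLp_four hL hu) (memLp_four hL hw)).2

theorem bForm_add_left (hL : IsLadyzhenskayaConstant Ω c_L) {u u' v w : FieldPair Ω}
    (hu : u ∈ H10 Ω) (hu' : u' ∈ H10 Ω)
    (hw : w ∈ H10 Ω) : bForm (u + u') v w = bForm u v w + bForm u' v w := by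
  rw [bForm_eq, bForm_eq, bForm_eq, ← integral_add (integrable_advect hL hu hw)
    (integrable_advect hL hu' hw)]
  refine integral_congr_ae ?_
  filter_upwards [Lp.coeFn_add u.fst u'.fst] with x hx
  have : (u + u').fst x = u.fst x + u'.fst x := hx
  simp only [this, advect, Fin.sum_univ_two, PiLp.add_apply]
  ring

theorem bForm_add_mid (hL : IsLadyzhenskayaConstant Ω c_L) {u v v' w : FieldPair Ω}
    (hu : u ∈ H10 Ω) (hw : w ∈ H10 Ω) :
    bForm u (v + v') w = bForm u v w + bForm u v' w := by
  rw [bForm_eq, bForm_eq, bForm_eq, ← integral_add (integrable_advect hL hu hw)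
    (integrable_advect hL hu hw)]
  refine integral_congr_ae ?_
  filter_upwards [Lp.coeFn_add v.snd v'.snd] with x hx
  have : (v + v').snd x = v.snd x + v'.snd x := hx
  simp only [this, advect, Fin.sum_univ_two, PiLp.add_apply]
  ring

theorem bForm_add_right (hL : IsLadyzhenskayaConstant Ω c_L) {u v w w' : FieldPair Ω}
    (hu : u ∈ H10 Ω) (hw : w ∈ H10 Ω)
    (hw' : w' ∈ H10 Ω) : bForm u v (w + w') = bForm u v w + bForm u v w' := by
  rw [bForm_eq, bForm_eq, bForm_eq, ← integral_add (integrable_advect hL hu hw)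
    (integrable_advect hL hu hw')]
  refine integral_congr_ae ?_
  filter_upwards [Lp.coeFn_add w.fst w'.fst] with x hx
  have : (w + w').fst x = w.fst x + w'.fst x := hx
  simp only [this, advect, Fin.sum_univ_two, PiLp.add_apply]
  ring

theorem bForm_smul_left (c : ℝ) (u v w : FieldPair Ω) : bForm (c • u) v w = c * bForm u v w := by
  rw [bForm_eq, bForm_eq, ← integral_const_mul]
  refine integral_congr_ae ?_
  filter_upwards [Lp.coeFn_smul c u.fst] with x hx
  have : (c • u).fst x = c • u.fst x := hx
  simp only [this, advect, Fin.sum_univ_two, PiLp.smul_apply, smul_eq_mul]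
  ring

theorem bForm_smul_mid (c : ℝ) (u v w : FieldPair Ω) : bForm u (c • v) w = c * bForm u v w := by
  rw [bForm_eq, bForm_eq, ← integral_const_mul]
  refine integral_congr_ae ?_
  filter_upwards [Lp.coeFn_smul c v.snd] with x hx
  have : (c • v).snd x = c • v.snd x := hx
  simp only [this, advect, Fin.sum_univ_two, PiLp.smul_apply, smul_eq_mul]
  ring

theorem bForm_smul_right (c : ℝ) (u v w : FieldPair Ω) : bForm u v (c • w) = c * bForm u v w := by
  rw [bForm_eq, bForm_eq, ← integral_const_mul]
  refine integral_congr_ae ?_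
  filter_upwards [Lp.coeFn_smul c w.fst] with x hx
  have : (c • w).fst x = c • w.fst x := hx
  simp only [this, advect, Fin.sum_univ_two, PiLp.smul_apply, smul_eq_mul]
  ring

end Trilinear

/-! ### Skew-symmetry of the trilinear form -/

section Skew

variable {Ω : Set Plane}

/-- The pairs `(ψ, ∇ψ)` with `ψ` a test field. -/
def testPairs (Ω : Set Plane) : Set (FieldPair Ω) :=
  {p : FieldPair Ω | ∃ ψ : Plane → Plane, IsTestFunction Ω ψ ∧
    p.fst =ᵐ[volume.restrict Ω] ψ ∧ p.snd =ᵐ[volume.restrict Ω] velocityGrad ψ}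

theorem testPairs_subset_H10 : testPairs Ω ⊆ H10 Ω := fun _ hp =>
  Submodule.le_topologicalClosure _ (Submodule.subset_span hp)

/-- A linear functional that is bounded on `H¹₀` and vanishes on test fields vanishes. -/
theorem eq_zero_of_testPairs {F : FieldPair Ω → ℝ} {C : ℝ}
    (hadd : ∀ p ∈ H10 Ω, ∀ q ∈ H10 Ω, F (p + q) = F p + F q)
    (hsmul : ∀ (c : ℝ), ∀ p ∈ H10 Ω, F (c • p) = c * F p)
    (hbd : ∀ p ∈ H10 Ω, |F p| ≤ C * ‖p‖) (hF : ∀ p ∈ testPairs Ω, F p = 0) :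
    ∀ p ∈ H10 Ω, F p = 0 := by
  let L : H10 Ω →L[ℝ] ℝ := LinearMap.mkContinuous
    { toFun := fun p => F p.1
      map_add' := fun p q => hadd p.1 p.2 q.1 q.2
      map_smul' := fun c p => hsmul c p.1 p.2 } C fun p => hbd p.1 p.2
  have hspan : ∀ p, ∀ hp : p ∈ Submodule.span ℝ (testPairs Ω),
      L ⟨p, Submodule.le_topologicalClosure _ hp⟩ = 0 := by
    intro p hp
    induction hp using Submodule.span_induction with
    | mem x h => exact hF x h
    | zero => exact map_zero L
    | add x y hx hy h1 h2 =>
      have := map_add L ⟨x, Submodule.le_topologicalClosure _ hx⟩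
        ⟨y, Submodule.le_topologicalClosure _ hy⟩
      rw [h1, h2, add_zero] at this
      exact this
    | smul c x hx h1 =>
      have := map_smul L c ⟨x, Submodule.le_topologicalClosure _ hx⟩
      rw [h1, smul_zero] at this
      exact this
  intro p hp
  have hp' : p ∈ closure (Submodule.span ℝ (testPairs Ω) : Set (FieldPair Ω)) := hp
  obtain ⟨x, hx, hlim⟩ := mem_closure_iff_seq_limit.1 hp'
  let xs : ℕ → H10 Ω := fun n => ⟨x n, Submodule.le_topologicalClosure _ (hx n)⟩
  have h1 : Filter.Tendsto xs Filter.atTop (nhds ⟨p, hp⟩) := tendsto_subtype_rng.2 hlim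
  have h2 := (L.continuous.tendsto _).comp h1
  have h3 : ∀ n, (L ∘ xs) n = 0 := fun n => hspan _ (hx n)
  have h4 : Filter.Tendsto (L ∘ xs) Filter.atTop (nhds 0) :=
    tendsto_const_nhds.congr fun n => (h3 n).symm
  exact tendsto_nhds_unique h2 h4

theorem IsTestFunction.continuous_partialD {F : Type} [NormedAddCommGroup F] [NormedSpace ℝ F]
    {η : Plane → F} (h : IsTestFunction Ω η) (j : Fin 2) : Continuous (partialD j η) :=
  (h.smooth.continuous_fderiv (by simp)).clm_apply continuous_const

theorem IsTestFunction.coord {η : Plane → Plane} (h : IsTestFunction Ω η) (i : Fin 2) :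
    IsTestFunction Ω (fun x => η x i) where
  smooth := (EuclideanSpace.proj (𝕜 := ℝ) i).contDiff.comp h.smooth
  compact := h.compact.comp_left (g := fun y : Plane => y i) rfl
  support := (closure_mono fun x (hx : η x i ≠ 0) => by
    intro h0
    rw [h0] at hx
    exact hx rfl).trans h.support

theorem partialD_coord {η : Plane → Plane} (h : IsTestFunction Ω η) (i j : Fin 2) (x : Plane) :
    partialD j (fun y => η y i) x = partialD j η x i := by
  have hd : DifferentiableAt ℝ η x := (h.smooth.differentiable (by simp)).differentiableAt
  have := ((EuclideanSpace.proj (𝕜 := ℝ) i).hasFDerivAt (x := η x)).comp x hd.hasFDerivAt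
  simp only [partialD]
  have e : fderiv ℝ (fun y => η y i) x = (EuclideanSpace.proj (𝕜 := ℝ) i).comp (fderiv ℝ η x) :=
    this.fderiv
  rw [e]; rfl

/-- Integration by parts for test functions. -/
theorem integral_mul_partialD {η q : Plane → ℝ} (hη : IsTestFunction Ω η)
    (hq : IsTestFunction Ω q) (j : Fin 2) :
    ∫ x in Ω, η x * partialD j q x = -∫ x in Ω, partialD j η x * q x := by
  have hs1 : Function.support (fun x => η x * partialD j q x) ⊆ Ω := fun x hx =>
    hη.support (subset_tsupport η (left_ne_zero_of_mul hx))
  have hs2 : Function.support (fun x => partialD j η x * q x) ⊆ Ω := fun x hx =>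
    hq.support (subset_tsupport q (right_ne_zero_of_mul hx))
  rw [setIntegral_eq_integral_of_forall_compl_eq_zero
      (fun x hx => Function.notMem_support.1 fun h => hx (hs1 h)),
    setIntegral_eq_integral_of_forall_compl_eq_zero
      (fun x hx => Function.notMem_support.1 fun h => hx (hs2 h))]
  refine integral_mul_fderiv_eq_neg_fderiv_mul_of_integrable ?_ ?_ ?_ ?_ ?_
  · exact ((hη.continuous_partialD j).mul hq.smooth.continuous).integrable_of_hasCompactSupport
      (hq.compact.mul_left)
  · exact (hη.smooth.continuous.mul (hq.continuous_partialD j)).integrable_of_hasCompactSupport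
      (hη.compact.mul_right)
  · exact (hη.smooth.continuous.mul hq.smooth.continuous).integrable_of_hasCompactSupport
      (hη.compact.mul_right)
  · exact fun x _ => (hη.smooth.differentiable (by simp)).differentiableAt
  · exact fun x _ => (hq.smooth.differentiable (by simp)).differentiableAt

/-- The gradient of a smooth scalar function. -/
def scalarGrad (q : Plane → ℝ) (x : Plane) : Plane := WithLp.toLp 2 fun j => partialD j q x

/-- A test function times the identity matrix. -/
def scalarMat (q : Plane → ℝ) (x : Plane) : Mat2 :=
  WithLp.toLp 2 fun ij : Fin 2 × Fin 2 => if ij.1 = ij.2 then q x else 0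

theorem memLp_of_continuous_hasCompactSupport {F : Type} [NormedAddCommGroup F] {g : Plane → F}
    (hg : Continuous g) (hc : HasCompactSupport g) :
    MemLp g 2 ((volume : Measure Plane).restrict Ω) :=
  (hg.memLp_of_hasCompactSupport hc).restrict Ω

theorem memLp_scalarGrad {q : Plane → ℝ} (hq : IsTestFunction Ω q) :
    MemLp (scalarGrad q) 2 ((volume : Measure Plane).restrict Ω) := by
  refine memLp_of_continuous_hasCompactSupport ?_ ?_
  · exact (PiLp.continuous_toLp 2 _).comp (continuous_pi fun j => hq.continuous_partialD j)
  · refine HasCompactSupport.intro hq.compact fun x hx => ?_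
    have : fderiv ℝ q x = 0 := by
      by_contra h
      exact hx (support_fderiv_subset ℝ h)
    ext j
    simp [scalarGrad, partialD, this]

theorem memLp_scalarMat {q : Plane → ℝ} (hq : IsTestFunction Ω q) :
    MemLp (scalarMat q) 2 ((volume : Measure Plane).restrict Ω) := by
  refine memLp_of_continuous_hasCompactSupport ?_ ?_
  · refine (PiLp.continuous_toLp 2 _).comp (continuous_pi fun ij => ?_)
    by_cases h : ij.1 = ij.2
    · simpa [h] using hq.smooth.continuous
    · simpa [h] using continuous_const
  · refine HasCompactSupport.intro hq.compact fun x hx => ?_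
    ext ij
    simp [scalarMat, image_eq_zero_of_notMem_tsupport hx]

theorem inner_scalarGrad (u : Plane) (q : Plane → ℝ) (x : Plane) :
    ⟪scalarGrad q x, u⟫_ℝ = ∑ j : Fin 2, u j * partialD j q x := by
  simp [scalarGrad, PiLp.inner_apply]

theorem inner_scalarMat (M : Mat2) (q : Plane → ℝ) (x : Plane) :
    ⟪scalarMat q x, M⟫_ℝ = ∑ i : Fin 2, M (i, i) * q x := by
  simp [scalarMat, PiLp.inner_apply, Fintype.sum_prod_type, Fin.sum_univ_two]

/-- Green's formula on `H¹₀`. -/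
theorem green_H10 {q : Plane → ℝ} (hq : IsTestFunction Ω q) :
    ∀ p ∈ H10 Ω, (∫ x in Ω, ∑ j : Fin 2, p.fst x j * partialD j q x) +
      ∫ x in Ω, ∑ i : Fin 2, p.snd x (i, i) * q x = 0 := by
  -- Represented by `g1` and `g2`, the functional is bounded, and `eq_zero_of_testPairs` reduces the
  -- formula to integration by parts for smooth fields.
  set g1 := (memLp_scalarGrad hq).toLp with hg1
  set g2 := (memLp_scalarMat hq).toLp with hg2
  have e1 : ∀ p : FieldPair Ω, ⟪g1, p.fst⟫_ℝ = ∫ x in Ω, ∑ j : Fin 2, p.fst x j * partialD j q x := by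
    intro p
    rw [L2.inner_def]
    refine integral_congr_ae ?_
    filter_upwards [(memLp_scalarGrad hq).coeFn_toLp] with x hx
    rw [hg1, hx, inner_scalarGrad]
  have e2 : ∀ p : FieldPair Ω, ⟪g2, p.snd⟫_ℝ = ∫ x in Ω, ∑ i : Fin 2, p.snd x (i, i) * q x := by
    intro p
    rw [L2.inner_def]
    refine integral_congr_ae ?_
    filter_upwards [(memLp_scalarMat hq).coeFn_toLp] with x hx
    rw [hg2, hx, inner_scalarMat]
  have key := eq_zero_of_testPairs (Ω := Ω) (F := fun p => ⟪g1, p.fst⟫_ℝ + ⟪g2, p.snd⟫_ℝ)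
    (C := ‖(innerSL ℝ g1).comp (WithLp.fstL 2 ℝ (L2 Ω Plane) (L2 Ω Mat2)) +
      (innerSL ℝ g2).comp (WithLp.sndL 2 ℝ (L2 Ω Plane) (L2 Ω Mat2))‖)
    (fun p _ q _ => by
      simp only [WithLp.add_fst, WithLp.add_snd, inner_add_right]; ring)
    (fun c p _ => by
      simp only [WithLp.smul_fst, WithLp.smul_snd, real_inner_smul_right]; ring)
    (fun p _ => ContinuousLinearMap.le_opNorm ((innerSL ℝ g1).comp
      (WithLp.fstL 2 ℝ (L2 Ω Plane) (L2 Ω Mat2)) +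
      (innerSL ℝ g2).comp (WithLp.sndL 2 ℝ (L2 Ω Plane) (L2 Ω Mat2))) p) ?_
  · intro p hp
    rw [← e1, ← e2]; exact key p hp
  rintro p ⟨ψ, hψ, h1, h2⟩
  rw [e1, e2]
  have a1 : ∫ x in Ω, ∑ j : Fin 2, p.fst x j * partialD j q x =
      ∑ j : Fin 2, ∫ x in Ω, ψ x j * partialD j q x := by
    rw [← integral_finsetSum]
    · refine integral_congr_ae ?_
      filter_upwards [h1] with x hx
      rw [hx]
    · intro j _
      exact (((hψ.coord j).smooth.continuous.mul
        (hq.continuous_partialD j)).integrable_of_hasCompactSupport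
        ((hψ.coord j).compact.mul_right)).integrableOn
  have a2 : ∫ x in Ω, ∑ i : Fin 2, p.snd x (i, i) * q x =
      ∑ i : Fin 2, ∫ x in Ω, partialD i (fun y => ψ y i) x * q x := by
    rw [← integral_finsetSum]
    · refine integral_congr_ae ?_
      filter_upwards [h2] with x hx
      rw [hx]
      refine Finset.sum_congr rfl fun i _ => ?_
      rw [partialD_coord hψ]; rfl
    · intro i _
      exact ((((hψ.coord i).continuous_partialD i).mul
        hq.smooth.continuous).integrable_of_hasCompactSupport hq.compact.mul_left).integrableOn
  rw [a1, a2, ← Finset.sum_add_distrib]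
  refine Finset.sum_eq_zero fun j _ => ?_
  rw [integral_mul_partialD (hψ.coord j) hq j, neg_add_cancel]

theorem IsTestFunction.inner {ψ χ : Plane → Plane} (hψ : IsTestFunction Ω ψ)
    (hχ : IsTestFunction Ω χ) : IsTestFunction Ω (fun x => ⟪ψ x, χ x⟫_ℝ) where
  smooth := hψ.smooth.inner ℝ hχ.smooth
  compact := HasCompactSupport.intro hψ.compact fun x hx => by
    rw [image_eq_zero_of_notMem_tsupport hx, inner_zero_left]
  support := (closure_mono fun x (hx : ⟪ψ x, χ x⟫_ℝ ≠ 0) => by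
    intro h0
    rw [h0, inner_zero_left] at hx
    exact hx rfl).trans hψ.support

theorem partialD_inner {ψ χ : Plane → Plane} (hψ : IsTestFunction Ω ψ)
    (hχ : IsTestFunction Ω χ) (j : Fin 2) (x : Plane) :
    partialD j (fun y => ⟪ψ y, χ y⟫_ℝ) x = ⟪ψ x, partialD j χ x⟫_ℝ + ⟪partialD j ψ x, χ x⟫_ℝ := by
  have h1 : DifferentiableAt ℝ ψ x := (hψ.smooth.differentiable (by simp)).differentiableAt
  have h2 : DifferentiableAt ℝ χ x := (hχ.smooth.differentiable (by simp)).differentiableAt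
  simp only [partialD]
  rw [fderiv_inner_apply ℝ h1 h2]

variable {c_L : ℝ}

/-- The integrands add up to `u · ∇(ψ · χ)`. Green's formula moves the derivative to `u`, which is
divergence-free. -/
theorem bForm_skew_test (hL : IsLadyzhenskayaConstant Ω c_L) {u v w : FieldPair Ω}
    (hu : u ∈ V Ω) (hv : v ∈ testPairs Ω)
    (hw : w ∈ testPairs Ω) : bForm u v w + bForm u w v = 0 := by
  have hv10 := testPairs_subset_H10 hv
  have hw10 := testPairs_subset_H10 hw
  obtain ⟨ψ, hψ, a1, a2⟩ := hv
  obtain ⟨χ, hχ, b1, b2⟩ := hw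
  have hg := green_H10 (hψ.inner hχ) u hu.1
  have htr : ∫ x in Ω, ∑ i : Fin 2, u.snd x (i, i) * ⟪ψ x, χ x⟫_ℝ = 0 := by
    have hu2 : ∀ᵐ x ∂((volume : Measure Plane).restrict Ω), ∑ i : Fin 2, u.snd x (i, i) = 0 := hu.2
    rw [integral_congr_ae (g := fun _ => (0 : ℝ)), integral_zero]
    filter_upwards [hu2] with x hx
    rw [← Finset.sum_mul, hx, zero_mul]
  rw [htr, add_zero] at hg
  rw [bForm_eq, bForm_eq, ← integral_add (integrable_advect hL hu.1 hw10)
    (integrable_advect hL hu.1 hv10), ← hg]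
  refine integral_congr_ae ?_
  filter_upwards [a1, a2, b1, b2] with x h1 h2 h3 h4
  rw [h1, h2, h3, h4]
  rw [Fin.sum_univ_two, partialD_inner hψ hχ, partialD_inner hψ hχ]
  simp only [advect, velocityGrad, Fin.sum_univ_two, PiLp.inner_apply]
  simp
  ring

theorem normL4_le (hL : IsLadyzhenskayaConstant Ω c_L) {v : FieldPair Ω}
    (hv : v ∈ H10 Ω) : normL4 v.fst ≤ √c_L * ‖v‖ := by
  refine le_of_sq_le_sq ?_ (by positivity)
  refine (normL4_sq_le hL hv).trans ?_
  have h := WithLp.prod_norm_sq_eq_of_L2 v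
  rw [mul_pow, Real.sq_sqrt hL.1.le, h]
  gcongr
  · exact hL.1.le
  · nlinarith [sq_nonneg (‖v.fst‖ - ‖v.snd‖), norm_nonneg v.fst, norm_nonneg v.snd]

theorem bForm_skew (hL : IsLadyzhenskayaConstant Ω c_L) {u v w : FieldPair Ω}
    (hu : u ∈ V Ω) (hv : v ∈ H10 Ω) (hw : w ∈ H10 Ω) :
    bForm u v w = -bForm u w v := by
  rw [← add_eq_zero_iff_eq_neg]
  have hsnd : ∀ p : FieldPair Ω, ‖p.snd‖ ≤ ‖p‖ := fun p => by
    refine le_of_sq_le_sq ?_ (norm_nonneg _)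
    rw [WithLp.prod_norm_sq_eq_of_L2]; nlinarith [sq_nonneg ‖p.fst‖]
  -- With `u` and one argument fixed, the sum is a bounded linear functional of the other, so test
  -- fields suffice there. As the sum is symmetric in `v` and `w`, two applications cover both
  -- slots.
  have gen : ∀ w ∈ H10 Ω, (∀ v ∈ testPairs Ω, bForm u v w + bForm u w v = 0) →
      ∀ v ∈ H10 Ω, bForm u v w + bForm u w v = 0 := by
    intro w hw htest
    refine eq_zero_of_testPairs (C := normL4 u.fst * normL4 w.fst +
      normL4 u.fst * √c_L * ‖w.snd‖) ?_ ?_ ?_ htest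
    · intro p hp q hq
      rw [bForm_add_mid hL hu.1 hw, bForm_add_right hL hu.1 hp hq]; ring
    · intro c p hp
      rw [bForm_smul_mid, bForm_smul_right]; ring
    · intro p hp
      have h1 := abs_bForm_le hL (v := p) hu.1 hw
      have h2 := abs_bForm_le hL (v := w) hu.1 hp
      have h3 : normL4 u.fst * normL4 w.fst * ‖p.snd‖ ≤ normL4 u.fst * normL4 w.fst * ‖p‖ :=
        mul_le_mul_of_nonneg_left (hsnd p)
          (mul_nonneg (normL4_nonneg _) (normL4_nonneg _))
      have h4 : normL4 u.fst * normL4 p.fst * ‖w.snd‖ ≤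
          normL4 u.fst * (√c_L * ‖p‖) * ‖w.snd‖ :=
        mul_le_mul_of_nonneg_right (mul_le_mul_of_nonneg_left (normL4_le hL hp)
          (normL4_nonneg _)) (norm_nonneg _)
      refine (abs_add_le _ _).trans ?_
      linarith
  refine gen w hw (fun v hv => ?_) v hv
  rw [add_comm]
  exact gen v (testPairs_subset_H10 hv)
    (fun w hw => by rw [add_comm]; exact bForm_skew_test hL hu hv hw) w hw

theorem bForm_self (hL : IsLadyzhenskayaConstant Ω c_L) {u v : FieldPair Ω}
    (hu : u ∈ V Ω) (hv : v ∈ H10 Ω) : bForm u v v = 0 := by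
  have := bForm_skew hL hu hv hv
  linarith

end Skew

/-! ### The operators of the Navier-Stokes equations -/

section Operators

variable {Ω : Set Plane}

theorem normL4_sq_le_grad {c_P c_L : ℝ} (hP : IsPoincareConstant Ω c_P)
    (hL : IsLadyzhenskayaConstant Ω c_L) {v : FieldPair Ω} (hv : v ∈ H10 Ω) :
    normL4 v.fst ^ 2 ≤ c_L * c_P * ‖v.snd‖ ^ 2 := by
  refine (normL4_sq_le hL hv).trans ?_
  have h := hP.2 v hv
  have : ‖v.fst‖ * ‖v.snd‖ ≤ c_P * ‖v.snd‖ * ‖v.snd‖ := by gcongr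
  have := mul_le_mul_of_nonneg_left this hL.1.le
  linarith

/-- The trilinear form represented by a bounded bilinear operator on `V`. -/
theorem exists_advection_operator {c_L : ℝ} (hL : IsLadyzhenskayaConstant Ω c_L) :
    ∃ B : V Ω →L[ℝ] V Ω →L[ℝ] V Ω,
      (∀ u v w : V Ω, ⟪B u v, w⟫_ℝ = bForm u.1 v.1 w.1) ∧
      (∀ u v : V Ω, ‖B u v‖ ^ 2 ≤
        c_L ^ 2 * ((‖embedL Ω u‖ * ‖u‖) * (‖embedL Ω v‖ * ‖v‖))) ∧
      ∀ u v : V Ω, ⟪B u v, v⟫_ℝ = 0 := by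
  have hex : ∀ u v : V Ω, ∃ z : V Ω, (∀ w : V Ω, ⟪z, w⟫_ℝ = bForm u.1 v.1 w.1) ∧
      ‖z‖ ≤ normL4 u.1.fst * normL4 v.1.fst := by
    intro u v
    have hb : ∀ w : V Ω, ‖bForm u.1 v.1 w.1‖ ≤ normL4 u.1.fst * normL4 v.1.fst * ‖w‖ := by
      intro w
      -- Exchanging `v` and `w` puts the gradient on `w`, so that `u` and `v` enter through their
      -- `L⁴` norms only.
      rw [bForm_skew hL u.2 v.2.1 w.2.1, norm_neg, Real.norm_eq_abs]
      refine (abs_bForm_le hL u.2.1 v.2.1).trans ?_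
      exact mul_le_mul_of_nonneg_left (norm_snd_le_V w)
        (mul_nonneg (normL4_nonneg _) (normL4_nonneg _))
    let ℓ : StrongDual ℝ (V Ω) := LinearMap.mkContinuous
      { toFun := fun w => bForm u.1 v.1 w.1
        map_add' := fun w w' => bForm_add_right hL u.2.1 w.2.1 w'.2.1
        map_smul' := fun c w => bForm_smul_right c u.1 v.1 w.1 }
      (normL4 u.1.fst * normL4 v.1.fst) hb
    refine ⟨(InnerProductSpace.toDual ℝ (V Ω)).symm ℓ, fun w => ?_, ?_⟩
    · rw [InnerProductSpace.toDual_symm_apply]; rfl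
    · rw [LinearIsometryEquiv.norm_map]
      exact LinearMap.mkContinuous_norm_le _ (mul_nonneg (normL4_nonneg _) (normL4_nonneg _)) _
  choose Z hZ hZn using hex
  have hbd : ∀ u v : V Ω, ‖Z u v‖ ≤ c_L * ‖u‖ * ‖v‖ := by
    intro u v
    refine (hZn u v).trans ?_
    have h1 := normL4_le hL u.2.1
    have h2 := normL4_le hL v.2.1
    calc _ ≤ (√c_L * ‖u‖) * (√c_L * ‖v‖) := by
          refine mul_le_mul h1 h2 (normL4_nonneg _) (by positivity)
      _ = (√c_L * √c_L) * ‖u‖ * ‖v‖ := by ring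
      _ = _ := by rw [Real.mul_self_sqrt hL.1.le]
  refine ⟨LinearMap.mkContinuous₂ (LinearMap.mk₂ ℝ Z ?_ ?_ ?_ ?_) c_L hbd, hZ, ?_, ?_⟩
  · intro u u' v
    refine ext_inner_right ℝ fun w => ?_
    rw [inner_add_left, hZ, hZ, hZ]
    exact bForm_add_left hL u.2.1 u'.2.1 w.2.1
  · intro c u v
    refine ext_inner_right ℝ fun w => ?_
    rw [real_inner_smul_left, hZ, hZ]
    exact bForm_smul_left c u.1 v.1 w.1
  · intro u v v'
    refine ext_inner_right ℝ fun w => ?_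
    rw [inner_add_left, hZ, hZ, hZ]
    exact bForm_add_mid hL u.2.1 w.2.1
  · intro c u v
    refine ext_inner_right ℝ fun w => ?_
    rw [real_inner_smul_left, hZ, hZ]
    exact bForm_smul_mid c u.1 v.1 w.1
  · intro u v
    have h0 : ∀ v : V Ω, normL4 v.1.fst ^ 2 ≤ c_L * (‖v.1.fst‖ * ‖v‖) := fun v =>
      (normL4_sq_le hL v.2.1).trans (mul_le_mul_of_nonneg_left
        (mul_le_mul_of_nonneg_left (norm_snd_le_V v) (norm_nonneg _)) hL.1.le)
    change ‖Z u v‖ ^ 2 ≤ c_L ^ 2 * ((‖u.1.fst‖ * ‖u‖) * (‖v.1.fst‖ * ‖v‖))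
    calc ‖Z u v‖ ^ 2 ≤ (normL4 u.1.fst * normL4 v.1.fst) ^ 2 := by gcongr; exact hZn u v
      _ = normL4 u.1.fst ^ 2 * normL4 v.1.fst ^ 2 := mul_pow _ _ _
      _ ≤ (c_L * (‖u.1.fst‖ * ‖u‖)) * (c_L * (‖v.1.fst‖ * ‖v‖)) :=
          mul_le_mul (h0 u) (h0 v) (by positivity) ((sq_nonneg _).trans (h0 u))
      _ = _ := by ring
  · intro u v
    exact (hZ u v v).trans (bForm_self hL u.2 v.2.1)

/-- Multiplication by a bounded function. -/
theorem exists_mul_operator {D : Set Plane} {θ : Plane → ℝ} {M : ℝ}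
    (hθ : AEStronglyMeasurable θ ((volume : Measure Plane).restrict D))
    (hM : ∀ᵐ x ∂((volume : Measure Plane).restrict D), |θ x| ≤ M) :
    ∃ T : L2 D Plane →L[ℝ] L2 D Plane, (∀ f, T f =ᵐ[volume.restrict D] fun x => θ x • f x) ∧
      ∀ f, ‖T f‖ ≤ M * ‖f‖ := by
  have hm : ∀ f : L2 D Plane, MemLp (fun x => θ x • f x) 2 (volume.restrict D) := by
    intro f
    refine MemLp.of_le_mul (c := M) (Lp.memLp f) (hθ.smul (Lp.aestronglyMeasurable f)) ?_
    filter_upwards [hM] with x hx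
    rw [norm_smul, Real.norm_eq_abs]
    gcongr
  have hn : ∀ f : L2 D Plane, ‖(hm f).toLp _‖ ≤ M * ‖f‖ := by
    intro f
    refine Lp.norm_le_mul_norm_of_ae_le_mul ?_
    filter_upwards [hM, (hm f).coeFn_toLp] with x hx h1
    rw [h1, norm_smul, Real.norm_eq_abs]
    gcongr
  refine ⟨LinearMap.mkContinuous ⟨⟨fun f => (hm f).toLp _, fun f g => ?_⟩, fun c f => ?_⟩ M hn,
    fun f => (hm f).coeFn_toLp, hn⟩
  · rw [← MemLp.toLp_add, MemLp.toLp_eq_toLp_iff]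
    filter_upwards [Lp.coeFn_add f g] with x hx
    rw [hx, Pi.add_apply, Pi.add_apply, smul_add]
  · change (hm (c • f)).toLp _ = c • (hm f).toLp _
    rw [← MemLp.toLp_const_smul, MemLp.toLp_eq_toLp_iff]
    filter_upwards [Lp.coeFn_smul c f] with x hx
    rw [hx, Pi.smul_apply, Pi.smul_apply, smul_comm]

/-- The coefficient vanishes at `1` and is Lipschitz, and `[-1, 1]` lies within distance `2` of `1`.
-/
theorem IsPorousCoefficient.exists_bound {α : ℝ → ℝ} (hα : IsPorousCoefficient α) :
    ∃ M, 0 ≤ M ∧ ∀ s, |s| ≤ 1 → |α s| ≤ M := by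
  obtain ⟨L, hL⟩ := hα.lipschitz
  refine ⟨L * 2, by positivity, fun s hs => ?_⟩
  have h := hL.dist_le_mul s 1
  rw [hα.fluid, Real.dist_eq, Real.dist_eq, sub_zero] at h
  refine h.trans ?_
  gcongr
  rw [abs_le] at hs ⊢
  constructor <;> linarith [hs.1, hs.2]

theorem IsPorousCoefficient.aestronglyMeasurable_comp {α : ℝ → ℝ} (hα : IsPorousCoefficient α)
    (φ : L2 Ω ℝ) :
    AEStronglyMeasurable (fun x => α (φ x)) ((volume : Measure Plane).restrict Ω) := by
  obtain ⟨L, hL⟩ := hα.lipschitz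
  exact hL.continuous.comp_aestronglyMeasurable (Lp.aestronglyMeasurable φ)

/-- The operator `-μ Δ` on `V`. -/
def diffusionL (Ω : Set Plane) (μ : ℝ) : V Ω →L[ℝ] V Ω :=
  μ • (ContinuousLinearMap.adjoint (gradL Ω)).comp (gradL Ω)

theorem inner_diffusionL (μ : ℝ) (u v : V Ω) :
    ⟪diffusionL Ω μ u, v⟫_ℝ = μ * ⟪u.1.snd, v.1.snd⟫_ℝ := by
  rw [diffusionL, _root_.smul_apply, real_inner_smul_left, ContinuousLinearMap.comp_apply,
    ContinuousLinearMap.adjoint_inner_left]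
  rfl

theorem diffusionL_coercive {c_P μ : ℝ} (hμ : 0 < μ) (hP : IsPoincareConstant Ω c_P) (v : V Ω) :
    μ / (1 + c_P ^ 2) * ‖v‖ ^ 2 ≤ ⟪diffusionL Ω μ v, v⟫_ℝ := by
  rw [inner_diffusionL, real_inner_self_eq_norm_sq, div_mul_eq_mul_div, div_le_iff₀ (by positivity)]
  have := mul_le_mul_of_nonneg_left (norm_sq_V_le hP v) hμ.le
  linarith

/-- The Brinkman term `α(φ) u` as an operator on `V`. -/
theorem exists_brinkman_operator {α : ℝ → ℝ} (hα : IsPorousCoefficient α)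
    {φ : L2 Ω ℝ × L2 Ω Plane} (hφ : φ ∈ Admissible Ω) :
    ∃ D : V Ω →L[ℝ] V Ω,
      (∀ u v : V Ω, ⟪D u, v⟫_ℝ = ∫ x in Ω, α (φ.1 x) * ⟪u.1.fst x, v.1.fst x⟫_ℝ) ∧
      ∀ v : V Ω, 0 ≤ ⟪D v, v⟫_ℝ := by
  obtain ⟨M, -, hM⟩ := hα.exists_bound
  obtain ⟨T, hT, -⟩ := exists_mul_operator (M := M) (hα.aestronglyMeasurable_comp φ.1)
    (by filter_upwards [hφ.2] with x hx using hM _ hx)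
  have e : ∀ u v : V Ω, ⟪((ContinuousLinearMap.adjoint (embedL Ω)).comp (T.comp (embedL Ω))) u, v⟫_ℝ
      = ∫ x in Ω, α (φ.1 x) * ⟪u.1.fst x, v.1.fst x⟫_ℝ := by
    intro u v
    rw [ContinuousLinearMap.comp_apply, ContinuousLinearMap.adjoint_inner_left,
      ContinuousLinearMap.comp_apply, L2.inner_def]
    refine integral_congr_ae ?_
    filter_upwards [hT (embedL Ω u)] with x hx
    rw [hx, real_inner_smul_left]; rfl
  refine ⟨_, e, fun v => ?_⟩
  rw [e]
  refine integral_nonneg fun x => ?_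
  simp only [real_inner_self_eq_norm_sq]
  exact mul_nonneg (hα.nonneg _) (by positivity)

/-- The action of a force on `V`. -/
theorem inner_adjoint_embedL (f : L2 Ω Plane) (ψ : V Ω) :
    ⟪ContinuousLinearMap.adjoint (embedL Ω) f, ψ⟫_ℝ = ∫ x in Ω, ⟪f x, ψ.1.fst x⟫_ℝ := by
  rw [ContinuousLinearMap.adjoint_inner_left, L2.inner_def]; rfl

theorem aForm_eq {μ : ℝ} {α : ℝ → ℝ} {φ : L2 Ω ℝ} {D : V Ω →L[ℝ] V Ω}
    (hD : ∀ u v : V Ω, ⟪D u, v⟫_ℝ = ∫ x in Ω, α (φ x) * ⟪u.1.fst x, v.1.fst x⟫_ℝ) (u v : V Ω) :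
    aForm μ α φ u.1 v.1 = ⟪diffusionL Ω μ u + D u, v⟫_ℝ := by
  rw [inner_add_left, inner_diffusionL, hD, aForm, L2.inner_def]

end Operators

/-! ### Small solutions of quadratic equations -/

section SmallData

open Filter Topology

variable {E F : Type*} [NormedAddCommGroup E] [InnerProductSpace ℝ E] [CompleteSpace E]
  [NormedAddCommGroup F] [NormedSpace ℝ F]

/-- The linearized equation is uniquely solvable by the Lax-Milgram theorem. -/
theorem exists_oseen_solution (N : E →L[ℝ] F) {k μ : ℝ} (hμ : 0 < μ) (hk : 0 < k)
    (hN : ∀ v, ‖v‖ ≤ k * ‖N v‖) (A : E →L[ℝ] E) (hA : ∀ w, μ * ‖N w‖ ^ 2 ≤ ⟪A w, w⟫_ℝ) (g : E) :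
    ∃ w, A w = g := by
  let Bl : E →L[ℝ] E →L[ℝ] ℝ := (innerSL ℝ).comp A
  have hBl : ∀ w z, Bl w z = ⟪A w, z⟫_ℝ := fun w z => rfl
  have hco : IsCoercive Bl := by
    refine ⟨μ / k ^ 2, by positivity, fun w => ?_⟩
    rw [hBl, mul_assoc, ← sq]
    refine le_trans ?_ (hA w)
    have h := pow_le_pow_left₀ (norm_nonneg _) (hN w) 2
    rw [mul_pow] at h
    rw [div_mul_eq_mul_div, div_le_iff₀ (by positivity)]
    nlinarith
  refine ⟨hco.continuousLinearEquivOfBilin.symm g, ext_inner_right ℝ fun z => ?_⟩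
  rw [← hBl, ← hco.continuousLinearEquivOfBilin_apply]
  simp

/-- A map that contracts the equivalent norm `‖N ·‖` has a fixed point. -/
theorem exists_fixed_of_contracting (N : E →L[ℝ] F) {k : ℝ} (hk : 0 < k)
    (hN : ∀ v, ‖v‖ ≤ k * ‖N v‖) (S : E → E)
    (hS : ∀ v v', ‖N (S v - S v')‖ ≤ 1 / 2 * ‖N (v - v')‖) : ∃ v, S v = v := by
  let x : ℕ → E := fun n => S^[n] 0
  have hxs : ∀ n, x (n + 1) = S (x n) := fun n => Function.iterate_succ_apply' S n 0
  have hgeo : ∀ n, ‖N (x n - x (n + 1))‖ ≤ ‖N (x 0 - x 1)‖ * (1 / 2) ^ n := by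
    intro n
    induction n with
    | zero => simp
    | succ n ih =>
      rw [hxs (n + 1), hxs n]
      refine (hS _ _).trans ?_
      rw [← hxs, pow_succ]
      linarith
  have hcau : CauchySeq x := by
    refine cauchySeq_of_le_geometric (1 / 2) (k * ‖N (x 0 - x 1)‖) (by norm_num) fun n => ?_
    rw [dist_eq_norm, mul_assoc]
    exact (hN _).trans (mul_le_mul_of_nonneg_left (hgeo n) hk.le)
  obtain ⟨v, hv⟩ := cauchySeq_tendsto_of_complete hcau
  refine ⟨v, ?_⟩
  have h1 : Tendsto (fun n => S (x n)) atTop (𝓝 (S v)) := by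
    rw [tendsto_iff_norm_sub_tendsto_zero]
    have h2 := tendsto_iff_norm_sub_tendsto_zero.1 hv
    refine squeeze_zero (fun n => norm_nonneg _) (g := fun n => k * (1 / 2 * (‖N‖ * ‖x n - v‖)))
      (fun n => ?_) ?_
    · refine (hN _).trans (mul_le_mul_of_nonneg_left ((hS _ _).trans ?_) hk.le)
      exact mul_le_mul_of_nonneg_left (N.le_opNorm _) (by norm_num)
    · simpa only [mul_zero] using ((h2.const_mul ‖N‖).const_mul (1 / 2)).const_mul k
  have h2 : Tendsto (fun n => x (n + 1)) atTop (𝓝 v) := (tendsto_add_atTop_iff_nat 1).2 hv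
  simp only [hxs] at h2
  exact tendsto_nhds_unique h1 h2

/-- Let `S v` solve the Oseen problem `A w + B v w = g`, which is coercive because `B v` is skew.
Then `‖N (S v)‖ ≤ m / μ`, and `(A + B v) (S v - S v') = -B (v - v') (S v')` shows that `S` contracts
`‖N ·‖` with factor `κ m / μ² ≤ 1/2`. A fixed point is a solution. -/
theorem exists_small_solution (N : E →L[ℝ] F) {k μ κ m : ℝ} (hμ : 0 < μ) (hk : 0 < k)
    (hκ : 0 ≤ κ) (hm : 0 ≤ m) (hN : ∀ v, ‖v‖ ≤ k * ‖N v‖) (A : E →L[ℝ] E) (B : E →L[ℝ] E →L[ℝ] E)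
    (hA : ∀ w, μ * ‖N w‖ ^ 2 ≤ ⟪A w, w⟫_ℝ) (hB0 : ∀ v w, ⟪B v w, w⟫_ℝ = 0)
    (hB : ∀ u v w, |⟪B u v, w⟫_ℝ| ≤ κ * (‖N u‖ * ‖N w‖) * ‖N v‖) (g : E)
    (hg : ∀ w, ⟪g, w⟫_ℝ ≤ m * ‖N w‖) (hsmall : 2 * (κ * m) ≤ μ ^ 2) :
    ∃ v, A v + B v v = g := by
  have hco : ∀ v w, μ * ‖N w‖ ^ 2 ≤ ⟪(A + B v) w, w⟫_ℝ := by
    intro v w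
    rw [_root_.add_apply, inner_add_left, hB0, add_zero]
    exact hA w
  choose S hS using fun v => exists_oseen_solution N hμ hk hN (A + B v) (hco v) g
  have hSb : ∀ v, μ * ‖N (S v)‖ ≤ m := by
    intro v
    have h1 := (hco v (S v)).trans ((hS v).symm ▸ hg (S v))
    rcases (norm_nonneg (N (S v))).eq_or_lt with h0 | h0
    · rw [← h0, mul_zero]; exact hm
    · refine le_of_mul_le_mul_right ?_ h0
      nlinarith
  have hcontr : ∀ v v', ‖N (S v - S v')‖ ≤ 1 / 2 * ‖N (v - v')‖ := by
    intro v v'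
    have e : (A + B v) (S v - S v') = -(B (v - v') (S v')) := by
      rw [map_sub (A + B v), hS v, ← hS v', map_sub B, _root_.sub_apply, _root_.add_apply,
        _root_.add_apply]
      abel
    have h1 := hco v (S v - S v')
    rw [e, inner_neg_left] at h1
    have h2 := (neg_le_abs _).trans (hB (v - v') (S v') (S v - S v'))
    have h3 := hSb v'
    have h6 := h1.trans h2
    have a0 := norm_nonneg (N (S v - S v'))
    have d0 := norm_nonneg (N (v - v'))
    set a := ‖N (S v - S v')‖
    set d := ‖N (v - v')‖
    set s := ‖N (S v')‖
    have h7 : μ ^ 2 * a ^ 2 ≤ μ ^ 2 / 2 * d * a := by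
      have a1 := mul_le_mul_of_nonneg_left h6 hμ.le
      have a2 := mul_le_mul_of_nonneg_left h3 (mul_nonneg hκ (mul_nonneg d0 a0))
      have a4 := mul_le_mul_of_nonneg_right hsmall (mul_nonneg d0 a0)
      linarith
    rcases a0.eq_or_lt with h0 | h0
    · rw [← h0]; positivity
    · have hμ2 : 0 < μ ^ 2 := by positivity
      have : μ ^ 2 * a * a ≤ (μ ^ 2 / 2 * d) * a := by linarith
      have := le_of_mul_le_mul_right this h0
      nlinarith
  obtain ⟨v, hv⟩ := exists_fixed_of_contracting N hk hN S hcontr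
  refine ⟨v, ?_⟩
  have := hS v
  rwa [hv, _root_.add_apply] at this

end SmallData

/-! ### The stationary problem -/

section Stationary

variable {Ω : Set Plane} {c_P c_L μ : ℝ}

/-- Test the equation with `v`: advection vanishes and the Brinkman term is nonnegative. The bound
is the same for all designs. -/
theorem stationary_bound (hμ : 0 < μ) (hP : IsPoincareConstant Ω c_P)
    (hL : IsLadyzhenskayaConstant Ω c_L) {α : ℝ → ℝ} (hα : IsPorousCoefficient α)
    {f_s : L2 Ω Plane} {φ : L2 Ω ℝ} {v : V Ω} (hv : IsStationaryState μ α f_s φ v) :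
    ‖v.1.snd‖ ≤ c_P * ‖f_s‖ / μ := by
  have h := hv v
  rw [bForm_self hL v.2 v.2.1, add_zero, aForm, ← L2.inner_def, ← L2.inner_def,
    real_inner_self_eq_norm_sq] at h
  have h1 : 0 ≤ ∫ x in Ω, α (φ x) * ⟪v.1.fst x, v.1.fst x⟫_ℝ :=
    integral_nonneg fun x => mul_nonneg (hα.nonneg _) (by
      rw [real_inner_self_eq_norm_sq]; positivity)
  have h2 := real_inner_le_norm f_s v.1.fst
  have h3 := mul_le_mul_of_nonneg_left (hP.2 v.1 v.2.1) (norm_nonneg f_s)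
  rw [le_div_iff₀ hμ]
  rcases (norm_nonneg v.1.snd).eq_or_lt with h0 | h0
  · rw [← h0, zero_mul]; exact mul_nonneg hP.1.le (norm_nonneg _)
  · refine le_of_mul_le_mul_right ?_ h0
    nlinarith

/-- The advection form is bounded by the Dirichlet norms. -/
theorem abs_bForm_le_grad (hP : IsPoincareConstant Ω c_P) (hL : IsLadyzhenskayaConstant Ω c_L)
    {u v w : FieldPair Ω} (hu : u ∈ H10 Ω) (hw : w ∈ H10 Ω) :
    |bForm u v w| ≤ c_L * c_P * (‖u.snd‖ * ‖w.snd‖) * ‖v.snd‖ := by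
  have hk0 : 0 ≤ c_L * c_P := mul_nonneg hL.1.le hP.1.le
  have n : ∀ {z : FieldPair Ω}, z ∈ H10 Ω → normL4 z.fst ≤ √(c_L * c_P) * ‖z.snd‖ := by
    intro z hz
    refine le_of_sq_le_sq ?_ (by positivity)
    rw [mul_pow, Real.sq_sqrt hk0]; exact normL4_sq_le_grad hP hL hz
  refine (abs_bForm_le hL hu hw).trans (mul_le_mul_of_nonneg_right ?_ (norm_nonneg _))
  calc _ ≤ (√(c_L * c_P) * ‖u.snd‖) * (√(c_L * c_P) * ‖w.snd‖) :=
        mul_le_mul (n hu) (n hw) (normL4_nonneg _) (by positivity)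
    _ = (√(c_L * c_P) * √(c_L * c_P)) * (‖u.snd‖ * ‖w.snd‖) := by ring
    _ = _ := by rw [Real.mul_self_sqrt hk0]

/-- `exists_small_solution` in the Dirichlet norm, with `κ = c_L * c_P` and `m = c_P * ‖f_s‖`; its
condition `2 * (κ * m) ≤ μ ^ 2` is the smallness of the force. -/
theorem exists_stationaryState (hμ : 0 < μ) (hP : IsPoincareConstant Ω c_P)
    (hL : IsLadyzhenskayaConstant Ω c_L) {α : ℝ → ℝ} (hα : IsPorousCoefficient α)
    {f_s : L2 Ω Plane} (hsmall : 2 * c_P ^ 2 * c_L * ‖f_s‖ < μ ^ 2)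
    {φ : L2 Ω ℝ × L2 Ω Plane} (hφ : φ ∈ Admissible Ω) :
    ∃ v : V Ω, IsStationaryState μ α f_s φ.1 v := by
  obtain ⟨B, hB, -, hB0⟩ := exists_advection_operator hL
  obtain ⟨D, hD, hD0⟩ := exists_brinkman_operator hα hφ
  have hN : ∀ v : V Ω, ‖v‖ ≤ √(1 + c_P ^ 2) * ‖gradL Ω v‖ := by
    intro v
    refine le_of_sq_le_sq ?_ (by positivity)
    rw [mul_pow, Real.sq_sqrt (by positivity)]
    exact norm_sq_V_le hP v
  have hA : ∀ w : V Ω, μ * ‖gradL Ω w‖ ^ 2 ≤ ⟪(diffusionL Ω μ + D) w, w⟫_ℝ := by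
    intro w
    rw [_root_.add_apply, inner_add_left, inner_diffusionL, real_inner_self_eq_norm_sq,
      gradL_apply]
    linarith [hD0 w]
  have hB' : ∀ u v w : V Ω, |⟪B u v, w⟫_ℝ| ≤
      c_L * c_P * (‖gradL Ω u‖ * ‖gradL Ω w‖) * ‖gradL Ω v‖ := by
    intro u v w
    rw [hB]
    exact abs_bForm_le_grad hP hL u.2.1 w.2.1
  have hg : ∀ w : V Ω, ⟪ContinuousLinearMap.adjoint (embedL Ω) f_s, w⟫_ℝ ≤
      c_P * ‖f_s‖ * ‖gradL Ω w‖ := by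
    intro w
    rw [ContinuousLinearMap.adjoint_inner_left]
    have h2 := real_inner_le_norm f_s (embedL Ω w)
    have h3 := mul_le_mul_of_nonneg_left (hP.2 w.1 w.2.1) (norm_nonneg f_s)
    rw [gradL_apply]
    rw [embedL_apply] at h2 ⊢
    linarith
  obtain ⟨v, hv⟩ := exists_small_solution (gradL Ω) hμ (by positivity)
    (mul_nonneg hL.1.le hP.1.le) (mul_nonneg hP.1.le (norm_nonneg f_s)) hN
    (diffusionL Ω μ + D) B hA hB0 hB' _ hg (by linarith)
  refine ⟨v, fun ψ => ?_⟩
  rw [aForm_eq hD, ← hB, ← inner_add_left, ← inner_adjoint_embedL, ← hv, _root_.add_apply]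

end Stationary

/-! ### Weak time derivatives -/

section WeakDerivative

variable {a b : ℝ}

theorem eq_zero_of_tsupport_subset_Ioo {θ : ℝ → ℝ} (hs : tsupport θ ⊆ Ioo a b) {t : ℝ}
    (ht : t ∉ Ioo a b) : θ t = 0 := by
  by_contra h
  exact ht (hs (subset_tsupport θ h))

/-- Integration by parts against the primitive of an integrable function. -/
theorem integral_deriv_mul_prim (hab : a ≤ b) {θ h : ℝ → ℝ} (hθ : ContDiff ℝ ∞ θ)
    (hs : tsupport θ ⊆ Ioo a b) (hh : Integrable h (timeMeasure a b)) :
    ∫ t in Ioo a b, deriv θ t * prim a h t = - ∫ t in Ioo a b, θ t * h t := by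
  have hI : IntervalIntegrable h volume a b :=
    intervalIntegrable_of_integrable_Ioo hh (left_mem_Icc.2 hab) (right_mem_Icc.2 hab)
  have h1 : AbsolutelyContinuousOnInterval θ a b :=
    (hθ.of_le (by exact_mod_cast le_top)).contDiffOn.absolutelyContinuousOnInterval
  have h2 : AbsolutelyContinuousOnInterval (prim a h) a b :=
    hI.absolutelyContinuousOnInterval_intervalIntegral (c := a) left_mem_uIcc
  have h3 := h1.integral_mul_deriv_eq_deriv_mul h2
  rw [eq_zero_of_tsupport_subset_Ioo hs (t := a) (by simp),
    eq_zero_of_tsupport_subset_Ioo hs (t := b) (by simp)] at h3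
  have h4 : ∫ t in a..b, θ t * deriv (prim a h) t = ∫ t in a..b, θ t * h t := by
    refine intervalIntegral.integral_congr_ae ?_
    filter_upwards [hI.ae_hasDerivAt_integral] with x hx hxI
    have := hx (uIoc_subset_uIcc hxI) a left_mem_uIcc
    exact congrArg (θ x * ·) this.deriv
  rw [integral_Ioo_eq_intervalIntegral _ hab, integral_Ioo_eq_intervalIntegral _ hab, ← h4, h3]
  simp

theorem exists_Icc_of_isCompact_subset_Ioo {K : Set ℝ} (hK : IsCompact K) (hs : K ⊆ Ioo a b)
    (hab : a < b) : ∃ c d, a < c ∧ d < b ∧ K ⊆ Icc c d := by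
  rcases K.eq_empty_or_nonempty with rfl | hne
  · exact ⟨b, a, hab, hab, empty_subset _⟩
  · obtain ⟨c, hc⟩ := hK.exists_isLeast hne
    obtain ⟨d, hd⟩ := hK.exists_isGreatest hne
    exact ⟨c, d, (hs hc.1).1, (hs hd.1).2, fun x hx => ⟨hc.2 hx, hd.2 hx⟩⟩

/-- A test function of vanishing mean is the derivative of a test function. -/
theorem exists_deriv_eq_of_integral_eq_zero (hab : a < b) {η : ℝ → ℝ} (hη : ContDiff ℝ ∞ η)
    (hc : HasCompactSupport η) (hs : tsupport η ⊆ Ioo a b) (h0 : ∫ t in a..b, η t = 0) :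
    ∃ θ : ℝ → ℝ, ContDiff ℝ ∞ θ ∧ HasCompactSupport θ ∧ tsupport θ ⊆ Ioo a b ∧ deriv θ = η := by
  obtain ⟨c, d, hac, hdb, hK⟩ := exists_Icc_of_isCompact_subset_Ioo hc hs hab
  have hz : ∀ t, t ∉ Icc c d → η t = 0 := fun t ht => by
    by_contra h
    exact ht (hK (subset_tsupport η h))
  have hd : ∀ t, HasDerivAt (fun t => ∫ s in a..t, η s) (η t) t := fun t =>
    intervalIntegral.integral_hasDerivAt_right (hη.continuous.intervalIntegrable _ _)
      hη.continuous.aestronglyMeasurable.stronglyMeasurableAtFilter hη.continuous.continuousAt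
  have hder : deriv (fun t => ∫ s in a..t, η s) = η := funext fun t => (hd t).deriv
  -- Left of `c` there is nothing to integrate; right of `d` the integral already equals the total
  -- one, which is zero.
  have hsupp : ∀ t, t ∉ Icc c d → ∫ s in a..t, η s = 0 := by
    intro t ht
    rcases lt_or_ge t c with h | h
    · refine (intervalIntegral.integral_congr (g := fun _ => 0) fun s hs => hz s fun h' => ?_).trans
        (by simp)
      exact absurd (h'.1.trans hs.2) (not_le.2 (max_lt hac h))
    · have h' : d < t := lt_of_not_ge fun h'' => ht ⟨h, h''⟩
      have : ∫ s in t..b, η s = 0 := by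
        refine (intervalIntegral.integral_congr (g := fun _ => 0)
          fun s hs => hz s fun h'' => ?_).trans (by simp)
        exact absurd (hs.1.trans h''.2) (not_le.2 (lt_min h' hdb))
      have h2 := intervalIntegral.integral_add_adjacent_intervals
        (μ := volume) (hη.continuous.intervalIntegrable a t)
        (hη.continuous.intervalIntegrable t b)
      linarith
  have hts : tsupport (fun t => ∫ s in a..t, η s) ⊆ Icc c d :=
    closure_minimal (fun t ht => by
      by_contra h
      exact ht (hsupp t h)) isClosed_Icc
  refine ⟨_, ?_, isCompact_Icc.of_isClosed_subset (isClosed_tsupport _) hts,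
    hts.trans fun x hx => ⟨hac.trans_le hx.1, hx.2.trans_lt hdb⟩, hder⟩
  rw [contDiff_infty_iff_deriv, hder]
  exact ⟨fun t => (hd t).differentiableAt, hη⟩

theorem exists_test_integral_eq_one (hab : a < b) : ∃ θ : ℝ → ℝ, ContDiff ℝ ∞ θ ∧
    HasCompactSupport θ ∧ tsupport θ ⊆ Ioo a b ∧ ∫ t in Ioo a b, θ t = 1 := by
  let χ : ContDiffBump ((a + b) / 2) := ⟨(b - a) / 8, (b - a) / 4, by linarith, by linarith⟩
  have hts : tsupport (χ.normed volume) ⊆ Ioo a b := by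
    rw [χ.tsupport_normed_eq, Real.closedBall_eq_Icc]
    intro x hx
    simp only [χ] at hx
    constructor <;> linarith [hx.1, hx.2]
  refine ⟨χ.normed volume, χ.contDiff_normed, χ.hasCompactSupport_normed, hts, ?_⟩
  rw [setIntegral_eq_integral_of_forall_compl_eq_zero
    fun t ht => eq_zero_of_tsupport_subset_Ioo hts ht]
  exact χ.integral_normed

/-- A continuous function with an integrable weak derivative is its primitive. -/
theorem sub_eq_integral_of_weak_deriv (hab : a < b) {y h : ℝ → ℝ}
    (hy : ContinuousOn y (Icc a b)) (hh : Integrable h (timeMeasure a b))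
    (H : ∀ θ : ℝ → ℝ, ContDiff ℝ ∞ θ → HasCompactSupport θ → tsupport θ ⊆ Ioo a b →
      ∫ t in Ioo a b, deriv θ t * y t = - ∫ t in Ioo a b, θ t * h t) {t : ℝ} (ht : t ∈ Icc a b) :
    y t - y a = ∫ s in a..t, h s := by
  set k : ℝ → ℝ := fun t => y t - prim a h t with hk
  have hkc : ContinuousOn k (Icc a b) := hy.sub (continuousOn_prim hh)
  have hInt : ∀ {θ g : ℝ → ℝ}, Continuous θ → ContinuousOn g (Icc a b) →
      IntegrableOn (fun t => θ t * g t) (Ioo a b) := fun {θ g} hθ hg =>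
    ((hθ.continuousOn.mul hg).integrableOn_Icc).mono_set Ioo_subset_Icc_self
  have hk0 : ∀ θ : ℝ → ℝ, ContDiff ℝ ∞ θ → HasCompactSupport θ → tsupport θ ⊆ Ioo a b →
      ∫ t in Ioo a b, deriv θ t * k t = 0 := by
    intro θ hθ hc hs
    have hdc : Continuous (deriv θ) := hθ.continuous_deriv (by exact_mod_cast le_top)
    simp only [hk, mul_sub]
    rw [integral_sub (hInt hdc hy) (hInt hdc (continuousOn_prim hh)), H θ hθ hc hs,
      integral_deriv_mul_prim hab.le hθ hs hh, sub_self]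
  -- The argument of du Bois-Reymond: for a test function `χ`, `χ - (∫ χ) θ₀` has mean zero and is
  -- the derivative of a test function, so `k` annihilates it. Hence `k - m` annihilates every `χ`.
  obtain ⟨θ₀, hθ₀, hc₀, hs₀, h₀⟩ := exists_test_integral_eq_one hab
  set m := ∫ t in Ioo a b, θ₀ t * k t with hm
  have hae : ∀ᵐ t ∂volume, t ∈ Ioo a b → k t - m = 0 := by
    refine isOpen_Ioo.ae_eq_zero_of_integral_contDiff_smul_eq_zero
      (((hkc.sub continuousOn_const).mono Ioo_subset_Icc_self).locallyIntegrableOn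
        measurableSet_Ioo) fun χ hχ hc hs => ?_
    rw [← setIntegral_eq_integral_of_forall_compl_eq_zero (s := Ioo a b) fun t ht => by
      rw [eq_zero_of_tsupport_subset_Ioo hs ht, zero_smul]]
    set I := ∫ t in Ioo a b, χ t with hI
    have hηs : tsupport (fun t => χ t - I * θ₀ t) ⊆ Ioo a b := by
      refine (tsupport_sub χ (fun t => I * θ₀ t)).trans (union_subset hs ?_)
      exact (closure_mono (Function.support_mul_subset_right (fun _ => I) θ₀)).trans hs₀
    have hcont₁ : IntegrableOn χ (Ioo a b) :=
      (hχ.continuous.integrableOn_Icc).mono_set Ioo_subset_Icc_self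
    have hcont₀ : IntegrableOn θ₀ (Ioo a b) :=
      (hθ₀.continuous.integrableOn_Icc).mono_set Ioo_subset_Icc_self
    obtain ⟨θ, h1, h2, h3, h4⟩ := exists_deriv_eq_of_integral_eq_zero hab
      (hχ.sub (contDiff_const.mul hθ₀)) (hc.sub hc₀.mul_left) hηs (by
        rw [← integral_Ioo_eq_intervalIntegral _ hab.le,
          integral_sub hcont₁ (hcont₀.const_mul I), integral_const_mul, h₀, mul_one, sub_self])
    have h5 := hk0 θ h1 h2 h3
    rw [h4] at h5
    simp only [sub_mul, mul_assoc, smul_eq_mul, mul_sub] at h5 ⊢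
    rw [integral_sub (hInt hχ.continuous hkc) ((hInt hθ₀.continuous hkc).const_mul I),
      integral_const_mul] at h5
    rw [integral_sub (hInt hχ.continuous hkc) (hcont₁.mul_const m), integral_mul_const]
    exact h5
  have hEq : EqOn k (fun _ => m) (Ioo a b) := by
    refine Measure.eqOn_open_of_ae_eq (μ := volume) ?_ isOpen_Ioo (hkc.mono Ioo_subset_Icc_self)
      continuousOn_const
    rw [Filter.EventuallyEq, ae_restrict_iff' measurableSet_Ioo]
    filter_upwards [hae] with t ht hI
    exact sub_eq_zero.1 (ht hI)
  have hEq' : EqOn k (fun _ => m) (Icc a b) := by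
    have := hEq.of_subset_closure hkc continuousOn_const Ioo_subset_Icc_self
    exact this (by rw [closure_Ioo hab.ne])
  have e1 := hEq' ht
  have e2 := hEq' (left_mem_Icc.2 hab.le)
  simp only [hk, prim, intervalIntegral.integral_same] at e1 e2
  linarith

end WeakDerivative

/-! ### The energy identity with a nonzero initial value -/

section Energy

variable {E : Type*} [NormedAddCommGroup E] [InnerProductSpace ℝ E] [CompleteSpace E]
  {G : Type*} [NormedAddCommGroup G] [InnerProductSpace ℝ G] [CompleteSpace G]
  {ι : E →L[ℝ] G} {a b : ℝ} {u g : ℝ → E} {w : ℝ → G}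

theorem integrable_inner_of_memLp {Y : Type*} [MeasurableSpace Y] {m : Measure Y} {f h : Y → E}
    (hf : MemLp f 2 m) (hh : MemLp h 2 m) : Integrable (fun s => ⟪f s, h s⟫_ℝ) m := by
  refine (L2.integrable_inner (𝕜 := ℝ) (hf.toLp f) (hh.toLp h)).congr ?_
  filter_upwards [hf.coeFn_toLp, hh.coeFn_toLp] with s h1 h2
  rw [h1, h2]

theorem intervalIntegral_inner_const {s t : ℝ} (hg : IntervalIntegrable g volume s t) (ψ : E) :
    ∫ r in s..t, ⟪g r, ψ⟫_ℝ = ⟪∫ r in s..t, g r, ψ⟫_ℝ := by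
  have := (innerSL ℝ ψ).intervalIntegral_comp_comm hg
  simp only [innerSL_apply_apply] at this
  rw [real_inner_comm, ← this]
  exact intervalIntegral.integral_congr fun r _ => real_inner_comm _ _

theorem timeMeasure_mono {s t : ℝ} (hs : a ≤ s) (ht : t ≤ b) : timeMeasure s t ≤ timeMeasure a b :=
  Measure.restrict_mono (Ioo_subset_Ioo hs ht) le_rfl

theorem eqOn_of_ae_eq_timeMeasure (hab : a < b) {f h : ℝ → G} (hf : ContinuousOn f (Icc a b))
    (hh : ContinuousOn h (Icc a b)) (hfh : f =ᵐ[timeMeasure a b] h) : EqOn f h (Icc a b) := by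
  have hEq : EqOn f h (Ioo a b) := Measure.eqOn_open_of_ae_eq (μ := volume) hfh isOpen_Ioo
    (hf.mono Ioo_subset_Icc_self) (hh.mono Ioo_subset_Icc_self)
  have := hEq.of_subset_closure hf hh Ioo_subset_Icc_self
  exact this (by rw [closure_Ioo hab.ne])

/-- The energy identity for functions with values in `E` and derivative in the dual space. -/
theorem norm_sq_sub_norm_sq_eq (hu : MemLp u 2 (timeMeasure a b)) (hg : MemLp g 2 (timeMeasure a b))
    (hw : ContinuousOn w (Icc a b)) (hwu : ∀ᵐ t ∂(timeMeasure a b), w t = ι (u t))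
    (hInt : ∀ t ∈ Icc a b, ∀ ψ, ⟪w t - w a, ι ψ⟫_ℝ = ∫ r in a..t, ⟪g r, ψ⟫_ℝ) {t : ℝ}
    (ht : t ∈ Icc a b) : ‖w t‖ ^ 2 - ‖w a‖ ^ 2 = 2 * ∫ s in a..t, ⟪g s, u s⟫_ℝ := by
  have hgi : Integrable g (timeMeasure a b) := hg.integrable one_le_two
  have hgu : Integrable (fun s => ⟪g s, u s⟫_ℝ) (timeMeasure a b) := integrable_inner_of_memLp hg hu
  rcases (ht.1.trans ht.2).eq_or_lt with rfl | hab
  · obtain rfl : t = a := le_antisymm ht.2 ht.1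
    simp
  have hgψ : ∀ ψ, Integrable (fun s => ⟪g s, ψ⟫_ℝ) (timeMeasure a b) :=
    fun ψ => hgi.inner_const ψ
  have hamem := left_mem_Icc.2 hab.le
  -- The claim says that `Q` is constant. By continuity it is enough that `Q s = Q b` for almost
  -- every `s`.
  set Q : ℝ → ℝ := fun t => ‖w t‖ ^ 2 - 2 * prim a (fun s => ⟪g s, u s⟫_ℝ) t with hQ
  have hQc : ContinuousOn Q (Icc a b) :=
    (hw.norm.pow 2).sub ((continuousOn_prim hgu).const_mul 2)
  have hQae : ∀ᵐ s ∂(timeMeasure a b), Q s = Q b := by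
    -- The value `w a` need not lie in the range of `ι`, but `w s = ι (u s)` for almost every `s`.
    -- On `(s, b)` the function `u - u s` has zero initial value, and
    -- `exists_continuous_representative` applies to it.
    filter_upwards [hwu, ae_restrict_mem measurableSet_Ioo] with s hws hs
    have hsI := Ioo_subset_Icc_self hs
    have hincr : ∀ t ∈ Icc s b, ∀ ψ, ⟪w t - w s, ι ψ⟫_ℝ = ∫ r in s..t, ⟪g r, ψ⟫_ℝ := by
      intro t ht ψ
      have ht' : t ∈ Icc a b := ⟨hs.1.le.trans ht.1, ht.2⟩
      rw [← sub_sub_sub_cancel_right (w t) (w s) (w a), inner_sub_left, hInt t ht', hInt s hsI,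
        intervalIntegral.integral_interval_sub_left
          (intervalIntegrable_of_integrable_Ioo (hgψ ψ) hamem ht')
          (intervalIntegrable_of_integrable_Ioo (hgψ ψ) hamem hsI)]
    have hmono := timeMeasure_mono (a := a) (b := b) hs.1.le le_rfl
    have hz : MemLp (fun r => u r - u s) 2 (timeMeasure s b) :=
      (hu.mono_measure hmono).sub (memLp_const _)
    have hg' : MemLp g 2 (timeMeasure s b) := hg.mono_measure hmono
    have hgi' := hg'.integrable one_le_two
    have hgram : gram s b ι (hz.toLp _) = volterra s b E (hg'.toLp _) := by
      refine Lp.ext ?_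
      filter_upwards [inner_gram ι (hz.toLp _), hz.coeFn_toLp, coeFn_volterra (hg'.toLp _),
        ae_Ioo_of_ae_timeMeasure hwu hs.1.le le_rfl, ae_restrict_mem measurableSet_Ioo]
        with r h1 h2 h3 h4 hr
      have hr' := Ioo_subset_Icc_self hr
      refine ext_inner_right ℝ fun ψ => ?_
      rw [h1, h2, h3, prim_congr hg'.coeFn_toLp hr', prim, map_sub, ← h4, ← hws,
        hincr r hr', intervalIntegral_inner_const
          (intervalIntegrable_of_integrable_Ioo hgi' (left_mem_Icc.2 hs.2.le) hr')]
    obtain ⟨ζ, hζc, -, hζae, hζ⟩ := exists_continuous_representative hs.2.le ι hgram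
    have hEq : EqOn ζ (fun r => w r - w s) (Icc s b) := by
      refine eqOn_of_ae_eq_timeMeasure hs.2 hζc
        ((hw.mono (Icc_subset_Icc_left hs.1.le)).sub continuousOn_const) ?_
      filter_upwards [hζae, hz.coeFn_toLp, ae_Ioo_of_ae_timeMeasure hwu hs.1.le le_rfl]
        with r h1 h2 h3
      rw [h1, h2, map_sub, ← h3, ← hws]
    have hb := right_mem_Icc.2 hs.2.le
    have e1 := hζ b hb
    have e2 := hincr b hb (u s)
    have e3 : ∫ r in s..b, ⟪(hg'.toLp _ : ℝ → E) r, (hz.toLp _ : ℝ → E) r⟫_ℝ =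
        (∫ r in s..b, ⟪g r, u r⟫_ℝ) - ∫ r in s..b, ⟪g r, u s⟫_ℝ := by
      rw [← intervalIntegral.integral_sub
        (intervalIntegrable_of_integrable_Ioo hgu hsI (right_mem_Icc.2 hab.le))
        (intervalIntegrable_of_integrable_Ioo (hgψ _) hsI (right_mem_Icc.2 hab.le))]
      refine intervalIntegral_congr_timeMeasure (a := s) (b := b) ?_ le_rfl hs.2.le le_rfl
      filter_upwards [hg'.coeFn_toLp, hz.coeFn_toLp] with r h1 h2
      rw [h1, h2, inner_sub_right]
    rw [e3, ← e2, hEq hb] at e1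
    simp only at e1
    rw [norm_sub_sq_real, ← hws, inner_sub_left, real_inner_self_eq_norm_sq] at e1
    have e4 := intervalIntegral.integral_add_adjacent_intervals
      (intervalIntegrable_of_integrable_Ioo hgu hamem hsI)
      (intervalIntegrable_of_integrable_Ioo hgu hsI (right_mem_Icc.2 hab.le))
    simp only [hQ, prim]
    linarith
  have hEq := eqOn_of_ae_eq_timeMeasure hab hQc continuousOn_const hQae
  have e1 := hEq ht
  have e2 := hEq hamem
  simp only [hQ, prim, intervalIntegral.integral_same] at e1 e2
  linarith

end Energy

/-! ### Existence of time-dependent states -/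

section IntegralForm

variable {E : Type*} [NormedAddCommGroup E] [InnerProductSpace ℝ E] [CompleteSpace E]
  {G : Type*} [NormedAddCommGroup G] [InnerProductSpace ℝ G] [CompleteSpace G]
  {a b : ℝ}

/-- The equation gives this for almost every `t`, and both sides are continuous. -/
theorem inner_representative_eq (hab : a < b) (ι : E →L[ℝ] G) {z g : LT a b E}
    (h : gram a b ι z = volterra a b E g) {ζ : ℝ → G} (hζ : ContinuousOn ζ (Icc a b))
    (hζz : ∀ᵐ t ∂(timeMeasure a b), ζ t = ι (z t)) {t : ℝ} (ht : t ∈ Icc a b) (ψ : E) :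
    ⟪ζ t, ι ψ⟫_ℝ = ∫ r in a..t, ⟪g r, ψ⟫_ℝ := by
  have hI : ∀ t ∈ Icc a b, ⟪prim a g t, ψ⟫_ℝ = ∫ r in a..t, ⟪g r, ψ⟫_ℝ := fun t ht =>
    (intervalIntegral_inner_const (g.intervalIntegrable (left_mem_Icc.2 hab.le) ht) ψ).symm
  rw [← hI t ht]
  refine eqOn_of_ae_eq_timeMeasure hab (f := fun t => ⟪ζ t, ι ψ⟫_ℝ)
    (h := fun t => ⟪prim a g t, ψ⟫_ℝ) (hζ.inner continuousOn_const)
    ((continuousOn_prim g.integrable).inner continuousOn_const) ?_ ht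
  filter_upwards [inner_gram ι z, coeFn_volterra g, hζz] with s h1 h2 h3
  rw [h3, ← h1, h, h2]

/-- A solution of an evolution equation yields a solution of a perturbed one with the same initial
value. -/
theorem exists_perturbed_evolution (hab : a < b) (ι : E →L[ℝ] G) {A : E →L[ℝ] E} {c : ℝ}
    (hc : 0 < c) (hA : ∀ v, c * ‖v‖ ^ 2 ≤ ⟪A v, v⟫_ℝ)
    (B : E →L[ℝ] E →L[ℝ] E) {K : ℝ} (hK : 0 ≤ K)
    (hB : ∀ u v, ‖B u v‖ ^ 2 ≤ K * ((‖ι u‖ * ‖u‖) * (‖ι v‖ * ‖v‖)))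
    (hB0 : ∀ u v, ⟪B u v, v⟫_ℝ = 0) {D₀ D₁ : E →L[ℝ] E} (hD₀ : ∀ v, 0 ≤ ⟪D₀ v, v⟫_ℝ)
    (hD₁ : ∀ v, 0 ≤ ⟪D₁ v, v⟫_ℝ) {u g : ℝ → E} {w : ℝ → G}
    (hu : MemLp u 2 (timeMeasure a b)) (hg : MemLp g 2 (timeMeasure a b))
    (hw : ContinuousOn w (Icc a b)) (hwu : ∀ᵐ t ∂(timeMeasure a b), w t = ι (u t))
    (hInt : ∀ t ∈ Icc a b, ∀ ψ, ⟪w t - w a, ι ψ⟫_ℝ = ∫ r in a..t, ⟪g r, ψ⟫_ℝ) :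
    ∃ (u' g' : ℝ → E) (w' : ℝ → G), MemLp u' 2 (timeMeasure a b) ∧ MemLp g' 2 (timeMeasure a b) ∧
      ContinuousOn w' (Icc a b) ∧ (∀ᵐ t ∂(timeMeasure a b), w' t = ι (u' t)) ∧ w' a = w a ∧
      (∀ t ∈ Icc a b, ∀ ψ, ⟪w' t - w' a, ι ψ⟫_ℝ = ∫ r in a..t, ⟪g' r, ψ⟫_ℝ) ∧
      ∀ᵐ t ∂(timeMeasure a b), g' t + (A (u' t) + D₁ (u' t)) + B (u' t) (u' t) =
        g t + (A (u t) + D₀ (u t)) + B (u t) (u t) := by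
  obtain ⟨C, hC⟩ := isCompact_Icc.exists_bound_of_continuousOn hw
  have hC0 : 0 ≤ C := (norm_nonneg _).trans (hC a (left_mem_Icc.2 hab.le))
  have hbd : ∀ᵐ t ∂(timeMeasure a b), ‖ι (hu.toLp u t)‖ ≤ C := by
    filter_upwards [hwu, hu.coeFn_toLp, ae_restrict_mem measurableSet_Ioo] with t h1 h2 h3
    rw [h2, ← h1]
    exact hC t (Ioo_subset_Icc_self h3)
  obtain ⟨p, hp, -⟩ := exists_mem_energySpace ι hC0 hbd
  obtain ⟨k, z, hz, hk⟩ := exists_perturbed_solution hab.le ι hc hA B hK hB hB0 hD₀ hD₁ p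
  obtain ⟨ζ, hζc, hζ0, hζz, -⟩ := exists_continuous_representative hab.le ι hz
  set Az := A.compLpL 2 (timeMeasure a b) z with hAz
  -- The correction `z` starts from zero, so the initial value is kept; its derivative is `k - A z`.
  refine ⟨fun t => u t + z t, fun t => g t + (k - Az : LT a b E) t, fun t => w t + ζ t,
    hu.add (Lp.memLp z), hg.add (Lp.memLp _), hw.add hζc, ?_, ?_, ?_, ?_⟩
  · filter_upwards [hwu, hζz] with t h1 h2
    rw [h1, h2, map_add]
  · simp only [hζ0, add_zero]
  · intro t ht ψ
    have h0 := left_mem_Icc.2 hab.le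
    simp only [hζ0, add_zero]
    rw [add_sub_right_comm, inner_add_left, hInt t ht,
      inner_representative_eq hab _ hz hζc hζz ht, ← intervalIntegral.integral_add
        (intervalIntegrable_of_integrable_Ioo
          ((hg.integrable one_le_two).inner_const ψ) h0 ht)
        (intervalIntegrable_of_integrable_Ioo ((LT.integrable _).inner_const ψ) h0 ht)]
    simp only [inner_add_left]
  · filter_upwards [hk, hu.coeFn_toLp, Lp.coeFn_sub k Az,
      A.coeFn_compLpL (p := 2) z] with t h2 h3 h4 h5
    rw [hp, h3] at h2
    rw [← add_assoc (g t) (A (u t)), add_assoc (g t + A (u t)), ← h2, h4, Pi.sub_apply, hAz, h5,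
      map_add A]
    abel

end IntegralForm

/-! ### Transfer of time-dependent states between designs -/

section TimeStates

variable {Ω : Set Plane} {c_P c_L μ T : ℝ} {α : ℝ → ℝ} {f : ℝ → L2 Ω Plane} {u₀ : L2 Ω Plane}
  {φ : L2 Ω ℝ} {u : ℝ → V Ω}

/-- The time derivative of a time-dependent state as a function with values in `V`, and its
continuous representative. -/
structure IsStateData (μ : ℝ) (α : ℝ → ℝ) (f : ℝ → L2 Ω Plane)
    (u₀ : L2 Ω Plane) (T : ℝ) (φ : L2 Ω ℝ) (u g : ℝ → V Ω) (w : ℝ → L2 Ω Plane) : Prop where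
  memLp_state : MemLp u 2 (timeMeasure 0 T)
  memLp_deriv : MemLp g 2 (timeMeasure 0 T)
  continuousOn : ContinuousOn w (Icc 0 T)
  ae_eq : ∀ᵐ t ∂(timeMeasure 0 T), w t = embedL Ω (u t)
  initial : w 0 = u₀
  increment : ∀ t ∈ Icc 0 T, ∀ ψ : V Ω, ⟪w t - w 0, embedL Ω ψ⟫_ℝ = ∫ r in 0..t, ⟪g r, ψ⟫_ℝ
  equation : ∀ᵐ t ∂(timeMeasure 0 T), ∀ ψ : V Ω,
    ⟪g t, ψ⟫_ℝ + aForm μ α φ (u t) ψ + bForm (u t : FieldPair Ω) (u t) ψ =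
      ∫ x in Ω, ⟪f t x, ψ.1.fst x⟫_ℝ

/-- Riesz's theorem moves the derivative from `V*` to `V`, and `sub_eq_integral_of_weak_deriv` turns
the weak derivative into increments valid at every time. -/
theorem IsTimeState.exists_data (hT : 0 < T) (h : IsTimeState μ α f u₀ T φ u) :
    ∃ g w, IsStateData μ α f u₀ T φ u g w := by
  obtain ⟨hu, ⟨du, hdu, hweak, heq⟩, ⟨w, hw, hwu, hw0⟩⟩ := h
  let R := (InnerProductSpace.toDual ℝ (V Ω)).symm
  have hR : ∀ t ψ, ⟪R (du t), ψ⟫_ℝ = du t ψ := fun t ψ =>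
    InnerProductSpace.toDual_symm_apply
  have hg : MemLp (fun t => R (du t)) 2 (timeMeasure 0 T) :=
    MemLp.of_le (f := fun t => R (du t)) (g := du) hdu
      (R.continuous.comp_aestronglyMeasurable hdu.1)
      (Filter.Eventually.of_forall fun t => (R.norm_map _).le)
  refine ⟨fun t => R (du t), w, hu, hg, hw, hwu, hw0, ?_, ?_⟩
  · intro t ht ψ
    have := sub_eq_integral_of_weak_deriv hT (y := fun t => ⟪w t, embedL Ω ψ⟫_ℝ)
      (h := fun t => ⟪R (du t), ψ⟫_ℝ) (hw.inner continuousOn_const)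
      ((hg.integrable one_le_two).inner_const ψ) (fun θ h1 h2 h3 => ?_) ht
    · rw [inner_sub_left]; exact this
    · simp only [hR]
      rw [← hweak θ h1 h2 h3 ψ]
      refine integral_congr_ae ?_
      filter_upwards [hwu] with t ht
      simp only [ht]
      rfl
  · filter_upwards [heq] with t ht ψ
    rw [hR]; exact ht ψ

theorem IsStateData.isTimeState (hT : 0 < T) {g : ℝ → V Ω} {w : ℝ → L2 Ω Plane}
    (h : IsStateData μ α f u₀ T φ u g w) : IsTimeState μ α f u₀ T φ u := by
  let J := InnerProductSpace.toDual ℝ (V Ω)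
  have hJ : ∀ t ψ, J (g t) ψ = ⟪g t, ψ⟫_ℝ := fun t ψ => rfl
  refine ⟨h.memLp_state, ⟨fun t => J (g t), ?_, ?_, ?_⟩, ⟨w, h.continuousOn, h.ae_eq, h.initial⟩⟩
  · exact MemLp.of_le (f := fun t => J (g t)) (g := g) h.memLp_deriv
      (J.continuous.comp_aestronglyMeasurable h.memLp_deriv.1)
      (Filter.Eventually.of_forall fun t => (J.norm_map _).le)
  · intro θ hθ hc hs ψ
    have hi : Integrable (fun r => ⟪g r, ψ⟫_ℝ) (timeMeasure 0 T) :=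
      (h.memLp_deriv.integrable one_le_two).inner_const ψ
    have h1 := integral_deriv_mul_prim hT.le hθ hs hi
    simp only [hJ]
    rw [← h1]
    have hdc : Continuous (deriv θ) := hθ.continuous_deriv (by exact_mod_cast le_top)
    have hcp := continuousOn_prim hi
    -- The state and the primitive of `g` differ by the initial value, a constant that is invisible
    -- to `θ'`.
    have h3 : ∫ t in Ioo 0 T, deriv θ t * ⟪w 0, embedL Ω ψ⟫_ℝ = 0 := by
      rw [integral_mul_const, integral_Ioo_eq_intervalIntegral _ hT.le,
        intervalIntegral.integral_deriv_eq_sub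
          (fun x _ => (hθ.differentiable (by simp)).differentiableAt)
          (hdc.intervalIntegrable _ _),
        eq_zero_of_tsupport_subset_Ioo hs (t := T) (by simp),
        eq_zero_of_tsupport_subset_Ioo hs (t := 0) (by simp)]
      simp
    have h4 : ∫ t in Ioo 0 T, deriv θ t * ⟪(u t).1.fst, ψ.1.fst⟫_ℝ =
        ∫ t in Ioo 0 T, (deriv θ t * prim 0 (fun r => ⟪g r, ψ⟫_ℝ) t +
          deriv θ t * ⟪w 0, embedL Ω ψ⟫_ℝ) := by
      refine integral_congr_ae ?_
      filter_upwards [h.ae_eq, ae_restrict_mem measurableSet_Ioo] with t ht htI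
      have e := h.increment t (Ioo_subset_Icc_self htI) ψ
      rw [ht, inner_sub_left] at e
      rw [← mul_add]
      congr 1
      rw [prim, ← e]
      simp only [embedL_apply]
      ring
    rw [h4, integral_add, h3, add_zero]
    · exact ((hdc.continuousOn.mul hcp).integrableOn_Icc).mono_set Ioo_subset_Icc_self
    · exact ((hdc.continuousOn.mul continuousOn_const).integrableOn_Icc).mono_set
        Ioo_subset_Icc_self
  · filter_upwards [h.equation] with t ht ψ
    rw [hJ]; exact ht ψ

/-- A time-dependent state for one design yields a time-dependent state for any other. -/
theorem exists_timeState (hT : 0 < T) (hμ : 0 < μ) (hP : IsPoincareConstant Ω c_P)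
    (hL : IsLadyzhenskayaConstant Ω c_L) (hα : IsPorousCoefficient α)
    {φ₀ φ₁ : L2 Ω ℝ × L2 Ω Plane} (hφ₀ : φ₀ ∈ Admissible Ω) (hφ₁ : φ₁ ∈ Admissible Ω)
    (h : IsTimeState μ α f u₀ T φ₀.1 u) : ∃ u', IsTimeState μ α f u₀ T φ₁.1 u' := by
  obtain ⟨g, w, hd⟩ := h.exists_data hT
  obtain ⟨B, hB, hBK, hB0⟩ := exists_advection_operator hL
  obtain ⟨D₀, hD₀, hD₀p⟩ := exists_brinkman_operator hα hφ₀
  obtain ⟨D₁, hD₁, hD₁p⟩ := exists_brinkman_operator hα hφ₁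
  obtain ⟨u', g', w', h1, h2, h3, h4, h5, h6, h7⟩ := exists_perturbed_evolution hT (embedL Ω)
    (A := diffusionL Ω μ) (div_pos hμ (by positivity : 0 < 1 + c_P ^ 2))
    (diffusionL_coercive hμ hP) B (sq_nonneg c_L) hBK hB0 hD₀p hD₁p hd.memLp_state
    hd.memLp_deriv hd.continuousOn hd.ae_eq hd.increment
  refine ⟨u', IsStateData.isTimeState hT ⟨h1, h2, h3, h4, h5.trans hd.initial, h6, ?_⟩⟩
  filter_upwards [hd.equation, h7] with t h1 h2 ψ
  have e := h1 ψ
  rw [aForm_eq hD₀, ← hB, ← inner_add_left, ← inner_add_left] at e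
  rw [aForm_eq hD₁, ← hB, ← inner_add_left, ← inner_add_left, h2, e]

end TimeStates

/-! ### Distance of the time-dependent state to the stationary one -/

/-- The advection terms differ by `B u (u - v) + B (u - v) v`, of which the first is orthogonal to
`u - v`. Only the stationary state is left as a coefficient. -/
theorem inner_deriv_eq {E : Type*} [NormedAddCommGroup E] [InnerProductSpace ℝ E]
    (L : E →L[ℝ] E) (B : E →L[ℝ] E →L[ℝ] E) (hB0 : ∀ u v, ⟪B u v, v⟫_ℝ = 0) {g u v : E} {p q : ℝ}
    (hu : ⟪g, u - v⟫_ℝ + ⟪L u, u - v⟫_ℝ + ⟪B u u, u - v⟫_ℝ = p)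
    (hv : ⟪L v, u - v⟫_ℝ + ⟪B v v, u - v⟫_ℝ = q) :
    ⟪g, u - v⟫_ℝ = p - q - ⟪L (u - v), u - v⟫_ℝ - ⟪B (u - v) v, u - v⟫_ℝ := by
  have h := hB0 u (u - v)
  rw [map_sub (B u), inner_sub_left] at h
  rw [← hu, ← hv, map_sub L, map_sub B, _root_.sub_apply, inner_sub_left, inner_sub_left]
  linarith

/-- Here `n = ‖∇(u - v)‖`, `m = ‖u - v‖`, `y = ‖∇v‖` and `r = ‖f - f_s‖`. Of the dissipation `μ n²`,
advection takes one half by smallness and the source one quarter by Young's inequality. Poincaré's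
inequality converts the last quarter to `m`. -/
theorem coercivity_estimate {μ c_P c_L F y n m r β p q : ℝ} (hμ : 0 < μ) (hP : 0 < c_P)
    (hL : 0 < c_L) (hsmall : 2 * c_P ^ 2 * c_L * F < μ ^ 2) (n0 : 0 ≤ n) (m0 : 0 ≤ m) (r0 : 0 ≤ r)
    (hy : y ≤ c_P * F / μ) (hm : m ≤ c_P * n) (hb : |β| ≤ c_L * c_P * (n * n) * y)
    (hp : p ≤ r * m) (hq : q ≤ p - μ * n ^ 2 - β) :
    q ≤ c_P ^ 2 / μ * r ^ 2 - μ / (4 * c_P ^ 2) * m ^ 2 := by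
  have k1 : c_L * c_P * (n * n) * y ≤ μ / 2 * n ^ 2 := by
    have a1 := mul_le_mul_of_nonneg_left hy (by positivity : 0 ≤ c_L * c_P * (n * n))
    have a2 : c_L * c_P * (c_P * F / μ) ≤ μ / 2 := by
      rw [← mul_div_assoc, div_le_iff₀ hμ]; nlinarith
    have a3 := mul_le_mul_of_nonneg_right a2 (sq_nonneg n)
    nlinarith
  have k2 : r * m ≤ c_P ^ 2 / μ * r ^ 2 + μ / 4 * n ^ 2 := by
    have a1 := mul_le_mul_of_nonneg_left hm r0
    have a2 : r * (c_P * n) ≤ c_P ^ 2 / μ * r ^ 2 + μ / 4 * n ^ 2 := by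
      have : c_P ^ 2 / μ * r ^ 2 + μ / 4 * n ^ 2 - r * (c_P * n) =
          (c_P * r - μ / 2 * n) ^ 2 / μ := by field_simp; ring
      have : 0 ≤ (c_P * r - μ / 2 * n) ^ 2 / μ := by positivity
      linarith
    exact a1.trans a2
  have k3 : μ / (4 * c_P ^ 2) * m ^ 2 ≤ μ / 4 * n ^ 2 := by
    have a1 := pow_le_pow_left₀ m0 hm 2
    rw [div_mul_eq_mul_div, div_le_iff₀ (by positivity)]
    rw [mul_pow] at a1
    have := mul_le_mul_of_nonneg_left a1 hμ.le
    linarith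
  linarith [neg_le_abs β]

section Turnpike

variable {Ω : Set Plane} {c_P c_L μ T : ℝ} {α : ℝ → ℝ} {f : ℝ → L2 Ω Plane} {u₀ : L2 Ω Plane}

theorem inner_deriv_le_sub (hL : IsLadyzhenskayaConstant Ω c_L) (hα : IsPorousCoefficient α)
    {f_s : L2 Ω Plane} {φ : L2 Ω ℝ × L2 Ω Plane} (hφ : φ ∈ Admissible Ω) {v : V Ω}
    (hv : IsStationaryState μ α f_s φ.1 v) {u g : V Ω} {F : L2 Ω Plane}
    (hu : ∀ ψ : V Ω, ⟪g, ψ⟫_ℝ + aForm μ α φ.1 u ψ + bForm (u : FieldPair Ω) u ψ =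
      ∫ x in Ω, ⟪F x, ψ.1.fst x⟫_ℝ) :
    ⟪g, u - v⟫_ℝ ≤ ⟪F - f_s, embedL Ω (u - v)⟫_ℝ - μ * ‖gradL Ω (u - v)‖ ^ 2 -
      bForm (u - v).1 v.1 (u - v).1 := by
  obtain ⟨B, hB, -, hB0⟩ := exists_advection_operator hL
  obtain ⟨D, hD, hD0⟩ := exists_brinkman_operator hα hφ
  have h1 := hu (u - v)
  have h2 := hv (u - v)
  rw [aForm_eq hD, ← hB, ← inner_adjoint_embedL, ContinuousLinearMap.adjoint_inner_left] at h1 h2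
  have h3 := inner_deriv_eq (diffusionL Ω μ + D) B hB0 h1 h2
  have h4 : μ * ‖gradL Ω (u - v)‖ ^ 2 ≤ ⟪(diffusionL Ω μ + D) (u - v), u - v⟫_ℝ := by
    rw [_root_.add_apply, inner_add_left, inner_diffusionL, real_inner_self_eq_norm_sq, gradL_apply]
    exact le_add_of_nonneg_right (hD0 _)
  refine h3.trans_le (sub_le_sub (sub_le_sub ?_ h4) (hB _ _ _).ge)
  exact (inner_sub_left F f_s _).ge

theorem inner_deriv_le (hμ : 0 < μ) (hP : IsPoincareConstant Ω c_P)
    (hL : IsLadyzhenskayaConstant Ω c_L) (hα : IsPorousCoefficient α)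
    {f_s : L2 Ω Plane} (hsmall : 2 * c_P ^ 2 * c_L * ‖f_s‖ < μ ^ 2)
    {φ : L2 Ω ℝ × L2 Ω Plane} (hφ : φ ∈ Admissible Ω) {v : V Ω}
    (hv : IsStationaryState μ α f_s φ.1 v) {u g : V Ω} {F : L2 Ω Plane}
    (hu : ∀ ψ : V Ω, ⟪g, ψ⟫_ℝ + aForm μ α φ.1 u ψ + bForm (u : FieldPair Ω) u ψ =
      ∫ x in Ω, ⟪F x, ψ.1.fst x⟫_ℝ) :
    ⟪g, u - v⟫_ℝ ≤ c_P ^ 2 / μ * ‖F - f_s‖ ^ 2 - μ / (4 * c_P ^ 2) * ‖embedL Ω (u - v)‖ ^ 2 :=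
  coercivity_estimate hμ hP.1 hL.1 hsmall (norm_nonneg _) (norm_nonneg _) (norm_nonneg _)
    (stationary_bound hμ hP hL hα hv) (hP.2 _ (u - v).2.1)
    (abs_bForm_le_grad hP hL (u - v).2.1 (u - v).2.1)
    (real_inner_le_norm _ _) (inner_deriv_le_sub hL hα hφ hv hu)

/-- Squaring the smallness condition gives `4 c_P⁴ c_L² F² ≤ μ⁴`, so the rate is nonnegative and the
weight at least one. -/
theorem integral_norm_sq_sub_le {K F : ℝ} (hμ : 0 < μ) (hP : IsPoincareConstant Ω c_P)
    (hL : IsLadyzhenskayaConstant Ω c_L) {f_s : L2 Ω Plane}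
    (hF : F = ‖f_s‖) (hf : MemLp f 2 (timeMeasure 0 T))
    (hsmall : 2 * c_P ^ 2 * c_L * F < μ ^ 2)
    (hK : ∫ t in Ioo 0 T, Real.exp (decayRate μ c_P c_L F * t) * ‖f t - f_s‖ ^ 2 ≤ K) :
    ∫ t in Ioo 0 T, ‖f t - f_s‖ ^ 2 ≤ K := by
  have hF0 : 0 ≤ F := hF ▸ norm_nonneg f_s
  have hP0 := hP.1
  have hL0 := hL.1
  have hrate : 0 ≤ decayRate μ c_P c_L F := by
    refine div_nonneg ?_ (by positivity)
    have h := pow_le_pow_left₀ (by positivity) hsmall.le 2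
    nlinarith [sq_nonneg (c_L * c_P ^ 2 * F)]
  have hm : MemLp (fun t => f t - f_s) 2 (timeMeasure 0 T) := hf.sub (memLp_const _)
  have hi : Integrable (fun t => ‖f t - f_s‖ ^ 2) (timeMeasure 0 T) :=
    (memLp_two_iff_integrable_sq_norm hm.1).1 hm
  refine le_trans (setIntegral_mono_on hi ?_ measurableSet_Ioo fun t ht => ?_) hK
  · refine Integrable.bdd_mul (c := Real.exp (decayRate μ c_P c_L F * T)) hi
      (by fun_prop) ?_
    filter_upwards [ae_restrict_mem measurableSet_Ioo] with t ht
    rw [Real.norm_eq_abs, Real.abs_exp]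
    exact Real.exp_le_exp.2 (mul_le_mul_of_nonneg_left ht.2.le hrate)
  · exact le_mul_of_one_le_left (by positivity)
      (Real.one_le_exp (mul_nonneg hrate ht.1.le))

theorem embedL_sub_memLp {u : ℝ → V Ω} (hu : MemLp u 2 (timeMeasure 0 T)) (v : V Ω) :
    MemLp (fun t => embedL Ω (u t - v)) 2 (timeMeasure 0 T) :=
  (embedL Ω).comp_memLp' (hu.sub (memLp_const _))

/-- The distance to the stationary state is square integrable, uniformly in the time horizon and
in the design. -/
theorem turnpike (hT : 0 < T) (hμ : 0 < μ) (hP : IsPoincareConstant Ω c_P)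
    (hL : IsLadyzhenskayaConstant Ω c_L) (hα : IsPorousCoefficient α)
    {f_s : L2 Ω Plane} (hsmall : 2 * c_P ^ 2 * c_L * ‖f_s‖ < μ ^ 2)
    (hf : MemLp f 2 (timeMeasure 0 T)) {K : ℝ} (hK : ∫ t in Ioo 0 T, ‖f t - f_s‖ ^ 2 ≤ K)
    {φ : L2 Ω ℝ × L2 Ω Plane} (hφ : φ ∈ Admissible Ω) {v : V Ω}
    (hv : IsStationaryState μ α f_s φ.1 v) {u : ℝ → V Ω} (hu : IsTimeState μ α f u₀ T φ.1 u) :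
    ∫ t in Ioo 0 T, ‖embedL Ω (u t - v)‖ ^ 2 ≤
      2 * c_P ^ 2 / μ * ((‖u₀‖ + c_P * (c_P * ‖f_s‖ / μ)) ^ 2 + 2 * (c_P ^ 2 / μ * K)) := by
  obtain ⟨g, w, hd⟩ := hu.exists_data hT
  have hdm : MemLp (fun t => u t - v) 2 (timeMeasure 0 T) := hd.memLp_state.sub (memLp_const _)
  have hT' := right_mem_Icc.2 hT.le
  -- Since `v` is constant in time, `u - v` has the derivative `g`. One integration of
  -- `inner_deriv_le` suffices: the final value is dropped, and the initial one is bounded uniformly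
  -- in the design by `stationary_bound`.
  have h1 := norm_sq_sub_norm_sq_eq (ι := embedL Ω) (w := fun t => w t - embedL Ω v) hdm
    hd.memLp_deriv (hd.continuousOn.sub continuousOn_const)
    (by filter_upwards [hd.ae_eq] with t ht; rw [ht, map_sub])
    (fun t ht ψ => by rw [sub_sub_sub_cancel_right]; exact hd.increment t ht ψ) hT'
  have hm : MemLp (fun t => f t - f_s) 2 (timeMeasure 0 T) := hf.sub (memLp_const _)
  have hi : Integrable (fun t => ‖f t - f_s‖ ^ 2) (timeMeasure 0 T) :=
    (memLp_two_iff_integrable_sq_norm hm.1).1 hm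
  have hem := embedL_sub_memLp hd.memLp_state v
  have hi' : Integrable (fun t => ‖embedL Ω (u t - v)‖ ^ 2) (timeMeasure 0 T) :=
    (memLp_two_iff_integrable_sq_norm hem.1).1 hem
  have h2 : ∫ t in Ioo 0 T, ⟪g t, u t - v⟫_ℝ ≤ c_P ^ 2 / μ * (∫ t in Ioo 0 T, ‖f t - f_s‖ ^ 2) -
      μ / (4 * c_P ^ 2) * ∫ t in Ioo 0 T, ‖embedL Ω (u t - v)‖ ^ 2 := by
    rw [← integral_const_mul, ← integral_const_mul, ← integral_sub (hi.const_mul _)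
      (hi'.const_mul _)]
    refine integral_mono_ae (integrable_inner_of_memLp hd.memLp_deriv hdm)
      ((hi.const_mul _).sub (hi'.const_mul _)) ?_
    filter_upwards [hd.equation] with t ht
    exact inner_deriv_le hμ hP hL hα hsmall hφ hv ht
  rw [integral_Ioo_eq_intervalIntegral (fun t => ⟪g t, u t - v⟫_ℝ) hT.le] at h2
  have h3 : ‖w 0 - embedL Ω v‖ ≤ ‖u₀‖ + c_P * (c_P * ‖f_s‖ / μ) := by
    rw [hd.initial]
    refine (norm_sub_le _ _).trans (add_le_add le_rfl ?_)
    exact (hP.2 v.1 v.2.1).trans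
      (mul_le_mul_of_nonneg_left (stationary_bound hμ hP hL hα hv) hP.1.le)
  have h4 := pow_le_pow_left₀ (norm_nonneg _) h3 2
  have hP0 := hP.1
  have h5 := mul_le_mul_of_nonneg_left hK (by positivity : 0 ≤ c_P ^ 2 / μ)
  have h6 := sq_nonneg ‖w T - embedL Ω v‖
  generalize ∫ t in Ioo 0 T, ‖embedL Ω (u t - v)‖ ^ 2 = I at *
  have h7 : μ / (2 * c_P ^ 2) * I ≤
      (‖u₀‖ + c_P * (c_P * ‖f_s‖ / μ)) ^ 2 + 2 * (c_P ^ 2 / μ * K) := by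
    have : μ / (2 * c_P ^ 2) * I = 2 * (μ / (4 * c_P ^ 2) * I) := by field_simp; ring
    linarith
  have h8 := mul_le_mul_of_nonneg_left h7 (by positivity : 0 ≤ 2 * c_P ^ 2 / μ)
  have h9 : 2 * c_P ^ 2 / μ * (μ / (2 * c_P ^ 2) * I) = I := by field_simp
  linarith

end Turnpike

/-! ### Comparison of the objectives -/

section Cost

theorem abs_quadratic_sub_le {X : Type*} [NormedAddCommGroup X] [InnerProductSpace ℝ X]
    {S : X →L[ℝ] X} {M : ℝ} (hS : ∀ x, ‖S x‖ ≤ M * ‖x‖) (x y : X) :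
    |⟪S x, x⟫_ℝ - ⟪S y, y⟫_ℝ| ≤ M * ‖x - y‖ ^ 2 + 2 * (M * ‖y‖) * ‖x - y‖ := by
  have e : ⟪S x, x⟫_ℝ - ⟪S y, y⟫_ℝ =
      ⟪S (x - y), x - y⟫_ℝ + ⟪S y, x - y⟫_ℝ + ⟪S (x - y), y⟫_ℝ := by
    rw [map_sub, inner_sub_right, inner_sub_right, inner_sub_left, inner_sub_left]
    ring
  rw [e]
  have h1 := (abs_real_inner_le_norm (S (x - y)) (x - y)).trans
    (mul_le_mul_of_nonneg_right (hS (x - y)) (norm_nonneg _))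
  have h2 := (abs_real_inner_le_norm (S y) (x - y)).trans
    (mul_le_mul_of_nonneg_right (hS y) (norm_nonneg _))
  have h3 := (abs_real_inner_le_norm (S (x - y)) y).trans
    (mul_le_mul_of_nonneg_right (hS (x - y)) (norm_nonneg _))
  have h4 := abs_add_three (⟪S (x - y), x - y⟫_ℝ) (⟪S y, x - y⟫_ℝ) (⟪S (x - y), y⟫_ℝ)
  nlinarith

variable {Ω D : Set Plane} {β : ℝ → ℝ}

theorem exists_extension (hD : MeasurableSet D) (u_d : L2 D Plane) :
    ∃ e : L2 Ω Plane, e =ᵐ[volume.restrict Ω] D.indicator u_d := by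
  have h : MemLp (D.indicator u_d) 2 (volume.restrict Ω) :=
    ((memLp_indicator_iff_restrict hD).2 (Lp.memLp u_d)).mono_measure Measure.restrict_le_self
  exact ⟨h.toLp _, h.coeFn_toLp⟩

/-- The running cost is a sum of two quadratic forms. -/
theorem exists_runningCost_eq (hD : MeasurableSet D) (hβ : IsPorousCoefficient β) {M : ℝ}
    (hM : ∀ s, |s| ≤ 1 → |β s| ≤ M) {u_d : L2 D Plane} {e : L2 Ω Plane}
    (he : e =ᵐ[volume.restrict Ω] D.indicator u_d) {φ : L2 Ω ℝ × L2 Ω Plane}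
    (hφ : φ ∈ Admissible Ω) :
    ∃ S R : L2 Ω Plane →L[ℝ] L2 Ω Plane, (∀ x, ‖S x‖ ≤ 1 * ‖x‖) ∧ (∀ x, ‖R x‖ ≤ M * ‖x‖) ∧
      ∀ x, runningCost β u_d φ.1 x = ⟪S (x - e), x - e⟫_ℝ + ⟪R x, x⟫_ℝ := by
  have hφm := Lp.aestronglyMeasurable φ.1
  obtain ⟨R, hR, hRM⟩ := exists_mul_operator (M := M) (hβ.aestronglyMeasurable_comp φ.1)
    (by filter_upwards [hφ.2] with x hx using hM _ hx)
  -- `|φ| ≤ 1` keeps the weight `(φ + 1) / 2` in `[0, 1]`, whence norm one for every design. The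
  -- indicator in the weight allows the extension of `u_d` by zero.
  obtain ⟨S, hS, hSM⟩ := exists_mul_operator (M := 1) (D := Ω)
    (θ := D.indicator fun x => (φ.1 x + 1) / 2)
    (((by fun_prop : Continuous fun s : ℝ => (s + 1) / 2).comp_aestronglyMeasurable hφm).indicator hD)
    (by
      filter_upwards [hφ.2] with x hx
      rw [abs_le] at hx
      by_cases hxD : x ∈ D
      · rw [indicator_of_mem hxD, abs_le]
        constructor <;> linarith [hx.1, hx.2]
      · rw [indicator_of_notMem hxD]; simp)
  refine ⟨S, R, hSM, hRM, fun x => ?_⟩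
  rw [runningCost, L2.inner_def, L2.inner_def]
  congr 1
  · refine integral_congr_ae ?_
    filter_upwards [hS (x - e), Lp.coeFn_sub x e, he] with y h1 h2 h3
    rw [h1, h2, Pi.sub_apply, h3, real_inner_smul_left, real_inner_self_eq_norm_sq]
    by_cases hy : y ∈ D
    · simp only [indicator_of_mem hy]
    · simp only [indicator_of_notMem hy, zero_mul]
  · refine integral_congr_ae ?_
    filter_upwards [hR x] with y h1
    rw [h1, real_inner_smul_left, real_inner_self_eq_norm_sq]

theorem continuous_runningCost (hD : MeasurableSet D) (hβ : IsPorousCoefficient β)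
    (u_d : L2 D Plane) {φ : L2 Ω ℝ × L2 Ω Plane} (hφ : φ ∈ Admissible Ω) :
    Continuous fun x : L2 Ω Plane => runningCost β u_d φ.1 x := by
  obtain ⟨M, -, hM⟩ := hβ.exists_bound
  obtain ⟨e, he⟩ := exists_extension (Ω := Ω) hD u_d
  obtain ⟨S, R, -, -, h⟩ := exists_runningCost_eq hD hβ hM he hφ
  simp only [h]
  fun_prop

/-- The running cost is locally Lipschitz, uniformly in the design. -/
theorem exists_runningCost_sub_le (hD : MeasurableSet D) (hβ : IsPorousCoefficient β)
    (u_d : L2 D Plane) (r : ℝ) : ∃ k, 0 < k ∧ ∀ φ ∈ Admissible Ω, ∀ x y : L2 Ω Plane, ‖y‖ ≤ r →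
      |runningCost β u_d φ.1 x - runningCost β u_d φ.1 y| ≤ k * (‖x - y‖ ^ 2 + ‖x - y‖) := by
  obtain ⟨M, hM0, hM⟩ := hβ.exists_bound
  obtain ⟨e, he⟩ := exists_extension (Ω := Ω) hD u_d
  -- `1 + M` bounds the quadratic terms of the two forms, the other summands their linear terms.
  -- `|r|` keeps the constant positive for every `r`.
  refine ⟨1 + M + 2 * (|r| + ‖e‖) + 2 * (M * |r|), by positivity, fun φ hφ x y hy => ?_⟩
  obtain ⟨S, R, hS, hR, h⟩ := exists_runningCost_eq hD hβ hM he hφ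
  rw [h, h]
  have h1 := abs_quadratic_sub_le hS (x - e) (y - e)
  have h2 := abs_quadratic_sub_le hR x y
  rw [sub_sub_sub_cancel_right] at h1
  have hy' : ‖y‖ ≤ |r| := hy.trans (le_abs_self r)
  have h3 : ‖y - e‖ ≤ |r| + ‖e‖ := (norm_sub_le _ _).trans (by linarith)
  have h4 := abs_add_le (⟪S (x - e), x - e⟫_ℝ - ⟪S (y - e), y - e⟫_ℝ) (⟪R x, x⟫_ℝ - ⟪R y, y⟫_ℝ)
  rw [add_sub_add_comm]
  have d0 := norm_nonneg (x - y)
  have h5 := mul_le_mul_of_nonneg_right h3 d0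
  have h6 := mul_le_mul_of_nonneg_right (mul_le_mul_of_nonneg_left hy' hM0) d0
  have p1 : 0 ≤ (2 * (|r| + ‖e‖) + 2 * (M * |r|)) * ‖x - y‖ ^ 2 := by positivity
  have p2 : 0 ≤ (1 + M) * ‖x - y‖ := by positivity
  linarith

end Cost

/-! ### Time averages and the objectives for a common design -/

section Objectives

variable {Ω D : Set Plane} {c_P c_L μ : ℝ} {α β : ℝ → ℝ}

/-- Averaging a locally Lipschitz function of a square-integrable quantity. -/
theorem average_le {T C k : ℝ} (hT : 0 < T) (hk : 0 ≤ k) {d r : ℝ → ℝ}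
    (hd : Integrable (fun t => d t ^ 2) (timeMeasure 0 T)) (hC : ∫ t in Ioo 0 T, d t ^ 2 ≤ C)
    (hr : ∀ᵐ t ∂(timeMeasure 0 T), |r t| ≤ k * (d t ^ 2 + d t)) :
    |1 / T * ∫ t in Ioo 0 T, r t| ≤ k * (C + 1) * (1 / √T + 1 / T) := by
  have hs : 0 < √T := Real.sqrt_pos.2 hT
  have hss : √T * √T = T := Real.mul_self_sqrt hT.le
  have hC0 : 0 ≤ C := le_trans (integral_nonneg fun t => sq_nonneg _) hC
  have h1 : |∫ t in Ioo 0 T, r t| ≤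
      ∫ t in Ioo 0 T, k * ((1 + √T / 2) * d t ^ 2 + 1 / (2 * √T)) := by
    rw [← Real.norm_eq_abs]
    refine norm_integral_le_of_norm_le
      (((hd.const_mul _).add (integrable_const _)).const_mul k) ?_
    filter_upwards [hr] with t ht
    refine ht.trans (mul_le_mul_of_nonneg_left ?_ hk)
    -- Young's inequality with weight `√T`: after division by `T`, the integrals of both terms are
    -- of order `1 / √T`.
    have : √T / 2 * d t ^ 2 + 1 / (2 * √T) - d t = (√T * d t - 1) ^ 2 / (2 * √T) := by
      field_simp; ring
    have : 0 ≤ (√T * d t - 1) ^ 2 / (2 * √T) := by positivity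
    linarith
  rw [integral_const_mul, integral_add (hd.const_mul _) (integrable_const _), integral_const_mul,
    setIntegral_const, Real.volume_real_Ioo_of_le hT.le, sub_zero, smul_eq_mul] at h1
  have h2 : k * ((1 + √T / 2) * (∫ t in Ioo 0 T, d t ^ 2) + T * (1 / (2 * √T))) ≤
      k * ((1 + √T / 2) * C + √T / 2) := by
    refine mul_le_mul_of_nonneg_left (add_le_add (mul_le_mul_of_nonneg_left hC (by positivity)) ?_)
      hk
    refine le_of_eq ?_
    field_simp
    rw [sq, hss]
  rw [abs_mul, abs_of_pos (by positivity : 0 < 1 / T)]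
  have h3 := mul_le_mul_of_nonneg_left (h1.trans h2) (by positivity : 0 ≤ 1 / T)
  have h4 : 1 / T * √T = 1 / √T := by
    field_simp
    rw [sq, hss]
  have h5 : 1 / T * (k * ((1 + √T / 2) * C + √T / 2)) =
      k * (C / T + (C + 1) / 2 * (1 / T * √T)) := by
    ring
  rw [h5, h4] at h3
  refine h3.trans ?_
  rw [mul_assoc]
  refine mul_le_mul_of_nonneg_left ?_ hk
  have q1 : 0 ≤ (C + 1) / 2 * (1 / √T) := by positivity
  have q2 : 0 ≤ 1 / T := by positivity
  have q3 : C / T = C * (1 / T) := by ring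
  rw [q3]
  linarith

/-- The objectives of both problems differ little for states that belong to the same design. -/
theorem exists_objective_sub_le (ε γ : ℝ) (hD : MeasurableSet D) (hμ : 0 < μ)
    (hα : IsPorousCoefficient α) (hβ : IsPorousCoefficient β) (u_d : L2 D Plane)
    (u₀ f_s : L2 Ω Plane) (f : ℝ → L2 Ω Plane)
    (hf : ∀ T : ℝ, 0 < T → MemLp f 2 (volume.restrict (Ioo 0 T)))
    (hP : IsPoincareConstant Ω c_P) (hL : IsLadyzhenskayaConstant Ω c_L)
    (hsmall : 2 * c_P ^ 2 * c_L * ‖f_s‖ < μ ^ 2)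
    (hsource : ∃ K : ℝ, 0 < K ∧ ∀ T : ℝ, 0 < T →
      ∫ t in Ioo 0 T, Real.exp (decayRate μ c_P c_L ‖f_s‖ * t) * ‖f t - f_s‖ ^ 2 ≤ K) :
    ∃ c, 0 < c ∧ ∀ T : ℝ, 0 < T → ∀ φ ∈ Admissible Ω, ∀ (u : ℝ → V Ω) (v : V Ω),
      IsTimeState μ α f u₀ T φ.1 u → IsStationaryState μ α f_s φ.1 v →
      |JT ε γ β u_d T u φ - Js ε γ β u_d v φ| ≤ c * (1 / √T + 1 / T) := by
  obtain ⟨K, hK0, hK⟩ := hsource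
  obtain ⟨k, hk, hcost⟩ := exists_runningCost_sub_le (Ω := Ω) hD hβ u_d (c_P * (c_P * ‖f_s‖ / μ))
  have hP0 := hP.1
  set C := 2 * c_P ^ 2 / μ * ((‖u₀‖ + c_P * (c_P * ‖f_s‖ / μ)) ^ 2 + 2 * (c_P ^ 2 / μ * K)) with hC
  have hC0 : 0 ≤ C := by positivity
  refine ⟨k * (C + 1), by positivity, fun T hT φ hφ u v hu hv => ?_⟩
  have hInt := turnpike hT hμ hP hL hα hsmall (hf T hT)
    (integral_norm_sq_sub_le hμ hP hL rfl (hf T hT) hsmall (hK T hT)) hφ hv hu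
  have hem := embedL_sub_memLp hu.memLp v
  have hi : Integrable (fun t => ‖embedL Ω (u t - v)‖ ^ 2) (timeMeasure 0 T) :=
    (memLp_two_iff_integrable_sq_norm hem.1).1 hem
  have hvr : ‖v.1.fst‖ ≤ c_P * (c_P * ‖f_s‖ / μ) := (hP.2 v.1 v.2.1).trans
    (mul_le_mul_of_nonneg_left (stationary_bound hμ hP hL hα hv) hP.1.le)
  have hdiff : ∀ t, |runningCost β u_d φ.1 (u t).1.fst - runningCost β u_d φ.1 v.1.fst| ≤
      k * (‖embedL Ω (u t - v)‖ ^ 2 + ‖embedL Ω (u t - v)‖) := by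
    intro t
    rw [map_sub (embedL Ω), embedL_apply, embedL_apply]
    exact hcost φ hφ _ _ hvr
  have hmeas : AEStronglyMeasurable (fun t => runningCost β u_d φ.1 (u t).1.fst)
      (timeMeasure 0 T) :=
    (continuous_runningCost hD hβ u_d hφ).comp_aestronglyMeasurable
      ((embedL Ω).continuous.comp_aestronglyMeasurable hu.memLp.1)
  have hci : Integrable (fun t => runningCost β u_d φ.1 (u t).1.fst -
      runningCost β u_d φ.1 v.1.fst) (timeMeasure 0 T) :=
    Integrable.mono' ((hi.add (hem.norm.integrable one_le_two)).const_mul k)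
      (hmeas.sub aestronglyMeasurable_const) (Filter.Eventually.of_forall hdiff)
  have h1 := average_le hT hk.le hi hInt (Filter.Eventually.of_forall hdiff)
  -- The Ginzburg-Landau terms cancel, and the stationary cost is its own time average.
  have h2 : JT ε γ β u_d T u φ - Js ε γ β u_d v φ = 1 / T * ∫ t in Ioo 0 T,
      (runningCost β u_d φ.1 (u t).1.fst - runningCost β u_d φ.1 v.1.fst) := by
    have h3 : ∫ t in Ioo 0 T, runningCost β u_d φ.1 (u t).1.fst = (∫ t in Ioo 0 T,
        (runningCost β u_d φ.1 (u t).1.fst - runningCost β u_d φ.1 v.1.fst)) +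
        T * runningCost β u_d φ.1 v.1.fst := by
      have h4 : ∫ _ in Ioo 0 T, runningCost β u_d φ.1 v.1.fst =
          T * runningCost β u_d φ.1 v.1.fst := by
        rw [setIntegral_const, Real.volume_real_Ioo_of_le hT.le, sub_zero, smul_eq_mul]
      rw [← h4, ← integral_add hci (integrable_const _)]
      simp only [sub_add_cancel]
    rw [JT, Js, h3]
    field_simp
    ring
  rw [h2]
  exact h1

end Objectives

end PhaseFieldNS

end

/-! ### Comparison of the two minimizers -/

open PhaseFieldNS
theorem theorem5p1
    (Ω D : Set Plane) (hΩ_open : IsOpen Ω) (hΩ_bdd : Bornology.IsBounded Ω)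
    (hD_meas : MeasurableSet D) (hD_sub : D ⊆ Ω)
    (ε γ μ : ℝ) (hε : 0 < ε) (hγ : 0 < γ) (hμ : 0 < μ)
    (α β : ℝ → ℝ) (hα : IsPorousCoefficient α) (hβ : IsPorousCoefficient β)
    (u_d : L2 D Plane) (u₀ : L2 Ω Plane) (hu₀ : u₀ ∈ H Ω)
    (f_s : L2 Ω Plane) (f : ℝ → L2 Ω Plane)
    (hf : ∀ T : ℝ, 0 < T → MemLp f 2 (volume.restrict (Ioo 0 T)))
    (c_P c_L : ℝ) (hP : IsPoincareConstant Ω c_P) (hL : IsLadyzhenskayaConstant Ω c_L)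
    (hsmall : 2 * c_P ^ 2 * c_L * ‖f_s‖ < μ ^ 2)
    (hsource : ∃ K : ℝ, 0 < K ∧ ∀ T : ℝ, 0 < T →
      ∫ t in Ioo 0 T, Real.exp (decayRate μ c_P c_L ‖f_s‖ * t) * ‖f t - f_s‖ ^ 2 ≤ K) :
    ∃ c : ℝ, 0 < c ∧ ∀ T : ℝ, 0 < T →
      ∀ (φT : L2 Ω ℝ × L2 Ω Plane) (uT : ℝ → V Ω) (φs : L2 Ω ℝ × L2 Ω Plane) (vs : V Ω),
        IsTimeMinimizer ε γ μ α β u_d f u₀ T φT uT →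
        IsStationaryMinimizer ε γ μ α β u_d f_s φs vs →
        |JT ε γ β u_d T uT φT - Js ε γ β u_d vs φs| ≤ c * (1 / √T + 1 / T) := by
  obtain ⟨c, hc, H⟩ := exists_objective_sub_le ε γ hD_meas hμ hα hβ u_d u₀ f_s f hf hP hL hsmall
    hsource
  refine ⟨c, hc, fun T hT φT uT φs vs hTm hsm => ?_⟩
  obtain ⟨v, hv⟩ := exists_stationaryState hμ hP hL hα hsmall hTm.admissible
  -- The state `uT` is the starting point of the continuation to the design `φs`, so existence for
  -- the initial value `u₀` is inherited from it.
  obtain ⟨u, hu⟩ := exists_timeState hT hμ hP hL hα hTm.admissible hsm.admissible hTm.state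
  have h1 := abs_le.1 (H T hT φT hTm.admissible uT v hTm.state hv)
  have h2 := abs_le.1 (H T hT φs hsm.admissible u vs hu hsm.state)
  have h3 := hTm.minimal φs hsm.admissible u hu
  have h4 := hsm.minimal φT hTm.admissible v hv
  -- The lower bound compares both problems at `φT` and uses minimality of `φs`; the upper bound
  -- compares them at `φs` and uses minimality of `φT`.
  exact abs_le.2 ⟨by linarith [h1.1], by linarith [h2.2]⟩
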